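/- **Conventions.** A simplicial complex on a finite set $S$ is a family of subsets of $S$ closed under taking subsets; the void complex $\{\,\}$ and $\{\emptyset\}$ are allowed, and not every element of $S$ need be a vertex. Let $R$ be $\mathbb Z$ or a field. $\tilde H_*(-)$ and $\tilde H^*(-)$ are reduced simplicial homology and cohomology with coefficients in $R$ (the empty simplex has degree $-1$, and $\tilde H_*(\{\,\})=0$). $\Sigma$ is suspension: $(\Sigma G)_b=G_{b-1}$, and likewise for upper degrees. **Polyhedral join complexes.** Let $[n]=[n_1]\sqcup\cdots\sqcup[n_m]$, let $K$ be a simplicial complex on $[m]$, and for $k=1,\dots,m$ let $A_k\subset X_k$ be simplicial complexes on $[n_k]$. The polyhedral join complex is $$\mathcal S(K;\underline X,\underline A)=\bigcup_{\tau\in K}\{\sigma\subset[n] : \sigma\cap[n_k]\in X_k \text{ for } k\in\tau,\ \sigma\cap[n_k]\in A_k\text{ for }k\notin\tau\}.$$ Let $\iota_k:\tilde H_*(A_k)\to\tilde H_*(X_k)$ and $\iota_k^\circ:\tilde H^*(X_k)\to\tilde H^*(A_k)$ be induced by inclusion. $\mathcal S(K;\underline X,\underline A)$ is *homology split* if, for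 $R=\mathbb Z$, the groups $\ker\iota_k$, $\operatorname{coker}\iota_k$, $\operatorname{im}\iota_k$ are free for every $k$. **Index sets.** Let $\mathcal X=\{(\emptyset,\emptyset),(\emptyset,\{1\}),(\{1\},\emptyset)\}$ and $\mathcal R=\{(\emptyset,\emptyset),(\emptyset,\{1\})\}$. Let $\mathcal X_m$ be the set of pairs $(\sigma,\omega)$ of disjoint subsets of $[m]$, identified with $\mathcal X^m$ by $\sigma=\{k: s_k=(\{1\},\emptyset)\}$, $\omega=\{k:s_k=(\emptyset,\{1\})\}$; let $\mathcal R_m\subset\mathcal X_m$ correspond to $\mathcal R^m$ (that is, $\sigma=\emptyset$). **Total (co)homology of $K$.** Let $T_*$ be the chain complex with basis $\alpha,\beta,\gamma,\eta$, $|\alpha|=|\gamma|=|\eta|=0$, $|\beta|=1$, $d\beta=\gamma$, where $\alpha$ has index $(\{1\},\emptyset)$, $\beta$ and $\gamma$ have index $(\emptyset,\{1\})$, and $\eta$ has index $(\emptyset,\emptyset)$; let $S_*\subset T_*$ be spanned by $\gamma,\eta$. Let $T_*(K)\subset T_*^{\otimes m}$ be the sum over $\tau\in K$ of the subcomplexes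 $U_1\otimes\cdots\otimes U_m$ with $U_k=T_*$ for $k\in\tau$ and $U_k=S_*$ for $k\notin\tau$. It splits as $\bigoplus_{(\sigma,\omega)\in\mathcal X_m}T_*^{\sigma,\omega}(K)$. Let $H_*^{\sigma,\omega}(K)$ be the homology of $T_*^{\sigma,\omega}(K)$ and $H^*_{\sigma,\omega}(K)$ the cohomology of its dual. **Character groups.** For $s=(\{1\},\emptyset),\ (\emptyset,\{1\}),\ (\emptyset,\emptyset)$ respectively, let $$H_*^s(X_k,A_k)=\Sigma\operatorname{coker}\iota_k,\ \Sigma\ker\iota_k,\ \Sigma\operatorname{im}\iota_k,\qquad H^*_s(X_k,A_k)=\Sigma\ker\iota_k^\circ,\ \Sigma\operatorname{coker}\iota_k^\circ,\ \Sigma\operatorname{im}\iota_k^\circ .$$ For $\Lambda\in\{\mathcal X,\mathcal R\}$ put $H_*^{\Lambda}(X_k,A_k)=\bigoplus_{s\in\Lambda}H_*^s(X_k,A_k)$ and $H_*^{\Lambda_m}(K)=\bigoplus_{(\sigma,\omega)\in\Lambda_m}H_*^{\sigma,\omega}(K)$, and similarly in cohomology. For groups indexed by the same set, $\widehat\otimes$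 is the diagonal tensor product $\bigl(\bigoplus_\lambda P^\lambda\bigr)\widehat\otimes\bigl(\bigoplus_\lambda Q^\lambda\bigr)=\bigoplus_\lambda P^\lambda\otimes Q^\lambda$, with the total grading. **Theorem 3.9.** If $\mathcal S(K;\underline X,\underline A)$ is homology split, then with $R=\mathbb Z$ there are isomorphisms of graded groups $$\tilde H_{*-1}(\mathcal S(K;\underline X,\underline A))\cong H_*^{\mathcal X_m}(K)\,\widehat\otimes\,\bigl(H_*^{\mathcal X}(X_1,A_1)\otimes\cdots\otimes H_*^{\mathcal X}(X_m,A_m)\bigr),$$ $$\tilde H^{*-1}(\mathcal S(K;\underline X,\underline A))\cong H^*_{\mathcal X_m}(K)\,\widehat\otimes\,\bigl(H^*_{\mathcal X}(X_1,A_1)\otimes\cdots\otimes H^*_{\mathcal X}(X_m,A_m)\bigr).$$ If moreover every $\iota_k$ is an epimorphism, then both isomorphisms also hold with $\mathcal R$ in place of $\mathcal X$ (and $\mathcal R_m$ in place of $\mathcal X_m$), and $H_*^{\mathcal R}(X_k,A_k)\cong\tilde H_{*-1}(A_k)$ and $H^*_{\mathcal R}(X_k,A_k)\cong\tilde H^{*-1}(A_k)$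 for every $k$. If $R$ is a field, all these conclusions hold (as isomorphisms of graded vector spaces) for every polyhedral join complex $\mathcal S(K;\underline X,\underline A)$, with no splitting hypothesis. -/

import Mathlib

open CategoryTheory
open scoped TensorProduct DirectSum

universe u

namespace PolyJoin

/-! ### Chain complexes with alternating-sign boundary -/

/-- A family of generators `g`, each with a finite set `verts g` of totally ordered vertices, and for
every vertex `v` of `g` a face `face g v` (the face obtained by removing the vertex `v`). -/
structure FaceSystem (V : Type) [LinearOrder V] where
  Gen : Type
  verts : Gen → Finset V
  face : Gen → V → Gen
  verts_face : ∀ g v, v ∈ verts g → verts (face g v) = (verts g).erase v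
  face_comm : ∀ g v w, v ∈ verts g → w ∈ verts g → v ≠ w →
    face (face g v) w = face (face g w) v

namespace FaceSystem

variable {V : Type} [LinearOrder V]

/-- The sign `(-1)^i`, where `i` is the number of vertices of `s` that precede `v`. -/
def sgn (s : Finset V) (v : V) : ℤ := (-1) ^ (s.filter (fun u => u < v)).card

theorem sgn_swap (s : Finset V) {v w : V} (hv : v ∈ s) (h : v < w) :
    sgn s v * sgn (s.erase v) w + sgn s w * sgn (s.erase w) v = 0 := by
  have h1 : (s.erase w).filter (fun u => u < v) = s.filter (fun u => u < v) := by
    ext u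
    simp only [Finset.mem_filter, Finset.mem_erase]
    constructor
    · rintro ⟨⟨_, a⟩, b⟩; exact ⟨a, b⟩
    · rintro ⟨a, b⟩; exact ⟨⟨(b.trans h).ne, a⟩, b⟩
  have h2 : s.filter (fun u => u < w) = insert v ((s.erase v).filter (fun u => u < w)) := by
    ext u
    simp only [Finset.mem_filter, Finset.mem_erase, Finset.mem_insert]
    constructor
    · rintro ⟨a, b⟩
      by_cases huv : u = v
      · exact Or.inl huv
      · exact Or.inr ⟨⟨huv, a⟩, b⟩
    · rintro (rfl | ⟨⟨_, a⟩, b⟩)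
      · exact ⟨hv, h⟩
      · exact ⟨a, b⟩
  have h3 : v ∉ (s.erase v).filter (fun u => u < w) := by simp
  unfold sgn
  rw [h1, h2, Finset.card_insert_of_notMem h3]
  ring

variable (R : Type u) [CommRing R] (F : FaceSystem V) (c : ℤ)

/-- The generators of degree `q`: those with `q + c` vertices. -/
abbrev GenDeg (q : ℤ) : Type := {g : F.Gen // ((F.verts g).card : ℤ) = q + c}

/-- The boundary of a generator, `∂ g = ∑ᵢ (-1)^i (face of g without its i-th vertex)`; only the
terms of degree `q` are kept. -/
noncomputable def bd (p q : ℤ) (g : F.GenDeg c p) : F.GenDeg c q →₀ R :=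
  ∑ v ∈ F.verts g.1,
    if h : ((F.verts (F.face g.1 v)).card : ℤ) = q + c then
      Finsupp.single ⟨F.face g.1 v, h⟩ ((sgn (F.verts g.1) v : ℤ) : R)
    else 0

noncomputable def d (p q : ℤ) : (F.GenDeg c p →₀ R) →ₗ[R] (F.GenDeg c q →₀ R) :=
  Finsupp.linearCombination R (F.bd R c p q)

theorem card_face (g : F.Gen) {v : V} (hv : v ∈ F.verts g) :
    ((F.verts (F.face g v)).card : ℤ) = (F.verts g).card - 1 := by
  rw [F.verts_face g v hv, Finset.card_erase_of_mem hv]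
  have : 0 < (F.verts g).card := Finset.card_pos.mpr ⟨v, hv⟩
  omega

theorem bd_eq_zero (p q : ℤ) (h : q + 1 ≠ p) (g : F.GenDeg c p) : F.bd R c p q g = 0 := by
  refine Finset.sum_eq_zero fun v hv => dif_neg ?_
  rw [F.card_face g.1 hv, g.2]
  omega

theorem d_eq_zero (p q : ℤ) (h : q + 1 ≠ p) : F.d R c p q = 0 := by
  ext g : 2
  simp [d, F.bd_eq_zero R c p q h]

theorem d_comp_d (p q r : ℤ) : (F.d R c q r) ∘ₗ (F.d R c p q) = 0 := by
  by_cases hpq : q + 1 = p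
  swap
  · rw [F.d_eq_zero R c p q hpq, LinearMap.comp_zero]
  by_cases hqr : r + 1 = q
  swap
  · rw [F.d_eq_zero R c q r hqr, LinearMap.zero_comp]
  ext g : 2
  have key : ∀ v, v ∈ F.verts g.1 → ((F.verts (F.face g.1 v)).card : ℤ) = q + c := by
    intro v hv
    rw [F.card_face g.1 hv, g.2]; omega
  have key2 : ∀ v, v ∈ F.verts g.1 → ∀ w, w ∈ (F.verts g.1).erase v →
      ((F.verts (F.face (F.face g.1 v) w)).card : ℤ) = r + c := by
    intro v hv w hw
    rw [F.card_face, key v hv]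
    · omega
    · rwa [F.verts_face _ _ hv]
  let T : V → V → (F.GenDeg c r →₀ R) := fun v w =>
    if h : ((F.verts (F.face (F.face g.1 v) w)).card : ℤ) = r + c then
      Finsupp.single ⟨F.face (F.face g.1 v) w, h⟩
        (((sgn (F.verts g.1) v * sgn ((F.verts g.1).erase v) w : ℤ)) : R)
    else 0
  have e1 : ((F.d R c q r) ∘ₗ (F.d R c p q)) (Finsupp.single g 1)
      = ∑ v ∈ F.verts g.1, ∑ w ∈ (F.verts g.1).erase v, T v w := by
    simp only [d, LinearMap.comp_apply, Finsupp.linearCombination_single, one_smul]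
    conv_lhs => rw [bd, map_sum]
    refine Finset.sum_congr rfl fun v hv => ?_
    rw [dif_pos (key v hv), Finsupp.linearCombination_single, bd, Finset.smul_sum]
    refine Finset.sum_congr (F.verts_face _ _ hv) fun w hw => ?_
    dsimp only [T]
    rw [dif_pos (key2 v hv w hw), dif_pos (key2 v hv w hw), Finsupp.smul_single, smul_eq_mul,
      F.verts_face _ _ hv]
    push_cast
    rfl
  have hT : ∀ v ∈ F.verts g.1, ∀ w ∈ F.verts g.1, v ≠ w → T v w + T w v = 0 := by
    intro v hv w hw hvw
    have a := key2 v hv w (Finset.mem_erase.mpr ⟨hvw.symm, hw⟩)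
    have b := key2 w hw v (Finset.mem_erase.mpr ⟨hvw, hv⟩)
    have hs : sgn (F.verts g.1) v * sgn ((F.verts g.1).erase v) w
        + sgn (F.verts g.1) w * sgn ((F.verts g.1).erase w) v = 0 := by
      rcases lt_or_gt_of_ne hvw with h | h
      · exact sgn_swap _ hv h
      · rw [add_comm]; exact sgn_swap _ hw h
    have hg : (⟨F.face (F.face g.1 v) w, a⟩ : F.GenDeg c r) = ⟨F.face (F.face g.1 w) v, b⟩ :=
      Subtype.ext (F.face_comm g.1 v w hv hw hvw)
    dsimp only [T]
    rw [dif_pos a, dif_pos b, hg, ← Finsupp.single_add, ← Int.cast_add, hs]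
    simp
  have e2 : ∑ v ∈ F.verts g.1, ∑ w ∈ (F.verts g.1).erase v, T v w = 0 := by
    rw [Finset.sum_sigma']
    refine Finset.sum_involution (fun x _ => ⟨x.2, x.1⟩) ?_ ?_ ?_ ?_
    · rintro ⟨v, w⟩ h
      simp only [Finset.mem_sigma, Finset.mem_erase] at h
      exact hT v h.1 w h.2.2 (Ne.symm h.2.1)
    · rintro ⟨v, w⟩ h _ he
      simp only [Finset.mem_sigma, Finset.mem_erase] at h
      exact h.2.1 (congrArg Sigma.fst he)
    · rintro ⟨v, w⟩ h
      simp only [Finset.mem_sigma, Finset.mem_erase] at h ⊢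
      exact ⟨h.2.2, Ne.symm h.2.1, h.1⟩
    · rintro ⟨v, w⟩ _
      rfl
  simpa using e1.trans e2

/-- The chain complex of `R`-modules freely generated by the generators of `F`, a generator with `k`
vertices having degree `k - c`. -/
noncomputable def complex : ChainComplex (ModuleCat.{u} R) ℤ where
  X q := ModuleCat.of R (F.GenDeg c q →₀ R)
  d p q := ModuleCat.ofHom (F.d R c p q)
  shape p q h := by
    rw [F.d_eq_zero R c p q h]; rfl
  d_comp_d' p q r _ _ := by
    rw [← ModuleCat.ofHom_comp, F.d_comp_d R c p q r]; rfl

/-- The chain map induced by a map of generators that preserves vertices and faces. -/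
noncomputable def map {F G : FaceSystem V} (f : F.Gen → G.Gen)
    (hv : ∀ g, G.verts (f g) = F.verts g) (hf : ∀ g v, f (F.face g v) = G.face (f g) v) :
    F.complex R c ⟶ G.complex R c where
  f q := ModuleCat.ofHom (Finsupp.lmapDomain R R
    (fun g : F.GenDeg c q => (⟨f g.1, by rw [hv]; exact g.2⟩ : G.GenDeg c q)))
  comm' p q _ := by
    dsimp only [complex]
    rw [← ModuleCat.ofHom_comp, ← ModuleCat.ofHom_comp]
    congr 1
    ext g : 2
    simp only [d, LinearMap.comp_apply, Finsupp.lsingle_apply, Finsupp.lmapDomain_apply,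
      Finsupp.mapDomain_single, Finsupp.linearCombination_single, one_smul]
    rw [bd, bd, ← Finsupp.lmapDomain_apply R R, map_sum]
    refine Finset.sum_congr (hv g.1) fun v _ => ?_
    have hc : (G.verts (G.face (f g.1) v)).card = (F.verts (F.face g.1 v)).card := by
      rw [← hf, hv]
    by_cases h : ((F.verts (F.face g.1 v)).card : ℤ) = q + c
    · rw [dif_pos (by rw [hc]; exact h), dif_pos h, Finsupp.lmapDomain_apply,
        Finsupp.mapDomain_single]
      congr 1
      · exact Subtype.ext (hf g.1 v).symm
      · exact congrArg (fun s => ((sgn s v : ℤ) : R)) (hv g.1)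
    · rw [dif_neg (by rw [hc]; exact h), dif_neg h, map_zero]

end FaceSystem

/-! ### Dual cochain complexes -/

section Dual

variable {R : Type u} [CommRing R]

/-- The dual cochain complex `Hom(C_*, R)`. -/
noncomputable def dualComplex (C : ChainComplex (ModuleCat.{u} R) ℤ) :
    CochainComplex (ModuleCat.{u} R) ℤ where
  X q := ModuleCat.of R (Module.Dual R (C.X q))
  d p q := ModuleCat.ofHom (C.d q p).hom.dualMap
  shape p q h := by
    rw [C.shape q p h]
    ext φ x
    change φ (0 : C.X p) = 0
    exact map_zero φ
  d_comp_d' p q r _ _ := by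
    ext φ x
    change φ ((C.d r q ≫ C.d q p).hom x) = 0
    rw [C.d_comp_d]
    exact map_zero φ

/-- The dual cochain map of a chain map. -/
noncomputable def dualHom {C D : ChainComplex (ModuleCat.{u} R) ℤ} (f : C ⟶ D) :
    dualComplex D ⟶ dualComplex C where
  f q := ModuleCat.ofHom (f.f q).hom.dualMap
  comm' p q _ := by
    refine ModuleCat.hom_ext (LinearMap.ext fun (φ : Module.Dual R (D.X p)) => ?_)
    refine LinearMap.ext fun (x : C.X q) => ?_
    change φ ((C.d q p ≫ f.f p).hom x) = φ ((f.f q ≫ D.d q p).hom x)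
    rw [f.comm]

end Dual

/-! ### Simplicial complexes and reduced (co)homology -/

/-- A simplicial complex with vertex set contained in `V`: a family of finite subsets of `V` closed
under passing to subsets. Ghost vertices, the void complex `⊥ = { }` and the complex `{∅}` are
allowed; `A ≤ X` means that `A` is a subcomplex of `X`. -/
abbrev SComplex (V : Type) : Type := LowerSet (Finset V)

section Simplicial

variable {V : Type} [LinearOrder V]

/-- The simplices of `K` (the empty simplex included, if `K` is not void) with their faces. -/
def simplexSystem (K : SComplex V) : FaceSystem V where
  Gen := {s : Finset V // s ∈ K}
  verts s := s.1
  face s v := ⟨s.1.erase v, K.lower (Finset.erase_subset v s.1) s.2⟩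
  verts_face _ _ _ := rfl
  face_comm _ _ _ _ _ _ := Subtype.ext Finset.erase_right_comm

variable (R : Type u) [CommRing R]

/-- The reduced (augmented) simplicial chain complex `C̃_*(K; R)`; a simplex `s` has degree
`|s| - 1`, so that the empty simplex has degree `-1`. -/
noncomputable def redChain (K : SComplex V) : ChainComplex (ModuleCat.{u} R) ℤ :=
  (simplexSystem K).complex R 1

/-- The inclusion `C̃_*(A; R) → C̃_*(X; R)` for a subcomplex `A` of `X`. -/
noncomputable def redChainIncl {A X : SComplex V} (h : A ≤ X) : redChain R A ⟶ redChain R X :=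
  FaceSystem.map (F := simplexSystem A) (G := simplexSystem X) R 1
    (fun s => ⟨s.1, h s.2⟩) (fun _ => rfl) (fun _ _ => rfl)

/-- Reduced simplicial homology `H̃_q(K; R)`. -/
noncomputable def redH (K : SComplex V) (q : ℤ) : ModuleCat.{u} R := (redChain R K).homology q

/-- Reduced simplicial cohomology `H̃^q(K; R)`. -/
noncomputable def redCoH (K : SComplex V) (q : ℤ) : ModuleCat.{u} R :=
  (dualComplex (redChain R K)).homology q

/-- `ι : H̃_q(A; R) → H̃_q(X; R)`, induced by inclusion. -/
noncomputable def iota {A X : SComplex V} (h : A ≤ X) (q : ℤ) : redH R A q →ₗ[R] redH R X q :=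
  (HomologicalComplex.homologyMap (redChainIncl R h) q).hom

/-- `ι° : H̃^q(X; R) → H̃^q(A; R)`, induced by inclusion. -/
noncomputable def coIota {A X : SComplex V} (h : A ≤ X) (q : ℤ) :
    redCoH R X q →ₗ[R] redCoH R A q :=
  (HomologicalComplex.homologyMap (dualHom (redChainIncl R h)) q).hom

/-- `ι` is split: its kernel, cokernel and image are free. -/
def IsSplit {A X : SComplex V} (h : A ≤ X) : Prop :=
  ∀ q : ℤ, Module.Free R (LinearMap.ker (iota R h q)) ∧
    Module.Free R (redH R X q ⧸ LinearMap.range (iota R h q)) ∧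
    Module.Free R (LinearMap.range (iota R h q))

end Simplicial

/-! ### Polyhedral join complexes -/

section Join

variable {m : ℕ} {n : Fin m → ℕ}

/-- The ordered vertex set `[n] = [n_1] ⊔ ⋯ ⊔ [n_m]`, the blocks one after the other. -/
abbrev Vert (n : Fin m → ℕ) : Type := Σₗ k : Fin m, Fin (n k)

/-- `σ ∩ [n_k]`. -/
def part (σ : Finset (Vert n)) (k : Fin m) : Finset (Fin (n k)) :=
  Finset.univ.filter (fun v => toLex (⟨k, v⟩ : Σ k : Fin m, Fin (n k)) ∈ σ)

/-- The join `Y_1 * ⋯ * Y_m`. -/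
def join (Y : ∀ k : Fin m, SComplex (Fin (n k))) : SComplex (Vert n) where
  carrier := {σ | ∀ k, part σ k ∈ Y k}
  lower' := by
    intro σ τ hτ hσ k
    refine (Y k).lower ?_ (hσ k)
    intro v hv
    simp only [part, Finset.mem_filter, Finset.mem_univ, true_and] at hv ⊢
    exact hτ hv

/-- The polyhedral join complex `S(K; X, A) = ⋃_{τ ∈ K} Y_1 * ⋯ * Y_m` with `Y_k = X_k` if `k ∈ τ`
and `Y_k = A_k` if `k ∉ τ`. -/
def polyJoin (K : SComplex (Fin m)) (X A : ∀ k : Fin m, SComplex (Fin (n k))) :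
    SComplex (Vert n) :=
  ⨆ τ ∈ K, join (fun k => if k ∈ τ then X k else A k)

end Join

/-! ### The index sets and the total (co)homology of `K` -/

/-- The three-element index set `𝒳`: `coker` is `({1}, ∅)`, `ker` is `(∅, {1})` and `im` is
`(∅, ∅)`. A function `x : Fin m → Idx` stands for the pair `(σ, ω)` of disjoint subsets of `[m]` with
`σ = {k | x k = coker}` and `ω = {k | x k = ker}`. -/
inductive Idx
  | coker
  | ker
  | im
  deriving DecidableEq

/-- `𝒳`. -/
def XX : Set Idx := Set.univ

/-- `ℛ = {(∅, ∅), (∅, {1})}`. -/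
def RR : Set Idx := {Idx.im, Idx.ker}

/-- The basis `α, β, γ, η` of the complex `T_*^𝒳`, where `|α| = |γ| = |η| = 0`, `|β| = 1`,
`dβ = γ`, `dα = dγ = dη = 0`. -/
inductive Letter
  | α
  | β
  | γ
  | η
  deriving DecidableEq

/-- The index of a basis element of `T_*^𝒳`. -/
def Letter.idx : Letter → Idx
  | .α => .coker
  | .β => .ker
  | .γ => .ker
  | .η => .im

section Total

variable {m : ℕ}

/-- The basis of the part of index `x = (σ, ω)` of the total chain complex `T_*^{𝒳_m}(K)`. The complex
`T_*^𝒳 ⊗ ⋯ ⊗ T_*^𝒳` has as its basis the words `w = w_1 ⊗ ⋯ ⊗ w_m` in `α, β, γ, η`; its differential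
is the sum over the positions of the letters `β` of the word with that `β` replaced by `γ`, with the
Koszul sign `(-1)^i`, `i` the number of letters `β` further to the left. The
subcomplex of `τ` is spanned by the words that have `γ` or `η` at all places outside `τ`; so the sum
of these subcomplexes over `τ ∈ K` is spanned by the words for which the places of the letters `α`
and `β` form a simplex of `K`. -/
def totalSystem (K : SComplex (Fin m)) (x : Fin m → Idx) : FaceSystem (Fin m) where
  Gen := {w : Fin m → Letter // (∀ k, (w k).idx = x k) ∧
    Finset.univ.filter (fun k => w k = Letter.α ∨ w k = Letter.β) ∈ K}
  verts w := Finset.univ.filter (fun k => w.1 k = Letter.β)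
  face w v := ⟨fun k => if k = v ∧ w.1 k = Letter.β then Letter.γ else w.1 k, by
    refine ⟨fun k => ?_, K.lower ?_ w.2.2⟩
    · rw [← w.2.1 k]
      dsimp only
      split_ifs with h
      · rw [h.2]; rfl
      · rfl
    · intro k hk
      simp only [Finset.mem_filter, Finset.mem_univ, true_and] at hk ⊢
      split_ifs at hk with h
      · simp at hk
      · exact hk⟩
  verts_face w v _ := by
    ext k
    simp only [Finset.mem_filter, Finset.mem_univ, true_and, Finset.mem_erase]
    split_ifs with h
    · simp [h.1]
    · constructor
      · intro hk; exact ⟨fun hkv => h ⟨hkv, hk⟩, hk⟩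
      · exact fun hk => hk.2
  face_comm w v v' _ _ _ := by
    apply Subtype.ext
    funext k
    dsimp only
    by_cases h1 : k = v <;> by_cases h2 : k = v' <;> by_cases h3 : w.1 k = Letter.β <;>
      simp only [h1, h2, h3] <;> grind

variable (R : Type u) [CommRing R]

/-- The part of index `x = (σ, ω)` of the total chain complex `T_*^{𝒳_m}(K)`. -/
noncomputable def totalChain (K : SComplex (Fin m)) (x : Fin m → Idx) :
    ChainComplex (ModuleCat.{u} R) ℤ :=
  (totalSystem K x).complex R 0

/-- `H_a^{σ,ω}(K)`, a summand of the total homology `H_*^{𝒳_m}(K)`. -/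
noncomputable def totH (K : SComplex (Fin m)) (x : Fin m → Idx) (a : ℤ) : ModuleCat.{u} R :=
  (totalChain R K x).homology a

/-- `H^a_{σ,ω}(K)`, a summand of the total cohomology `H^*_{𝒳_m}(K)`. -/
noncomputable def totCoH (K : SComplex (Fin m)) (x : Fin m → Idx) (a : ℤ) : ModuleCat.{u} R :=
  (dualComplex (totalChain R K x)).homology a

end Total

/-! ### The character groups of the pairs and the diagonal tensor product -/

section Formula

variable (R : Type u) [CommRing R]

/-- The degree `b` part of `H_*^s(X, A)`: the suspension of `coker ι`, `ker ι`, `im ι`. -/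
noncomputable def charH {V : Type} [LinearOrder V] {A X : SComplex V} (h : A ≤ X) (s : Idx)
    (b : ℤ) : ModuleCat.{u} R :=
  match s with
  | .coker => ModuleCat.of R (redH R X (b - 1) ⧸ LinearMap.range (iota R h (b - 1)))
  | .ker => ModuleCat.of R (LinearMap.ker (iota R h (b - 1)))
  | .im => ModuleCat.of R (LinearMap.range (iota R h (b - 1)))

/-- The degree `b` part of `H^*_s(X, A)`: the suspension of `ker ι°`, `coker ι°`, `im ι°`. -/
noncomputable def charCoH {V : Type} [LinearOrder V] {A X : SComplex V} (h : A ≤ X) (s : Idx)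
    (b : ℤ) : ModuleCat.{u} R :=
  match s with
  | .coker => ModuleCat.of R (LinearMap.ker (coIota R h (b - 1)))
  | .ker => ModuleCat.of R (redCoH R A (b - 1) ⧸ LinearMap.range (coIota R h (b - 1)))
  | .im => ModuleCat.of R (LinearMap.range (coIota R h (b - 1)))

/-- The degree `N` part of the diagonal tensor product `T ⊗̂ (H_1 ⊗ ⋯ ⊗ H_m)` over the index set
`S × ⋯ × S`: the direct sum over the indices `x` and over the degrees `a`, `b_1, …, b_m` with
`a + b_1 + ⋯ + b_m = N` of `T_a^x ⊗ (H_1)_{b_1}^{x_1} ⊗ ⋯ ⊗ (H_m)_{b_m}^{x_m}`. -/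
abbrev DiagTensor {m : ℕ} (S : Set Idx) (T : (Fin m → Idx) → ℤ → ModuleCat.{u} R)
    (H : Fin m → Idx → ℤ → ModuleCat.{u} R) (N : ℤ) : Type u :=
  ⨁ (x : Fin m → S), ⨁ (p : {p : ℤ × (Fin m → ℤ) // p.1 + ∑ k, p.2 k = N}),
    (T (fun k => (x k : Idx)) p.1.1) ⊗[R] (⨂[R] k, H k (x k) (p.1.2 k))

variable {m : ℕ} {n : Fin m → ℕ} (K : SComplex (Fin m))
  {X A : ∀ k : Fin m, SComplex (Fin (n k))} (h : ∀ k, A k ≤ X k)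

/-- `H̃_{*-1}(S(K; X, A)) ≅ H_*^{S_m}(K) ⊗̂ (H_*^S(X_1, A_1) ⊗ ⋯ ⊗ H_*^S(X_m, A_m))`. -/
def HomologyFormula (S : Set Idx) : Prop :=
  ∀ N : ℤ, Nonempty (redH R (polyJoin K X A) (N - 1) ≃ₗ[R]
    DiagTensor R S (totH R K) (fun k => charH R (h k)) N)

/-- `H̃^{*-1}(S(K; X, A)) ≅ H^*_{S_m}(K) ⊗̂ (H^*_S(X_1, A_1) ⊗ ⋯ ⊗ H^*_S(X_m, A_m))`. -/
def CohomologyFormula (S : Set Idx) : Prop :=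
  ∀ N : ℤ, Nonempty (redCoH R (polyJoin K X A) (N - 1) ≃ₗ[R]
    DiagTensor R S (totCoH R K) (fun k => charCoH R (h k)) N)

/-- The (co)homology of `S(K; X, A)` with coefficients in `R` is given by the two formulas over `𝒳`;
if every `ι_k` is an epimorphism, then also by the two formulas over `ℛ`, and moreover
`H_*^ℛ(X_k, A_k) ≅ H̃_{*-1}(A_k)` and `H^*_ℛ(X_k, A_k) ≅ H̃^{*-1}(A_k)` for all `k`. -/
def JoinFormulas : Prop :=
  HomologyFormula R K h XX ∧ CohomologyFormula R K h XX ∧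
  ((∀ k q, Function.Surjective (iota R (h k) q)) →
    HomologyFormula R K h RR ∧ CohomologyFormula R K h RR ∧
    (∀ k b, Nonempty ((⨁ s : RR, charH R (h k) s b) ≃ₗ[R] redH R (A k) (b - 1))) ∧
    (∀ k b, Nonempty ((⨁ s : RR, charCoH R (h k) s b) ≃ₗ[R] redCoH R (A k) (b - 1))))

end Formula

end PolyJoin

/-! Graded by cardinality, the augmented chains of a join are the tensor product of the augmented
chains of its factors. The chains of the polyhedral join are therefore the part of C(X_1) ⊗ ⋯ ⊗
C(X_m) spanned by the words whose letters outside A_k occur only at places k of some simplex of K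
(`mat_polyJoin`, `range_toWord`). The plan is to replace every pair C(A_k) ⊂ C(X_k) by a minimal
pair.

If ι has torsion-free kernel, image and cokernel, then the differentials of C(A) and of C(X)/C(A)
and the connecting map between their homologies all have saturated images. Over a principal ideal
domain such maps have generalized inverses. Together these give a deformation retraction of C(X),
compatible with C(A), onto a complex whose only differential is β ↦ γ. There α represents coker ι, η
represents im ι, γ represents ker ι and β stands for chains of X bounding the γ; the letters γ and η
span the subcomplex. This is `nonempty_pairContraction`, whose algebra is `filtered_contraction`.

Retractions can be tensored (`isRetraction_wordMat`). As they respect the subcomplexes, they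
restrict to the words allowed by K (`PairContraction.nonempty_matH_equiv`). In the small complex the
differential changes letters but never the basis elements to which the letters are attached. So it
is a direct sum, up to signs and shifts, of copies of the complexes T^{σ,ω}(K), one for each word of
basis elements (`wordMat_toGood`, `nonempty_matH_good`). Sorting these words by index and degree
gives the diagonal tensor product (`nonempty_diagTensor_equiv`).

All complexes are finite and free, so a differential is one square matrix acting on row vectors, and
the dual complex has the transposed matrix. Retractions can be transposed, hence cohomology follows
from the same data, with kernel and cokernel exchanged. If every ι_k is onto, there are no letters
α, and only the indices in ℛ remain. Over a field every module is free, so the splitting hypothesis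
is automatic. -/

namespace PolyJoin

/-! ### Homology of square matrices -/

section MatrixHomology

variable {R : Type u} [CommRing R] {I J L : Type} [Fintype I] [Fintype J] [Fintype L]

/-- The functions on `L` that vanish outside `p`. -/
def suppOn (R : Type u) [CommRing R] (p : L → Prop) : Submodule R (L → R) where
  carrier := {c | ∀ l, ¬ p l → c l = 0}
  add_mem' ha hb l hl := by simp [ha l hl, hb l hl]
  zero_mem' _ _ := rfl
  smul_mem' r c hc l hl := by simp [hc l hl]

/-- The row vectors supported on `p` that are annihilated by `D`. -/
def cyc (D : Matrix L L R) (p : L → Prop) : Submodule R (L → R) :=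
  suppOn R p ⊓ LinearMap.ker D.vecMulLinear

/-- The elements of `cyc D p` that lie in the row space of `D`. -/
def bdry (D : Matrix L L R) (p : L → Prop) : Submodule R (cyc D p) :=
  (LinearMap.range D.vecMulLinear).comap (cyc D p).subtype

/-- The homology of the differential matrix `D` in the degree singled out by `p`. -/
abbrev MatH (D : Matrix L L R) (p : L → Prop) : Type u := cyc D p ⧸ bdry D p

theorem mem_cyc {D : Matrix L L R} {p : L → Prop} {c : L → R} :
    c ∈ cyc D p ↔ (∀ l, ¬ p l → c l = 0) ∧ Matrix.vecMul c D = 0 := Iff.rfl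

theorem mem_bdry {D : Matrix L L R} {p : L → Prop} {c : cyc D p} :
    c ∈ bdry D p ↔ ∃ y, Matrix.vecMul y D = c.1 := Iff.rfl

theorem vecMul_mem_cyc {D : Matrix I I R} {E : Matrix J J R} {p : I → Prop} {q : J → Prop}
    (P : Matrix I J R) (hP : ∀ i j, P i j ≠ 0 → p i → q j) (hc : D * P = P * E) (c : I → R)
    (h : c ∈ cyc D p) : Matrix.vecMul c P ∈ cyc E q := by
  refine mem_cyc.2 ⟨fun j hj => ?_, ?_⟩
  · refine Finset.sum_eq_zero fun i _ => ?_
    by_cases hi : p i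
    · by_cases hz : P i j = 0
      · simp [hz]
      · exact absurd (hP i j hz hi) hj
    · simp [h.1 i hi]
  · rw [Matrix.vecMul_vecMul, ← hc, ← Matrix.vecMul_vecMul, (mem_cyc.1 h).2, Matrix.zero_vecMul]

/-- The map on cycles induced by a matrix that commutes with the differentials. -/
def cycMap {D : Matrix I I R} {E : Matrix J J R} {p : I → Prop} {q : J → Prop}
    (P : Matrix I J R) (hP : ∀ i j, P i j ≠ 0 → p i → q j) (hc : D * P = P * E) :
    cyc D p →ₗ[R] cyc E q :=
  P.vecMulLinear.restrict (vecMul_mem_cyc P hP hc)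

/-- The map on homology induced by a matrix that commutes with the differentials. -/
def MatH.map {D : Matrix I I R} {E : Matrix J J R} {p : I → Prop} {q : J → Prop}
    (P : Matrix I J R) (hP : ∀ i j, P i j ≠ 0 → p i → q j) (hc : D * P = P * E) :
    MatH D p →ₗ[R] MatH E q :=
  Submodule.mapQ _ _ (cycMap P hP hc) (by
    rintro c ⟨y, hy⟩
    refine ⟨Matrix.vecMul y P, ?_⟩
    change Matrix.vecMul (Matrix.vecMul y P) E = Matrix.vecMul c.1 P
    have hy' : Matrix.vecMul y D = c.1 := hy
    rw [Matrix.vecMul_vecMul, ← hc, ← Matrix.vecMul_vecMul, hy'])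

theorem MatH.map_mk {D : Matrix I I R} {E : Matrix J J R} {p : I → Prop} {q : J → Prop}
    (P : Matrix I J R) (hP : ∀ i j, P i j ≠ 0 → p i → q j) (hc : D * P = P * E) (c : cyc D p) :
    MatH.map P hP hc (Submodule.Quotient.mk c) =
      Submodule.Quotient.mk ⟨Matrix.vecMul c.1 P, vecMul_mem_cyc P hP hc c.1 c.2⟩ := rfl

/-- `P` and `Q` exhibit the differential matrix `E` as a deformation retract of `D`, with
homotopy `h`. -/
structure IsRetraction [DecidableEq I] [DecidableEq J] (D : Matrix I I R) (E : Matrix J J R)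
    (P : Matrix I J R) (Q : Matrix J I R) (h : Matrix I I R) : Prop where
  comm : D * P = P * E
  comm' : E * Q = Q * D
  retract : Q * P = 1
  homotopy : 1 - P * Q = D * h + h * D

/-- Inclusion and projection trade places under transposition. This is what makes each retraction
serve cohomology as well as homology. -/
theorem IsRetraction.transpose [DecidableEq I] [DecidableEq J] {D : Matrix I I R}
    {E : Matrix J J R} {P : Matrix I J R} {Q : Matrix J I R} {h : Matrix I I R}
    (H : IsRetraction D E P Q h) :
    IsRetraction D.transpose E.transpose Q.transpose P.transpose h.transpose where
  comm := by rw [← Matrix.transpose_mul, ← Matrix.transpose_mul, H.comm']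
  comm' := by rw [← Matrix.transpose_mul, ← Matrix.transpose_mul, H.comm]
  retract := by rw [← Matrix.transpose_mul, H.retract, Matrix.transpose_one]
  homotopy := by
    have := congrArg Matrix.transpose H.homotopy
    simp only [Matrix.transpose_sub, Matrix.transpose_mul, Matrix.transpose_one,
      Matrix.transpose_add] at this
    rw [this, add_comm]

/-- If c is a cycle with cP = yE, then c = c(PQ + Dh + hD) = (yQ + ch)D is a boundary. Conversely cQ
is a preimage of a cycle c, since QP = 1. -/
theorem IsRetraction.map_bijective [DecidableEq I] [DecidableEq J] {D : Matrix I I R}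
    {E : Matrix J J R} {P : Matrix I J R} {Q : Matrix J I R} {h : Matrix I I R}
    (H : IsRetraction D E P Q h) {p : I → Prop} {q : J → Prop}
    (hP : ∀ i j, P i j ≠ 0 → p i → q j) (hQ : ∀ j i, Q j i ≠ 0 → q j → p i) :
    Function.Bijective (MatH.map (D := D) (E := E) P hP H.comm) := by
  constructor
  · rw [← LinearMap.ker_eq_bot, LinearMap.ker_eq_bot']
    intro x hx
    obtain ⟨c, rfl⟩ := Submodule.Quotient.mk_surjective _ x
    rw [MatH.map_mk, Submodule.Quotient.mk_eq_zero] at hx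
    obtain ⟨y, hy⟩ := hx
    rw [Submodule.Quotient.mk_eq_zero]
    refine ⟨Matrix.vecMul y Q + Matrix.vecMul c.1 h, ?_⟩
    change Matrix.vecMul y E = Matrix.vecMul c.1 P at hy
    change Matrix.vecMul _ D = c.1
    have e : c.1 = Matrix.vecMul c.1 (P * Q + (D * h + h * D)) := by
      rw [← H.homotopy, add_sub_cancel, Matrix.vecMul_one]
    have h0 : Matrix.vecMul c.1 D = 0 := (mem_cyc.1 c.2).2
    conv_rhs => rw [e, Matrix.vecMul_add, Matrix.vecMul_add, ← Matrix.vecMul_vecMul _ P Q, ← hy,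
      ← Matrix.vecMul_vecMul _ D h, h0, Matrix.zero_vecMul, zero_add, Matrix.vecMul_vecMul,
      H.comm']
    rw [Matrix.add_vecMul, Matrix.vecMul_vecMul, Matrix.vecMul_vecMul]
  · intro x
    obtain ⟨c, rfl⟩ := Submodule.Quotient.mk_surjective _ x
    refine ⟨Submodule.Quotient.mk ⟨_, vecMul_mem_cyc Q hQ H.comm' c.1 c.2⟩, ?_⟩
    rw [MatH.map_mk]
    congr 1
    apply Subtype.ext
    change Matrix.vecMul (Matrix.vecMul c.1 Q) P = c.1
    rw [Matrix.vecMul_vecMul, H.retract, Matrix.vecMul_one]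

/-- Two differential matrices that agree, up to signs, after a relabelling of the basis have
isomorphic homology. -/
theorem matH_equiv_of_equiv [DecidableEq I] [DecidableEq J] {D : Matrix I I R} {E : Matrix J J R}
    (e : I ≃ J) (s : I → ℤˣ)
    (hs : ∀ i i', E (e i) (e i') = ((s i : ℤ) : R) * ((s i' : ℤ) : R) * D i i')
    {p : I → Prop} {q : J → Prop} (hp : ∀ i, p i ↔ q (e i)) :
    Nonempty (MatH D p ≃ₗ[R] MatH E q) := by
  have ss : ∀ i, ((s i : ℤ) : R) * ((s i : ℤ) : R) = 1 := by
    intro i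
    rw [← Int.cast_mul, ← Units.val_mul, Int.units_mul_self]; simp
  -- A signed permutation matrix has its transpose as inverse, so the zero homotopy suffices.
  have H : IsRetraction D E (Matrix.of fun i j => if e i = j then ((s i : ℤ) : R) else 0)
      (Matrix.of fun j i => if e i = j then ((s i : ℤ) : R) else 0) 0 := by
    refine ⟨?_, ?_, ?_, ?_⟩
    · ext i j
      obtain ⟨i', rfl⟩ := e.surjective j
      simp only [Matrix.mul_apply, Matrix.of_apply, EmbeddingLike.apply_eq_iff_eq, mul_ite, mul_zero,
        ite_mul, zero_mul, Finset.sum_ite_eq, Finset.sum_ite_eq', Finset.mem_univ, if_true, hs]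
      linear_combination (-D i i' * ((s i' : ℤ) : R)) * ss i
    · ext j i'
      obtain ⟨i, rfl⟩ := e.surjective j
      simp only [Matrix.mul_apply, Matrix.of_apply, EmbeddingLike.apply_eq_iff_eq, mul_ite, mul_zero,
        ite_mul, zero_mul, Finset.sum_ite_eq, Finset.sum_ite_eq', Finset.mem_univ, if_true, hs]
      linear_combination (D i i' * ((s i : ℤ) : R)) * ss i'
    · ext j j'
      obtain ⟨i, rfl⟩ := e.surjective j
      obtain ⟨i', rfl⟩ := e.surjective j'
      by_cases h : i = i'
      · subst h; simp [Matrix.mul_apply, ss]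
      · simpa [Matrix.mul_apply, h] using fun h2 : i' = i => absurd h2.symm h
    · rw [mul_zero, zero_mul, add_zero, sub_eq_zero]
      ext i i'
      by_cases h : i = i'
      · subst h; simp [Matrix.mul_apply, ss]
      · simp [Matrix.mul_apply, h]
  refine ⟨LinearEquiv.ofBijective _ (H.map_bijective ?_ ?_)⟩
  · intro i j h hi
    by_cases hj : e i = j
    · exact hj ▸ (hp i).1 hi
    · simp [hj] at h
  · intro j i h hi
    by_cases hj : e i = j
    · exact (hp i).2 (hj ▸ hi)
    · simp [hj] at h

/-- If the classes of `D` are detected on a set `T` of basis elements, then these form a basis of the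
homology. -/
theorem exists_matH_equiv_fun {D : Matrix L L R} (T : L → Prop) (p : L → Prop)
    (h1 : ∀ y l, T l → Matrix.vecMul y D l = 0)
    (h2 : ∀ c, Matrix.vecMul c D = 0 → (∀ l, T l → c l = 0) → ∃ y, Matrix.vecMul y D = c)
    (h3 : ∀ l l', T l → D l l' = 0) :
    ∃ e : MatH D p ≃ₗ[R] ({l // T l ∧ p l} → R),
      ∀ (c : cyc D p) (l : {l // T l ∧ p l}), e (Submodule.Quotient.mk c) l = c.1 l := by
  classical
  let f : cyc D p →ₗ[R] ({l // T l ∧ p l} → R) :=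
    (LinearMap.funLeft R R (Subtype.val : {l // T l ∧ p l} → L)) ∘ₗ (cyc D p).subtype
  have hker : LinearMap.ker f = bdry D p := by
    ext c
    rw [LinearMap.mem_ker, mem_bdry]
    constructor
    · intro h
      refine h2 c.1 (mem_cyc.1 c.2).2 fun l hl => ?_
      by_cases hpl : p l
      · exact congrFun h ⟨l, hl, hpl⟩
      · exact (mem_cyc.1 c.2).1 l hpl
    · rintro ⟨y, hy⟩
      funext l
      change c.1 l.1 = 0
      rw [← hy]; exact h1 y _ l.2.1
  have hsurj : Function.Surjective f := by
    intro g
    -- Extension by zero is a cycle because the rows of `D` indexed by `T` vanish.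
    refine ⟨⟨fun l => if h : T l ∧ p l then g ⟨l, h⟩ else 0, mem_cyc.2 ⟨fun l hl => ?_, ?_⟩⟩, ?_⟩
    · simp [hl]
    · funext l'
      refine Finset.sum_eq_zero fun l _ => ?_
      by_cases h : T l
      · simp [h3 l l' h]
      · simp [h]
    · funext l
      change dite _ _ _ = _
      rw [dif_pos l.2]
  exact ⟨(Submodule.quotEquivOfEq _ _ hker.symm).trans (f.quotKerEquivOfSurjective hsurj),
    fun c l => rfl⟩

end MatrixHomology

/-! ### Complexes of modules described by a differential matrix -/

section Cycles

variable {R : Type u} [CommRing R]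

/-- The homology class of a cycle of a short complex of modules. -/
noncomputable def homologyClass (S : ShortComplex (ModuleCat.{u} R)) :
    LinearMap.ker S.g.hom →ₗ[R] S.homology :=
  (S.moduleCatCyclesIso.inv ≫ S.homologyπ).hom

theorem homologyClass_surjective (S : ShortComplex (ModuleCat.{u} R)) :
    Function.Surjective (homologyClass S) :=
  (ModuleCat.epi_iff_surjective (S.moduleCatCyclesIso.inv ≫ S.homologyπ)).1 inferInstance

theorem homologyClass_eq_zero (S : ShortComplex (ModuleCat.{u} R)) (z : LinearMap.ker S.g.hom) :
    homologyClass S z = 0 ↔ ∃ y, S.f.hom y = z.1 := by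
  have h : homologyClass S z = S.moduleCatHomologyIso.inv.hom
      (S.moduleCatLeftHomologyData.π.hom z) := by
    change (S.moduleCatCyclesIso.inv ≫ S.homologyπ).hom z = _
    rw [ShortComplex.moduleCatCyclesIso_inv_π]
    rfl
  have h2 : homologyClass S z = 0 ↔ S.moduleCatLeftHomologyData.π.hom z = 0 := by
    rw [h]
    constructor
    · intro h0
      apply (ModuleCat.mono_iff_injective S.moduleCatHomologyIso.inv).1 inferInstance
      exact h0.trans (map_zero _).symm
    · intro h0
      rw [h0, map_zero]
  refine h2.trans ((Submodule.Quotient.mk_eq_zero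
    (LinearMap.range S.moduleCatToCycles) (x := z)).trans ?_)
  constructor
  · rintro ⟨y, hy⟩
    exact ⟨y, congrArg Subtype.val hy⟩
  · rintro ⟨y, hy⟩
    exact ⟨y, Subtype.ext hy⟩

/-- The inclusion of cycles is a monomorphism, so the two cycles need only be compared in the middle
module. -/
theorem homologyClass_naturality {S T : ShortComplex (ModuleCat.{u} R)} (φ : S ⟶ T)
    (z : LinearMap.ker S.g.hom) (w : LinearMap.ker T.g.hom) (h : φ.τ₂.hom z.1 = w.1) :
    (ShortComplex.homologyMap φ).hom (homologyClass S z) = homologyClass T w := by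
  change ((S.moduleCatCyclesIso.inv ≫ S.homologyπ) ≫ ShortComplex.homologyMap φ).hom z = _
  rw [Category.assoc, ShortComplex.homologyπ_naturality]
  change T.homologyπ.hom ((ShortComplex.cyclesMap φ).hom (S.moduleCatCyclesIso.inv.hom z)) =
    T.homologyπ.hom (T.moduleCatCyclesIso.inv.hom w)
  congr 1
  apply (ModuleCat.mono_iff_injective T.iCycles).1 inferInstance
  change ((S.moduleCatCyclesIso.inv ≫ ShortComplex.cyclesMap φ) ≫ T.iCycles).hom z =
    (T.moduleCatCyclesIso.inv ≫ T.iCycles).hom w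
  rw [Category.assoc, ShortComplex.cyclesMap_i, ← Category.assoc,
    ShortComplex.moduleCatCyclesIso_inv_iCycles, ShortComplex.moduleCatCyclesIso_inv_iCycles]
  exact h

variable {ι : Type} {s : ComplexShape ι}

/-- The homology class of a cycle of a complex of modules. -/
noncomputable def cycleClass (C : HomologicalComplex (ModuleCat.{u} R) s) (j : ι) :
    LinearMap.ker (C.d j (s.next j)).hom →ₗ[R] C.homology j :=
  homologyClass (C.sc j)

theorem cycleClass_surjective (C : HomologicalComplex (ModuleCat.{u} R) s) (j : ι) :
    Function.Surjective (cycleClass C j) :=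
  homologyClass_surjective (C.sc j)

theorem cycleClass_eq_zero (C : HomologicalComplex (ModuleCat.{u} R) s) (j : ι)
    (z : LinearMap.ker (C.d j (s.next j)).hom) :
    cycleClass C j z = 0 ↔ ∃ y, (C.d (s.prev j) j).hom y = z.1 :=
  homologyClass_eq_zero (C.sc j) z

theorem cycleClass_naturality {C C' : HomologicalComplex (ModuleCat.{u} R) s} (f : C ⟶ C') (j : ι)
    (z : LinearMap.ker (C.d j (s.next j)).hom) (w : LinearMap.ker (C'.d j (s.next j)).hom)
    (h : (f.f j).hom z.1 = w.1) :
    (HomologicalComplex.homologyMap f j).hom (cycleClass C j z) = cycleClass C' j w :=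
  homologyClass_naturality
    ((HomologicalComplex.shortComplexFunctor (ModuleCat.{u} R) s j).map f) z w h

end Cycles

/-! ### Complexes with a finite total basis and their homology -/

section Model

variable {R : Type u} [CommRing R] {ι : Type} {s : ComplexShape ι} {L L' : Type} [Fintype L]
  [Fintype L']

/-- A basis `L` of all the modules of the complex `C`, the `i`-th module having the basis
`{l | p i l}`, such that the differential of `C` is given by the matrix `D`. -/
structure MatrixModel (C : HomologicalComplex (ModuleCat.{u} R) s) (D : Matrix L L R)
    (p : ι → L → Prop) where
  equiv : ∀ i, C.X i ≃ₗ[R] suppOn R (p i)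
  equiv_d : ∀ i j, s.Rel i j → ∀ x, (equiv j ((C.d i j).hom x)).1 = Matrix.vecMul (equiv i x).1 D
  supp : ∀ i j, s.Rel i j → ∀ l l', D l l' ≠ 0 → p j l' → p i l
  rel_prev : ∀ j, s.Rel (s.prev j) j
  rel_next : ∀ j, s.Rel j (s.next j)

namespace MatrixModel

variable {C : HomologicalComplex (ModuleCat.{u} R) s} {D : Matrix L L R} {p : ι → L → Prop}
  (M : MatrixModel C D p)

theorem mem_ker_d_iff (j : ι) (x : C.X j) :
    x ∈ LinearMap.ker (C.d j (s.next j)).hom ↔ Matrix.vecMul (M.equiv j x).1 D = 0 := by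
  rw [← M.equiv_d j _ (M.rel_next j), LinearMap.mem_ker]
  constructor
  · intro h; rw [h, map_zero]; rfl
  · intro h
    exact (M.equiv _).map_eq_zero_iff.1 (Subtype.ext h)

/-- The cycles of the complex as row vectors. -/
noncomputable def cycEquiv (j : ι) : LinearMap.ker (C.d j (s.next j)).hom ≃ₗ[R] cyc D (p j) where
  toFun x := ⟨(M.equiv j x.1).1, (M.equiv j x.1).2, (M.mem_ker_d_iff j x.1).1 x.2⟩
  invFun c := ⟨(M.equiv j).symm ⟨c.1, c.2.1⟩, (M.mem_ker_d_iff j _).2 (by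
    rw [LinearEquiv.apply_symm_apply]; exact c.2.2)⟩
  map_add' x y := by
    apply Subtype.ext
    change (M.equiv j (x.1 + y.1)).1 = (M.equiv j x.1).1 + (M.equiv j y.1).1
    rw [map_add]; rfl
  map_smul' r x := by
    apply Subtype.ext
    change (M.equiv j (r • x.1)).1 = r • (M.equiv j x.1).1
    rw [map_smul]; rfl
  left_inv x := Subtype.ext (by
    change (M.equiv j).symm (M.equiv j x.1) = x.1
    rw [LinearEquiv.symm_apply_apply])
  right_inv c := Subtype.ext (by
    change ((M.equiv j) ((M.equiv j).symm ⟨c.1, c.2.1⟩)).1 = c.1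
    rw [LinearEquiv.apply_symm_apply])

theorem cycEquiv_apply (j : ι) (z : LinearMap.ker (C.d j (s.next j)).hom) :
    (M.cycEquiv j z).1 = (M.equiv j z.1).1 := rfl

theorem cycleClass_eq_zero_iff (j : ι) (z : LinearMap.ker (C.d j (s.next j)).hom) :
    cycleClass C j z = 0 ↔ M.cycEquiv j z ∈ bdry D (p j) := by
  classical
  rw [cycleClass_eq_zero, mem_bdry, cycEquiv_apply]
  constructor
  · rintro ⟨y, hy⟩
    exact ⟨(M.equiv _ y).1, by rw [← M.equiv_d _ _ (M.rel_prev j), hy]⟩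
  · rintro ⟨y, hy⟩
    -- A preimage under the matrix may have entries in any degree. By `supp`, only those in degree
    -- `s.prev j` influence the degree `j` part of the image, so the others can be dropped.
    let y' : suppOn R (p (s.prev j)) :=
      ⟨fun l => if p (s.prev j) l then y l else 0, fun l hl => if_neg hl⟩
    refine ⟨(M.equiv _).symm y', (M.equiv j).injective (Subtype.ext ?_)⟩
    rw [M.equiv_d _ _ (M.rel_prev j), LinearEquiv.apply_symm_apply, ← hy]
    funext l'
    by_cases hl' : p j l'
    · refine Finset.sum_congr rfl fun l _ => ?_
      by_cases hz : D l l' = 0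
      · simp [hz]
      · dsimp only [y']
        rw [if_pos (M.supp _ _ (M.rel_prev j) l l' hz hl')]
    · have h1 := (M.equiv j ((C.d _ j).hom ((M.equiv _).symm y'))).2 l' hl'
      rw [M.equiv_d _ _ (M.rel_prev j), LinearEquiv.apply_symm_apply] at h1
      rw [h1, hy]
      exact ((M.equiv j z.1).2 l' hl').symm

/-- The homology of a complex is the homology of its differential matrix. -/
noncomputable def homologyEquiv (j : ι) : C.homology j ≃ₗ[R] MatH D (p j) :=
  ((cycleClass C j).quotKerEquivOfSurjective (cycleClass_surjective C j)).symm.trans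
    (Submodule.Quotient.equiv _ _ (M.cycEquiv j) (by
      ext c
      rw [Submodule.mem_map]
      constructor
      · rintro ⟨z, hz, rfl⟩
        exact (M.cycleClass_eq_zero_iff j z).1 hz
      · intro hc
        refine ⟨(M.cycEquiv j).symm c, (M.cycleClass_eq_zero_iff j _).2 ?_, ?_⟩
        · rwa [LinearEquiv.apply_symm_apply]
        · exact LinearEquiv.apply_symm_apply _ c))

theorem homologyEquiv_cycleClass (j : ι) (z : LinearMap.ker (C.d j (s.next j)).hom) :
    M.homologyEquiv j (cycleClass C j z) = Submodule.Quotient.mk (M.cycEquiv j z) := by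
  have h : ((cycleClass C j).quotKerEquivOfSurjective (cycleClass_surjective C j)).symm
      (cycleClass C j z) = Submodule.Quotient.mk z := by
    rw [LinearEquiv.symm_apply_eq]; rfl
  rw [homologyEquiv, LinearEquiv.trans_apply, h]
  rfl

theorem homologyEquiv_homologyMap {C' : HomologicalComplex (ModuleCat.{u} R) s}
    {D' : Matrix L' L' R} {p' : ι → L' → Prop} (M' : MatrixModel C' D' p') (f : C ⟶ C')
    (P : Matrix L L' R) (j : ι) (hP : ∀ l l', P l l' ≠ 0 → p j l → p' j l')
    (hc : D * P = P * D')
    (hf : ∀ x, (M'.equiv j ((f.f j).hom x)).1 = Matrix.vecMul (M.equiv j x).1 P)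
    (x : C.homology j) :
    M'.homologyEquiv j ((HomologicalComplex.homologyMap f j).hom x) =
      MatH.map P hP hc (M.homologyEquiv j x) := by
  obtain ⟨z, rfl⟩ := cycleClass_surjective C j x
  have hz : (f.f j).hom z.1 ∈ LinearMap.ker (C'.d j (s.next j)).hom := by
    rw [M'.mem_ker_d_iff, hf, Matrix.vecMul_vecMul, ← hc, ← Matrix.vecMul_vecMul,
      (M.mem_ker_d_iff j z.1).1 z.2, Matrix.zero_vecMul]
  rw [cycleClass_naturality f j z ⟨_, hz⟩ rfl, homologyEquiv_cycleClass, homologyEquiv_cycleClass,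
    MatH.map_mk]
  congr 1
  exact Subtype.ext (hf z.1)

end MatrixModel

end Model

/-! ### The differential matrix of a face system -/

namespace FaceSystem

variable {V : Type} [LinearOrder V] (R : Type u) [CommRing R] (F : FaceSystem V) (c : ℤ)

open Classical in
/-- The matrix of the boundary operator of a face system. -/
noncomputable def mat : Matrix F.Gen F.Gen R := fun g g' =>
  ∑ v ∈ F.verts g, if F.face g v = g' then ((sgn (F.verts g) v : ℤ) : R) else 0

theorem card_of_mat_ne_zero {g g' : F.Gen} (h : F.mat R g g' ≠ 0) :
    ((F.verts g').card : ℤ) = (F.verts g).card - 1 := by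
  obtain ⟨v, hv, hne⟩ := Finset.exists_ne_zero_of_sum_ne_zero h
  have : F.face g v = g' := by
    by_contra h'
    exact hne (if_neg h')
  rw [← this, F.card_face g hv]

variable [Fintype F.Gen]

open Classical in
/-- Finitely supported functions on a set of generators of a finite face system as functions. -/
noncomputable def finsuppEquiv (q : ℤ) :
    (F.GenDeg c q →₀ R) ≃ₗ[R] suppOn R (fun g : F.Gen => ((F.verts g).card : ℤ) = q + c) where
  toFun x := ⟨fun g => if h : ((F.verts g).card : ℤ) = q + c then x ⟨g, h⟩ else 0,
    fun g hg => dif_neg hg⟩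
  invFun y := Finsupp.equivFunOnFinite.symm fun g => y.1 g.1
  map_add' x y := by
    apply Subtype.ext; funext g
    by_cases h : ((F.verts g).card : ℤ) = q + c <;> simp [h]
  map_smul' r x := by
    apply Subtype.ext; funext g
    by_cases h : ((F.verts g).card : ℤ) = q + c <;> simp [h]
  left_inv x := by
    ext g
    simp [g.2]
  right_inv y := by
    apply Subtype.ext; funext g
    by_cases h : ((F.verts g).card : ℤ) = q + c
    · simp [h]
    · simp [h, y.2 g h]

theorem finsuppEquiv_single (q : ℤ) (g : F.GenDeg c q) [DecidableEq F.Gen] :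
    (F.finsuppEquiv R c q (Finsupp.single g 1)).1 = Pi.single g.1 1 := by
  funext g'
  change dite _ _ _ = _
  by_cases h : g' = g.1
  · subst h
    rw [dif_pos g.2, Pi.single_eq_same, Finsupp.single_eq_same]
  · rw [Pi.single_eq_of_ne h]
    split_ifs with h'
    · exact Finsupp.single_eq_of_ne fun h2 => h (congrArg Subtype.val h2)
    · rfl

theorem finsuppEquiv_d (p q : ℤ) (h : q + 1 = p) (x : F.GenDeg c p →₀ R) :
    (F.finsuppEquiv R c q (F.d R c p q x)).1 =
      Matrix.vecMul (F.finsuppEquiv R c p x).1 (F.mat R) := by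
  classical
  have : (suppOn R _).subtype ∘ₗ (F.finsuppEquiv R c q).toLinearMap ∘ₗ F.d R c p q =
      (F.mat R).vecMulLinear ∘ₗ (suppOn R _).subtype ∘ₗ (F.finsuppEquiv R c p).toLinearMap := by
    ext g : 2
    change (F.finsuppEquiv R c q (F.d R c p q (Finsupp.single g 1))).1 =
      Matrix.vecMul (F.finsuppEquiv R c p (Finsupp.single g 1)).1 (F.mat R)
    rw [finsuppEquiv_single, Matrix.single_one_vecMul, d, Finsupp.linearCombination_single,
      one_smul, bd, map_sum, AddSubmonoidClass.coe_finsetSum]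
    funext g'
    rw [Finset.sum_apply]
    refine Finset.sum_congr rfl fun v hv => ?_
    have hc : ((F.verts (F.face g.1 v)).card : ℤ) = q + c := by
      rw [F.card_face g.1 hv, g.2]; omega
    rw [dif_pos hc, ← mul_one ((sgn (F.verts g.1) v : ℤ) : R), ← smul_eq_mul,
      ← Finsupp.smul_single, map_smul, Submodule.coe_smul, finsuppEquiv_single, Pi.smul_apply,
      Pi.single_apply]
    simp [eq_comm]
  exact LinearMap.congr_fun this x

/-- The matrix model of the chain complex of a finite face system. -/
noncomputable def matrixModel :
    MatrixModel (F.complex R c) (F.mat R) (fun q g => ((F.verts g).card : ℤ) = q + c) where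
  equiv q := F.finsuppEquiv R c q
  equiv_d p q h x := F.finsuppEquiv_d R c p q h x
  supp p q h g g' hg hq := by
    have h1 := F.card_of_mat_ne_zero R hg
    have h2 : q + 1 = p := h
    omega
  rel_prev j := by rw [ChainComplex.prev]; exact rfl
  rel_next j := by simp

open Classical in
/-- Linear forms on the chains of a finite face system as functions. -/
noncomputable def dualEquiv (q : ℤ) : Module.Dual R (F.GenDeg c q →₀ R) ≃ₗ[R]
    suppOn R (fun g : F.Gen => ((F.verts g).card : ℤ) = q + c) where
  toFun φ := ⟨fun g => if h : ((F.verts g).card : ℤ) = q + c then φ (Finsupp.single ⟨g, h⟩ 1) else 0,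
    fun g hg => dif_neg hg⟩
  invFun y := Finsupp.linearCombination R fun g => y.1 g.1
  map_add' x y := by
    apply Subtype.ext; funext g
    by_cases h : ((F.verts g).card : ℤ) = q + c <;> simp [h]
  map_smul' r x := by
    apply Subtype.ext; funext g
    by_cases h : ((F.verts g).card : ℤ) = q + c <;> simp [h]
  left_inv φ := by
    ext g
    simp [g.2]
  right_inv y := by
    apply Subtype.ext; funext g
    by_cases h : ((F.verts g).card : ℤ) = q + c
    · simp [h]
    · simp [h, y.2 g h]

theorem dualEquiv_apply (q : ℤ) (φ : Module.Dual R (F.GenDeg c q →₀ R)) (g : F.GenDeg c q) :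
    (F.dualEquiv R c q φ).1 g.1 = φ (Finsupp.single g 1) :=
  dif_pos g.2

theorem dualEquiv_d (p q : ℤ) (h : p + 1 = q) (φ : Module.Dual R (F.GenDeg c p →₀ R)) :
    (F.dualEquiv R c q (φ ∘ₗ F.d R c q p)).1 =
      Matrix.vecMul (F.dualEquiv R c p φ).1 (F.mat R).transpose := by
  classical
  funext g
  rw [Matrix.vecMul_transpose]
  by_cases hg : ((F.verts g).card : ℤ) = q + c
  · rw [F.dualEquiv_apply R c q _ ⟨g, hg⟩, LinearMap.comp_apply, d,
      Finsupp.linearCombination_single, one_smul, bd, map_sum]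
    simp only [Matrix.mulVec, dotProduct, mat, Finset.sum_mul]
    rw [Finset.sum_comm]
    refine Finset.sum_congr rfl fun v hv => ?_
    have hc : ((F.verts (F.face g v)).card : ℤ) = p + c := by
      rw [F.card_face g hv, hg]; omega
    rw [dif_pos hc, ← mul_one ((sgn (F.verts g) v : ℤ) : R), ← smul_eq_mul,
      ← Finsupp.smul_single, map_smul, ← F.dualEquiv_apply R c p φ ⟨F.face g v, hc⟩]
    simp
  -- Outside degree `q` both sides vanish: a nonzero entry in the row of `g` leads to a generator
  -- outside degree `p`, where the vector of `φ` is zero.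
  · rw [(F.dualEquiv R c q _).2 g hg]
    symm
    refine Finset.sum_eq_zero fun g' _ => ?_
    change F.mat R g g' * _ = 0
    by_cases hz : F.mat R g g' = 0
    · rw [hz, zero_mul]
    · have h1 := F.card_of_mat_ne_zero R hz
      rw [(F.dualEquiv R c p φ).2 g' (by omega), mul_zero]

/-- The matrix model of the dual of the chain complex of a finite face system. -/
noncomputable def dualMatrixModel :
    MatrixModel (dualComplex (F.complex R c)) (F.mat R).transpose
      (fun q g => ((F.verts g).card : ℤ) = q + c) where
  equiv q := F.dualEquiv R c q
  equiv_d p q h x := F.dualEquiv_d R c p q h x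
  supp p q h g g' hg hq := by
    have h1 := F.card_of_mat_ne_zero R hg
    have h2 : p + 1 = q := h
    omega
  rel_prev j := by simp
  rel_next j := by rw [CochainComplex.next]; exact rfl

end FaceSystem


/-! ### Generalized inverses and idempotents of graded matrices -/

section Graded

variable {R : Type u} [CommRing R] {I J K L : Type} [Fintype I] [Fintype J] [Fintype K] [Fintype L]

/-- The matrix `M` is homogeneous of degree `n`. -/
def IsHomog (deg : I → ℤ) (deg' : J → ℤ) (n : ℤ) (M : Matrix I J R) : Prop :=
  ∀ i j, M i j ≠ 0 → deg' j = deg i + n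

section

variable {d : I → ℤ} {d' : J → ℤ} {d'' : K → ℤ} {n n' : ℤ}

omit [Fintype I] [Fintype K] in
theorem IsHomog.mul {M : Matrix I J R} {N : Matrix J K R} (hM : IsHomog d d' n M)
    (hN : IsHomog d' d'' n' N) {k : ℤ} (hk : n + n' = k) : IsHomog d d'' k (M * N) := by
  intro i j h
  obtain ⟨l, -, hl⟩ := Finset.exists_ne_zero_of_sum_ne_zero h
  have h1 := hM i l (left_ne_zero_of_mul hl)
  have h2 := hN l j (right_ne_zero_of_mul hl)
  omega

omit [Fintype I] [Fintype J] in
theorem IsHomog.add {M N : Matrix I J R} (hM : IsHomog d d' n M) (hN : IsHomog d d' n N) :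
    IsHomog d d' n (M + N) := by
  intro i j h
  by_cases h0 : M i j = 0
  · refine hN i j fun h1 => h ?_
    rw [Matrix.add_apply, h0, h1, add_zero]
  · exact hM i j h0

omit [Fintype I] [Fintype J] in
theorem IsHomog.sub {M N : Matrix I J R} (hM : IsHomog d d' n M) (hN : IsHomog d d' n N) :
    IsHomog d d' n (M - N) := by
  intro i j h
  by_cases h0 : M i j = 0
  · refine hN i j fun h1 => h ?_
    rw [Matrix.sub_apply, h0, h1, sub_zero]
  · exact hM i j h0

omit [Fintype I] in
theorem isHomog_diagonal [DecidableEq I] (d : I → ℤ) (v : I → R) :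
    IsHomog d d 0 (Matrix.diagonal v) := by
  intro i j h
  by_cases hij : i = j
  · simp [hij]
  · exact absurd (Matrix.diagonal_apply_ne v hij) h

omit [Fintype I] in
theorem isHomog_one [DecidableEq I] (d : I → ℤ) : IsHomog d d 0 (1 : Matrix I I R) :=
  isHomog_diagonal d _

end

/-- A matrix over a principal ideal domain whose row space is saturated has a generalized
inverse. -/
theorem exists_generalized_inverse [IsDomain R] [IsPrincipalIdealRing R] [DecidableEq I]
    [DecidableEq J] (M : Matrix I J R)
    (h : ∀ (r : R) (c : J → R), r ≠ 0 → (∃ y, Matrix.vecMul y M = r • c) →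
      ∃ y, Matrix.vecMul y M = c) :
    ∃ N : Matrix J I R, M * N * M = M := by
  set B := LinearMap.range M.vecMulLinear with hB
  -- Saturation of the row space `B` means that the quotient is torsion-free, hence free, so `B` is
  -- a direct summand.
  have tf : Module.IsTorsionFree R ((J → R) ⧸ B) := by
    refine Module.IsTorsionFree.of_smul_eq_zero fun r x hx => ?_
    obtain ⟨c, rfl⟩ := Submodule.Quotient.mk_surjective _ x
    rw [or_iff_not_imp_left]
    intro hr
    rw [← Submodule.Quotient.mk_smul, Submodule.Quotient.mk_eq_zero] at hx
    rw [Submodule.Quotient.mk_eq_zero]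
    obtain ⟨y, hy⟩ := h r c hr hx
    exact ⟨y, hy⟩
  have fr : Module.Free R ((J → R) ⧸ B) := Module.free_of_finite_type_torsion_free'
  obtain ⟨s, hs⟩ := B.mkQ.exists_rightInverse_of_surjective B.range_mkQ
  -- The row space is itself free, so the surjection of `I → R` onto it splits. The generalized
  -- inverse projects onto `B` and then applies this splitting.
  have frB : Module.Free R B := inferInstance
  obtain ⟨t, ht⟩ := (M.vecMulLinear.rangeRestrict).exists_rightInverse_of_surjective
    (LinearMap.range_rangeRestrict _)
  let pr : (J → R) →ₗ[R] B := (LinearMap.id - s ∘ₗ B.mkQ).codRestrict B (by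
    intro c
    rw [← Submodule.Quotient.mk_eq_zero]
    change B.mkQ (c - s (B.mkQ c)) = 0
    rw [map_sub, sub_eq_zero]
    exact (LinearMap.congr_fun hs (B.mkQ c)).symm)
  let g : (J → R) →ₗ[R] (I → R) := t ∘ₗ pr
  have hg : ∀ c ∈ B, Matrix.vecMul (g c) M = c := by
    intro c hc
    have h1 : (pr c).1 = c := by
      change c - s (B.mkQ c) = c
      rw [(Submodule.Quotient.mk_eq_zero B).2 hc |> (show B.mkQ c = 0 from ·), map_zero, sub_zero]
    have h2 := congrArg Subtype.val (LinearMap.congr_fun ht (pr c))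
    exact h2.trans h1
  refine ⟨LinearMap.toMatrixRight' g, ?_⟩
  have hN : ∀ c, Matrix.vecMul c (LinearMap.toMatrixRight' g) = g c := by
    intro c
    have := LinearMap.congr_fun (Matrix.toLinearMapRight'.apply_symm_apply g) c
    exact this
  refine Matrix.ext_of_single_vecMul fun i => ?_
  rw [← Matrix.vecMul_vecMul, ← Matrix.vecMul_vecMul, hN]
  exact hg _ ⟨_, rfl⟩

/-- In the product M N M, homogeneity of M lets only the entries of N of degree -n contribute. All
other entries of a generalized inverse may be replaced by zero. -/
theorem exists_homog_generalized_inverse [IsDomain R] [IsPrincipalIdealRing R] [DecidableEq I]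
    [DecidableEq J] {d : I → ℤ} {d' : J → ℤ} {n : ℤ} (M : Matrix I J R) (hM : IsHomog d d' n M)
    (h : ∀ (r : R) (c : J → R), r ≠ 0 → (∃ y, Matrix.vecMul y M = r • c) →
      ∃ y, Matrix.vecMul y M = c) (n' : ℤ) (hn : n + n' = 0) :
    ∃ N : Matrix J I R, IsHomog d' d n' N ∧ M * N * M = M := by
  obtain ⟨N, hN⟩ := exists_generalized_inverse M h
  let N' : Matrix J I R := Matrix.of fun j i => if d i = d' j + n' then N j i else 0
  have h1 : IsHomog d' d n' N' := by
    intro j i hne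
    by_contra hc
    exact hne (if_neg hc)
  refine ⟨N', h1, ?_⟩
  ext i j
  by_cases hij : d' j = d i + n
  · conv_rhs => rw [← hN]
    simp only [Matrix.mul_apply, Finset.sum_mul]
    refine Finset.sum_congr rfl fun i' _ => Finset.sum_congr rfl fun j' _ => ?_
    by_cases hz : M i j' = 0
    · simp [hz]
    by_cases hz' : M i' j = 0
    · simp [hz']
    have e1 := hM i j' hz
    have e2 := hM i' j hz'
    have e3 : N' j' i' = N j' i' := if_pos (by omega)
    rw [e3]
  · have z1 : M i j = 0 := by
      by_contra hc; exact hij (hM i j hc)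
    rw [z1]
    by_contra hc
    exact hij (((hM.mul h1 rfl).mul hM (k := n) (by omega)) i j hc)

/-- A homogeneous idempotent matrix over a principal ideal domain splits. -/
theorem exists_factorization_of_idempotent [IsDomain R] [IsPrincipalIdealRing R] [DecidableEq L]
    (d : L → ℤ) (E : Matrix L L R) (hE : IsHomog d d 0 E) (hEE : E * E = E) :
    ∃ (T : Type) (_ : Fintype T) (_ : DecidableEq T) (dT : T → ℤ) (p : Matrix L T R)
      (q : Matrix T L R), IsHomog d dT 0 p ∧ IsHomog dT d 0 q ∧ p * q = E ∧ q * p = 1 := by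
  classical
  -- The degree `n` part of the row space of `E`, as the vectors fixed by `E`. The rows of `q` will
  -- be bases of these free modules, and those of `p` the coordinates of the rows of `E`.
  let Y : ℤ → Submodule R (L → R) := fun n =>
    suppOn R (fun l => d l = n) ⊓ LinearMap.ker (E.vecMulLinear - LinearMap.id)
  have hY : ∀ n c, c ∈ Y n ↔ (∀ l, d l ≠ n → c l = 0) ∧ Matrix.vecMul c E = c := by
    intro n c
    rw [← sub_eq_zero (a := Matrix.vecMul c E)]
    rfl
  let b : ∀ n, Module.Basis (Fin (Module.finrank R (Y n))) R (Y n) := fun n => Module.finBasis R (Y n)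
  -- Only degrees that occur are used, so that `T` is finite.
  let T := Σ n : Set.range d, Fin (Module.finrank R (Y n.1))
  have hrow : ∀ l, E l ∈ Y (d l) := by
    intro l
    rw [hY]
    refine ⟨fun l' hl' => ?_, ?_⟩
    · by_contra hne
      have := hE l l' hne
      omega
    · have := congrFun hEE l
      rwa [Matrix.mul_apply_eq_vecMul] at this
  let q : Matrix T L R := fun t => (b t.1.1 t.2).1
  let p : Matrix L T R := fun l t =>
    if h : t.1.1 = d l then (b t.1.1).repr ⟨E l, h ▸ hrow l⟩ t.2 else 0
  have hp : IsHomog d (fun t : T => t.1.1) 0 p := by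
    intro l t h
    by_contra hc
    exact h (dif_neg (by simpa using hc))
  have hq : IsHomog (fun t : T => t.1.1) d 0 q := by
    intro t l h
    by_contra hc
    exact h (((hY _ _).1 (b t.1.1 t.2).2).1 l (by simpa using hc))
  have hpq : p * q = E := by
    funext l
    have e1 : (p * q) l = ∑ i, (b (d l)).repr ⟨E l, hrow l⟩ i • (b (d l) i).1 := by
      funext l'
      rw [Matrix.mul_apply, Fintype.sum_sigma, Fintype.sum_eq_single (⟨d l, l, rfl⟩ : Set.range d)]
      · rw [Finset.sum_apply]
        refine Finset.sum_congr rfl fun i _ => ?_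
        change dite _ _ _ * _ = _
        rw [dif_pos rfl]
        rfl
      · intro n hn
        refine Finset.sum_eq_zero fun i _ => ?_
        have : p l ⟨n, i⟩ = 0 := dif_neg fun h => hn (Subtype.ext h)
        rw [this, zero_mul]
    rw [e1]
    have := congrArg Subtype.val ((b (d l)).sum_repr ⟨E l, hrow l⟩)
    rwa [AddSubmonoidClass.coe_finsetSum] at this
  have hqE : q * E = q := by
    funext t
    rw [Matrix.mul_apply_eq_vecMul]
    exact ((hY _ _).1 (b t.1.1 t.2).2).2
  have hinj : ∀ x : T → R, Matrix.vecMul x q = 0 → x = 0 := by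
    intro x hx
    funext t
    obtain ⟨n, i⟩ := t
    have e2 : ∑ i, x ⟨n, i⟩ • b n.1 i = 0 := by
      apply Subtype.ext
      funext l
      rw [AddSubmonoidClass.coe_finsetSum, Finset.sum_apply]
      by_cases hl : d l = n.1
      · have := congrFun hx l
        rw [Matrix.vecMul, dotProduct, Fintype.sum_sigma, Fintype.sum_eq_single n] at this
        · exact this
        · intro n' hn'
          refine Finset.sum_eq_zero fun i' _ => ?_
          have : q ⟨n', i'⟩ l = 0 := by
            by_contra hne
            have := hq _ _ hne
            exact hn' (Subtype.ext (by change d l = n'.1 + 0 at this; omega))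
          rw [this, mul_zero]
      · refine Finset.sum_eq_zero fun i' _ => ?_
        have : (b n.1 i').1 l = 0 := ((hY _ _).1 (b n.1 i').2).1 l hl
        change x _ • (b n.1 i').1 l = 0
        rw [this, smul_zero]
    exact Fintype.linearIndependent_iff.1 (b n.1).linearIndependent (fun i => x ⟨n, i⟩) e2 i
  refine ⟨T, inferInstance, inferInstance, fun t => t.1.1, p, q, hp, hq, hpq, ?_⟩
  -- The rows of `q` are linearly independent, so `q` may be cancelled on the right.
  have h0 : (q * p - 1) * q = 0 := by
    rw [Matrix.sub_mul, Matrix.mul_assoc, hpq, hqE, Matrix.one_mul, sub_self]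
  rw [← sub_eq_zero]
  funext t
  refine hinj _ ?_
  rw [← Matrix.mul_apply_eq_vecMul, h0]; rfl

end Graded

/-! ### Homotopies of filtered differential rings -/

section Ring

variable {S : Type u} [Ring S]

/-- The element h = NDN satisfies both DhD = D and hDh = h. Subtracting hhD preserves these
equations, because DD = 0, and makes the square vanish. -/
theorem exists_special_homotopy {D N : S} (hD : D * D = 0) (hN : D * N * D = D) :
    ∃ k, k = N * D * N - N * D * N * (N * D * N) * D ∧ D * k * D = D ∧ k * D * k = k ∧
      k * k = 0 := by
  have e : N * D * N * D * (N * D * N) = N * D * N := by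
    calc _ = N * (D * N * D) * N * D * N := by noncomm_ring
    _ = N * D * N * D * N := by rw [hN]
    _ = N * (D * N * D) * N := by noncomm_ring
    _ = _ := by rw [hN]
  have e2 : D * (N * D * N) * D = D := by
    calc _ = (D * N * D) * N * D := by noncomm_ring
    _ = _ := by rw [hN, hN]
  generalize N * D * N = h at e e2
  refine ⟨h - h * h * D, rfl, ?_, ?_, ?_⟩
  · linear_combination (norm := noncomm_ring) e2 - D * h * h * hD
  · linear_combination (norm := noncomm_ring) e - h * h * hD * h - e * h * D + h * h * hD * h * h * D
  · linear_combination (norm := noncomm_ring) - h * e + h * e * h * D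

end Ring

/-! ### Contraction of a differential with a two-step filtration -/

section Ring

variable {S : Type u} [Ring S]

/-- The operators obtained by contracting a filtered differential `D`, the filtration being given by
the idempotent `e`, with the help of special homotopies `x` and `y` of the two graded pieces. -/
theorem filtered_contraction {e D x y pw pu : S} (hpw : pw = e - e * D * x - x * D)
    (hpu : pu = (1 - e) - D * y - y * D * (1 - e))
    (hee : e * e = e) (heD : e * D * e = e * D) (hDD : D * D = 0)
    (hx1 : e * x = x) (hx2 : x * e = x) (hx3 : e * D * x * D = e * D) (hx4 : x * D * x = x)
    (hx5 : x * x = 0) (hy1 : e * y = 0) (hy2 : y * e = 0)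
    (hy3 : D * y * D * (1 - e) = D * (1 - e)) (hy4 : y * D * y = y) (hy5 : y * y = 0) :
    (e * pw = pw ∧ pw * e = pw ∧ pw * pw = pw ∧ pw * D = 0 ∧ x * pw = 0) ∧
    (e * pu = 0 ∧ pu * e = 0 ∧ pu * pu = pu ∧ D * pu = 0 ∧ pu * y = 0) ∧
    (D - D * y * D) * pw = pu * D * pw ∧ pu * (D - D * x * D) = pu * D * pw ∧
    1 - ((1 - y * D) * pw + pu * (1 - D * x)) =
      D * (x + y - y * D * x) + (x + y - y * D * x) * D := by
  -- Products act on row vectors from left to right. Thus `pw` projects the subcomplex, and `pu` the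
  -- quotient, onto representatives of homology, and `pu * D * pw` is the connecting map between
  -- them.
  have a1 : x * D * e = x * D := by
    linear_combination (norm := noncomm_ring) x * heD - hx2 * D * e + hx2 * D
  have a2 : e * D * y = 0 := by
    linear_combination (norm := noncomm_ring) e * D * hy1 - heD * y
  have h1 : e * pw = pw := by
    rw [hpw]; linear_combination (norm := noncomm_ring) hee - hee * D * x - hx1 * D
  have h2 : pw * e = pw := by
    rw [hpw]; linear_combination (norm := noncomm_ring) hee - e * D * hx2 - a1
  have h4 : pw * D = 0 := by
    rw [hpw]; linear_combination (norm := noncomm_ring) - hx3 - x * hDD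
  have h5 : x * pw = 0 := by
    rw [hpw]; linear_combination (norm := noncomm_ring) hx2 - hx2 * D * x - hx4 - hx5 * D
  have h5' : pw * x = 0 := by
    rw [hpw]; linear_combination (norm := noncomm_ring) hx1 - e * D * hx5 - hx4
  have h3 : pw * pw = pw := by
    have : pw * pw = pw * e - (pw * e) * D * x - pw * x * D := by
      conv_lhs => enter [2]; rw [hpw]
      noncomm_ring
    rw [this, h2, h4, h5']; noncomm_ring
  have h6 : e * pu = 0 := by
    rw [hpu]; linear_combination (norm := noncomm_ring) - hee - a2 - hy1 * D * (1 - e)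
  have h7 : pu * e = 0 := by
    rw [hpu]; linear_combination (norm := noncomm_ring) - hee - D * hy2 + y * D * hee
  have h9 : D * pu = 0 := by
    rw [hpu]; linear_combination (norm := noncomm_ring) - hy3 - hDD * y
  have h10 : pu * y = 0 := by
    rw [hpu]; linear_combination (norm := noncomm_ring) - hy1 - D * hy5 - hy4 + y * D * hy1
  have a3 : pu * D * y = 0 := by
    rw [hpu]
    linear_combination (norm := noncomm_ring) - D * hy4 - a2 - y * hDD * y + y * D * a2
  have h8 : pu * pu = pu := by
    have : pu * pu = pu - pu * e - pu * D * y - pu * y * D * (1 - e) := by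
      conv_lhs => enter [2]; rw [hpu]
      noncomm_ring
    rw [this, h7, a3, h10]; noncomm_ring
  have a4 : e * D * pw = 0 := by
    rw [hpw]
    linear_combination (norm := noncomm_ring) heD - heD * D * x - e * hDD * x - hx3
  have a5 : pu * D * (1 - e) = 0 := by
    rw [hpu]
    linear_combination (norm := noncomm_ring) - hy3 + heD - y * hDD * (1 - e) - y * D * heD
  refine ⟨⟨h1, h2, h3, h4, h5⟩, ⟨h6, h7, h8, h9, h10⟩, ?_, ?_, ?_⟩
  · have : (D - D * y * D) * pw - pu * D * pw = e * D * pw + y * (D * D) * pw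
        - y * D * (e * D * pw) := by
      rw [hpu]; noncomm_ring
    rw [← sub_eq_zero, this, a4, hDD]; noncomm_ring
  · have : pu * (D - D * x * D) - pu * D * pw = pu * D * (1 - e) + pu * (D * D) * x
        - pu * D * (1 - e) * D * x := by
      rw [hpw]; noncomm_ring
    rw [← sub_eq_zero, this, a5, hDD]; noncomm_ring
  -- After expansion the two sides differ only by a multiple of yDDx. The term `- y * D * x` in the
  -- homotopy is the correction that couples the two pieces of the filtration.
  · rw [hpw, hpu]; linear_combination (norm := noncomm_ring) - y * hDD * x

end Ring

/-! ### The minimal model of a pair -/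

instance : Fintype Letter := ⟨{.α, .β, .γ, .η}, fun x => by cases x <;> decide⟩

/-- The basis of `T_*^𝒳 ⊗̂ M`, where `M` has the basis `B`. -/
abbrev Good (B : Idx → Type) : Type := Σ l : Letter, B l.idx

/-- Replace the letter `β` by `γ`. -/
def Good.toGamma {B : Idx → Type} : Good B → Good B
  | ⟨.α, b⟩ => ⟨.α, b⟩
  | ⟨.β, b⟩ => ⟨.γ, b⟩
  | ⟨.γ, b⟩ => ⟨.γ, b⟩
  | ⟨.η, b⟩ => ⟨.η, b⟩

/-- The degree of a basis element of `T_*^𝒳 ⊗̂ M`. -/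
def Good.deg {B : Idx → Type} (dB : ∀ s, B s → ℤ) (g : Good B) : ℤ :=
  dB _ g.2 + if g.1 = .β then 1 else 0

/-- The basis elements that belong to the subcomplex `S_* ⊗̂ M`. -/
def Good.inSub {B : Idx → Type} (g : Good B) : Prop := g.1 = .γ ∨ g.1 = .η

/-- The differential `β ↦ γ`. -/
def Good.mat (R : Type u) [CommRing R] (B : Idx → Type) [∀ s, DecidableEq (B s)] :
    Matrix (Good B) (Good B) R :=
  Matrix.of fun g g' => if g.1 = .β ∧ g' = g.toGamma then 1 else 0

section

variable {R : Type u} [CommRing R] {B : Idx → Type} [∀ s, DecidableEq (B s)]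

theorem Good.mat_of_ne (g g' : Good B) (h : g.1 ≠ .β) : Good.mat R B g g' = 0 :=
  if_neg fun h' => h h'.1

theorem Good.mat_beta (b : B .ker) (g' : Good B) :
    Good.mat R B ⟨.β, b⟩ g' = if g' = ⟨.γ, b⟩ then 1 else 0 := by
  simp [Good.mat, Good.toGamma]

theorem Good.mat_of_ne' (g g' : Good B) (h : g'.1 ≠ .γ) : Good.mat R B g g' = 0 := by
  obtain ⟨x, b⟩ := g
  by_cases hx : x = .β
  · subst hx
    refine (Good.mat_beta (R := R) b g').trans (if_neg ?_)
    rintro rfl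
    exact h rfl
  · exact Good.mat_of_ne _ _ hx

theorem Good.vecMul_mat_gamma [∀ s, Fintype (B s)] (f : Good B → R) (b : B .ker) :
    Matrix.vecMul f (Good.mat R B) ⟨.γ, b⟩ = f ⟨.β, b⟩ := by
  refine (Finset.sum_eq_single (⟨.β, b⟩ : Good B) ?_ fun h => absurd (Finset.mem_univ _) h).trans ?_
  · rintro ⟨x, c⟩ - hne
    by_cases hx : x = .β
    · subst hx
      refine (congrArg (f _ * ·) ((Good.mat_beta c _).trans (if_neg ?_))).trans (mul_zero _)
      intro h
      exact hne (by rw [eq_of_heq (Sigma.mk.inj h).2])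
    · exact (congrArg (f _ * ·) (Good.mat_of_ne _ _ hx)).trans (mul_zero _)
  · exact (congrArg (f _ * ·) ((Good.mat_beta b _).trans (if_pos rfl))).trans (mul_one _)

theorem Good.vecMul_mat_of_ne [∀ s, Fintype (B s)] (f : Good B → R) (g : Good B) (h : g.1 ≠ .γ) :
    Matrix.vecMul f (Good.mat R B) g = 0 :=
  Finset.sum_eq_zero fun _ _ =>
    (congrArg (f _ * ·) (Good.mat_of_ne' _ _ h)).trans (mul_zero _)

theorem Good.mat_mulVec_beta [∀ s, Fintype (B s)] (f : Good B → R) (b : B .ker) :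
    Matrix.mulVec (Good.mat R B) f ⟨.β, b⟩ = f ⟨.γ, b⟩ := by
  refine (Finset.sum_eq_single (⟨.γ, b⟩ : Good B) ?_ fun h => absurd (Finset.mem_univ _) h).trans ?_
  · intro g _ hne
    exact (congrArg (· * f _) ((Good.mat_beta b _).trans (if_neg hne))).trans (zero_mul _)
  · exact (congrArg (· * f _) ((Good.mat_beta b _).trans (if_pos rfl))).trans (one_mul _)

theorem Good.mat_mulVec_of_ne [∀ s, Fintype (B s)] (f : Good B → R) (g : Good B) (h : g.1 ≠ .β) :
    Matrix.mulVec (Good.mat R B) f g = 0 :=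
  Finset.sum_eq_zero fun _ _ =>
    (congrArg (· * f _) (Good.mat_of_ne _ _ h)).trans (zero_mul _)

theorem Good.inSub_of_mat_ne_zero (g g' : Good B) (h : Good.mat R B g g' ≠ 0) : g'.inSub := by
  by_contra h'
  exact h (Good.mat_of_ne' g g' fun h2 => h' (Or.inl h2))

end

/-- A filtered contraction of the complex with differential `D`, and with the subcomplex spanned by
`a`, onto a complex with differential `β ↦ γ`. -/
structure PairContraction {R : Type u} [CommRing R] {L : Type} [Fintype L] [DecidableEq L]
    (deg : L → ℤ) (a : L → Prop) (D : Matrix L L R) where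
  B : Idx → Type
  [fintype : ∀ s, Fintype (B s)]
  [decEq : ∀ s, DecidableEq (B s)]
  dB : ∀ s, B s → ℤ
  P : Matrix L (Good B) R
  Q : Matrix (Good B) L R
  h : Matrix L L R
  isRetraction : IsRetraction D (Good.mat R B) P Q h
  homP : IsHomog deg (Good.deg dB) 0 P
  homQ : IsHomog (Good.deg dB) deg 0 Q
  homh : IsHomog deg deg 1 h
  filtP : ∀ l g, P l g ≠ 0 → a l → g.inSub
  filtQ : ∀ g l, Q g l ≠ 0 → g.inSub → a l
  filth : ∀ l l', h l l' ≠ 0 → a l → a l'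

attribute [instance] PairContraction.fintype PairContraction.decEq

section

variable {R : Type u} [CommRing R] {L : Type} [Fintype L] [DecidableEq L]

/-- A dependent function on the letters with values in the index set. -/
def letterElim {M : Idx → Type u} (a : M .coker) (b c : M .ker) (d : M .im) :
    ∀ x : Letter, M x.idx
  | .α => a
  | .β => b
  | .γ => c
  | .η => d

omit [DecidableEq L] in
theorem sum_good {M : Type*} [AddCommMonoid M] {B : Idx → Type} [∀ s, Fintype (B s)]
    (f : Good B → M) : ∑ g, f g = (∑ b, f ⟨.α, b⟩) + (∑ b, f ⟨.β, b⟩) + (∑ b, f ⟨.γ, b⟩) +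
      ∑ b, f ⟨.η, b⟩ := by
  rw [Fintype.sum_sigma]
  have : (Finset.univ : Finset Letter) = {.α, .β, .γ, .η} := rfl
  rw [this, Finset.sum_insert (by decide), Finset.sum_insert (by decide),
    Finset.sum_insert (by decide), Finset.sum_singleton, add_assoc, add_assoc]

-- Multiplying by the matrix β ↦ γ on the right moves the β columns to γ and kills the others;
-- multiplying on the left moves the γ rows to β. So the chain map equations separate into one
-- equation per letter.
omit [Fintype L] [DecidableEq L] in
theorem exists_pairContraction_of_letters [Fintype L] [DecidableEq L]
    (deg : L → ℤ) (a : L → Prop) (D : Matrix L L R)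
    (B : Idx → Type) [∀ s, Fintype (B s)] [∀ s, DecidableEq (B s)] (dB : ∀ s, B s → ℤ)
    (p : ∀ x : Letter, Matrix L (B x.idx) R) (q : ∀ x : Letter, Matrix (B x.idx) L R)
    (h : Matrix L L R)
    (hpα : D * p .α = 0) (hpβ : D * p .β = 0) (hpγ : D * p .γ = p .β) (hpη : D * p .η = 0)
    (hqα : q .α * D = 0) (hqβ : q .β * D = q .γ) (hqγ : q .γ * D = 0) (hqη : q .η * D = 0)
    (h1 : ∀ x, q x * p x = 1) (h0 : ∀ x y, x ≠ y → q x * p y = 0)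
    (hh : 1 - (p .α * q .α + p .β * q .β + p .γ * q .γ + p .η * q .η) = D * h + h * D)
    (dp : ∀ x, IsHomog deg (fun b => Good.deg dB ⟨x, b⟩) 0 (p x))
    (dq : ∀ x, IsHomog (fun b => Good.deg dB ⟨x, b⟩) deg 0 (q x))
    (dh : IsHomog deg deg 1 h)
    (fα : ∀ l b, a l → p .α l b = 0) (fβ : ∀ l b, a l → p .β l b = 0)
    (fγ : ∀ l b, ¬ a l → q .γ b l = 0) (fη : ∀ l b, ¬ a l → q .η b l = 0)
    (fh : ∀ l l', h l l' ≠ 0 → a l → a l') :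
    Nonempty (PairContraction deg a D) := by
  refine ⟨⟨B, dB, Matrix.of fun l g => p g.1 l g.2, Matrix.of fun g l => q g.1 g.2 l, h,
    ⟨?_, ?_, ?_, ?_⟩, ?_, ?_, dh, ?_, ?_, fh⟩⟩
  · ext l ⟨x, b⟩
    change (D * p x) l b =
      Matrix.vecMul (fun g : Good B => p g.1 l g.2) (Good.mat R B) ⟨x, b⟩
    cases x with
    | α => rw [hpα, Good.vecMul_mat_of_ne _ _ (fun h => by cases h)]; rfl
    | β => rw [hpβ, Good.vecMul_mat_of_ne _ _ (fun h => by cases h)]; rfl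
    | γ => exact (congrFun (congrFun hpγ l) b).trans (Good.vecMul_mat_gamma (fun g : Good B => p g.1 l g.2) b).symm
    | η => rw [hpη, Good.vecMul_mat_of_ne _ _ (fun h => by cases h)]; rfl
  · ext ⟨x, b⟩ l
    change Matrix.mulVec (Good.mat R B) (fun g : Good B => q g.1 g.2 l) ⟨x, b⟩ = (q x * D) b l
    cases x with
    | α => rw [hqα, Good.mat_mulVec_of_ne _ _ (fun h => by cases h)]; rfl
    | β => exact (Good.mat_mulVec_beta _ b).trans (congrFun (congrFun hqβ b) l).symm
    | γ => rw [hqγ, Good.mat_mulVec_of_ne _ _ (fun h => by cases h)]; rfl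
    | η => rw [hqη, Good.mat_mulVec_of_ne _ _ (fun h => by cases h)]; rfl
  · ext ⟨x, b⟩ ⟨y, c⟩
    have e1 : ((Matrix.of fun (g : Good B) l => q g.1 g.2 l) *
      Matrix.of fun l (g : Good B) => p g.1 l g.2) ⟨x, b⟩ ⟨y, c⟩ = (q x * p y) b c := rfl
    rw [e1]
    by_cases hxy : x = y
    · subst hxy
      rw [h1, Matrix.one_apply, Matrix.one_apply]
      simp
    · rw [h0 x y hxy, Matrix.one_apply_ne fun h => hxy (congrArg Sigma.fst h)]
      rfl
  · rw [← hh]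
    congr 1
    ext l l'
    rw [Matrix.mul_apply, sum_good]
    rfl
  · rintro l ⟨x, b⟩ hne
    exact dp x l b hne
  · rintro ⟨x, b⟩ l hne
    exact dq x b l hne
  · rintro l ⟨x, b⟩ hne hl
    cases x with
    | α => exact absurd (fα l b hl) hne
    | β => exact absurd (fβ l b hl) hne
    | γ => exact Or.inl rfl
    | η => exact Or.inr rfl
  · rintro ⟨x, b⟩ l hne hg
    by_contra hl
    cases x with
    | α => rcases hg with hg | hg <;> cases hg
    | β => rcases hg with hg | hg <;> cases hg
    | γ => exact hne (fγ l b hl)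
    | η => exact hne (fη l b hl)

end

section

variable {R : Type u} [CommRing R] [IsDomain R] [IsPrincipalIdealRing R] {L : Type} [Fintype L]
  [DecidableEq L]

/-- A generalized inverse N may be compressed to ENE, because ED = D = DE. The resulting homotopy
then lives on the summand cut out by E. -/
theorem exists_homog_special_homotopy {d : L → ℤ} (E D : Matrix L L R) (hE : IsHomog d d 0 E)
    (hD : IsHomog d d (-1) D) (hEE : E * E = E) (hED : E * D * E = D)
    (hDD : D * D = 0)
    (h : ∀ (r : R) (c : L → R), r ≠ 0 → (∃ y, Matrix.vecMul y D = r • c) →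
      ∃ y, Matrix.vecMul y D = c) :
    ∃ k : Matrix L L R, IsHomog d d 1 k ∧ E * k = k ∧ k * E = k ∧ D * k * D = D ∧ k * D * k = k ∧
      k * k = 0 := by
  obtain ⟨N, hN, hDN⟩ := exists_homog_generalized_inverse D hD h 1 (by norm_num)
  have hDE : D * E = D := by
    rw [← hED]; simp only [Matrix.mul_assoc, hEE]
  have hED' : E * D = D := by
    rw [← hED]; simp only [← Matrix.mul_assoc, hEE]
  have h1 : D * (E * N * E) * D = D := by
    calc _ = (D * E) * N * (E * D) := by simp only [Matrix.mul_assoc]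
    _ = D := by rw [hDE, hED', hDN]
  obtain ⟨k, hk, k1, k2, k3⟩ := exists_special_homotopy hDD h1
  have hN' : IsHomog d d 1 (E * N * E) := (hE.mul hN rfl).mul hE (by norm_num)
  have hM : IsHomog d d 1 (E * N * E * D * (E * N * E)) :=
    (hN'.mul hD rfl).mul hN' (by norm_num)
  refine ⟨k, ?_, ?_, ?_, k1, k2, k3⟩
  · rw [hk]
    exact hM.sub ((hM.mul hM rfl).mul hD (by norm_num))
  · rw [hk]
    simp only [Matrix.mul_sub, ← Matrix.mul_assoc, hEE]
  · rw [hk]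
    simp only [Matrix.sub_mul, Matrix.mul_assoc, hEE, hDE]

/-- The family of types over `Idx` with the given members. -/
def idxFamily (A B C : Type) : Idx → Type
  | .coker => A
  | .ker => B
  | .im => C

instance (A B C : Type) [Fintype A] [Fintype B] [Fintype C] : ∀ s, Fintype (idxFamily A B C s)
  | .coker => inferInstanceAs (Fintype A)
  | .ker => inferInstanceAs (Fintype B)
  | .im => inferInstanceAs (Fintype C)

instance (A B C : Type) [DecidableEq A] [DecidableEq B] [DecidableEq C] :
    ∀ s, DecidableEq (idxFamily A B C s)
  | .coker => inferInstanceAs (DecidableEq A)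
  | .ker => inferInstanceAs (DecidableEq B)
  | .im => inferInstanceAs (DecidableEq C)

/-- A filtered complex with torsion-free homology, such that the connecting homomorphism also has
torsion-free cokernel, can be contracted to a complex of the form `T_*^𝒳 ⊗̂ M`. -/
theorem nonempty_pairContraction (deg : L → ℤ) (a : L → Prop) (D : Matrix L L R)
    (hD : IsHomog deg deg (-1) D) (hDD : D * D = 0) (ha : ∀ l l', D l l' ≠ 0 → a l → a l')
    (t1 : ∀ (r : R) (w : L → R), r ≠ 0 → (∃ y ∈ suppOn R a, Matrix.vecMul y D = r • w) →
      ∃ y ∈ suppOn R a, Matrix.vecMul y D = w)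
    (t2 : ∀ (r : R) (w : L → R), r ≠ 0 → (∃ y, r • w - Matrix.vecMul y D ∈ suppOn R a) →
      ∃ y, w - Matrix.vecMul y D ∈ suppOn R a)
    (t3 : ∀ (r : R) (w : L → R), r ≠ 0 → w ∈ suppOn R a → Matrix.vecMul w D = 0 →
      (∃ y, Matrix.vecMul y D = r • w) → ∃ y, Matrix.vecMul y D = w) :
    Nonempty (PairContraction deg a D) := by
  classical
  -- The coordinate projection onto the subcomplex. The equation eDe = eD below expresses that the
  -- subcomplex is closed under the differential.
  set e : Matrix L L R := Matrix.diagonal fun l => if a l then 1 else 0 with he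
  have hvec : ∀ c : L → R, c ∈ suppOn R a ↔ Matrix.vecMul c e = c := by
    intro c
    constructor
    · intro hc
      funext l
      rw [he, Matrix.vecMul_diagonal]
      by_cases hl : a l
      · rw [if_pos hl, mul_one]
      · rw [hc l hl, zero_mul]
    · intro hc l hl
      rw [← hc, he, Matrix.vecMul_diagonal, if_neg hl, mul_zero]
  have de : IsHomog deg deg 0 e := isHomog_diagonal _ _
  have d1 : IsHomog deg deg 0 (1 : Matrix L L R) := isHomog_one _
  have hee : e * e = e := by
    rw [he, Matrix.diagonal_mul_diagonal]
    congr 1; funext l; split_ifs <;> simp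
  have heD : e * D * e = e * D := by
    ext l l'
    rw [he, Matrix.mul_diagonal, Matrix.diagonal_mul]
    by_cases hl : a l
    · by_cases hl' : a l'
      · rw [if_pos hl']; ring
      · have : D l l' = 0 := by
          by_contra hne; exact hl' (ha l l' hne hl)
        rw [this]; ring
    · rw [if_neg hl]; ring
  have cancel : ∀ (r : R) (c c' : L → R), r ≠ 0 → r • c = r • c' → c = c' :=
    fun r c c' hr h => smul_right_injective _ hr h
  have supp_of_smul : ∀ (r : R) (c : L → R), r ≠ 0 → r • c ∈ suppOn R a → c ∈ suppOn R a := by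
    intro r c hr hc
    rw [hvec] at hc ⊢
    rw [Matrix.smul_vecMul] at hc
    exact cancel r _ _ hr hc
  have hee' : (1 - e) * (1 - e) = 1 - e := by
    linear_combination (norm := noncomm_ring) hee
  -- The homotopy of the subcomplex, whose boundaries are saturated by `t1`.
  obtain ⟨x, dx, hx1, hx2, hx3, hx4, hx5⟩ := exists_homog_special_homotopy e (e * D) de
    (de.mul hD (by norm_num)) hee
    (by linear_combination (norm := noncomm_ring) hee * D * e + heD)
    (by linear_combination (norm := noncomm_ring) heD * D + e * hDD) (by
      rintro r c hr ⟨y, hy⟩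
      rw [← Matrix.vecMul_vecMul] at hy
      obtain ⟨y', hy', h'⟩ := t1 r c hr ⟨_, (hvec _).2 (by rw [Matrix.vecMul_vecMul, hee]), hy⟩
      exact ⟨y', by rw [← Matrix.vecMul_vecMul, (hvec _).1 hy', h']⟩)
  -- The homotopy of the quotient complex, whose boundaries are saturated by `t2`.
  obtain ⟨y, dy, hy1, hy2, hy3, hy4, hy5⟩ := exists_homog_special_homotopy (1 - e) (D * (1 - e))
    (d1.sub de) (hD.mul (d1.sub de) (by norm_num)) hee'
    (by linear_combination (norm := noncomm_ring) D * hee' + heD - e * D * hee + heD * e - heD * e)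
    (by linear_combination (norm := noncomm_ring) hDD * (1 - e) + D * heD)
    (by
      rintro r c hr ⟨y, hy⟩
      have hce : Matrix.vecMul c e = 0 := by
        refine cancel r _ _ hr ?_
        rw [← Matrix.smul_vecMul, ← hy, Matrix.vecMul_vecMul, smul_zero]
        have : D * (1 - e) * e = 0 := by
          linear_combination (norm := noncomm_ring) - D * hee
        rw [this, Matrix.vecMul_zero]
      obtain ⟨y', h'⟩ := t2 r c hr ⟨y, by
        rw [← hy, Matrix.mul_sub, Matrix.mul_one, Matrix.vecMul_sub, sub_sub_cancel_left,
          ← Matrix.vecMul_vecMul]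
        exact neg_mem ((hvec _).2 (by rw [Matrix.vecMul_vecMul, hee]))⟩
      refine ⟨y', ?_⟩
      rw [hvec, Matrix.sub_vecMul, hce, zero_sub] at h'
      rw [Matrix.mul_sub, Matrix.mul_one, Matrix.vecMul_sub, ← Matrix.vecMul_vecMul,
        sub_eq_add_neg, h']
      abel)
  have hy1' : e * y = 0 := by linear_combination (norm := noncomm_ring) - hy1
  have hy2' : y * e = 0 := by linear_combination (norm := noncomm_ring) - hy2
  set pw := e - e * D * x - x * D with hpw
  set pu := (1 - e) - D * y - y * D * (1 - e) with hpu
  have hxx4 : x * D * x = x := by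
    linear_combination (norm := noncomm_ring) hx4 - hx2 * D * x
  have hxx3 : e * D * x * D = e * D := by
    linear_combination (norm := noncomm_ring) hx3 - e * D * hx2 * D
  have hyy4 : y * D * y = y := by
    linear_combination (norm := noncomm_ring) hy4 + y * D * hy1'
  have hyy3 : D * y * D * (1 - e) = D * (1 - e) := by
    linear_combination (norm := noncomm_ring) hy3 + D * hy1' * D * (1 - e)
  obtain ⟨⟨w1, w2, w3, w4, w5⟩, ⟨u1, u2, u3, u4, u5⟩, m1, m2, m3⟩ :=
    filtered_contraction hpw hpu hee heD hDD hx1 hx2 hxx3 hxx4 hx5 hy1' hy2' hyy3 hyy4 hy5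
  have dpw : IsHomog deg deg 0 pw :=
    (de.sub ((de.mul hD rfl).mul dx (by norm_num))).sub (dx.mul hD (by norm_num))
  have dpu : IsHomog deg deg 0 pu :=
    ((d1.sub de).sub (hD.mul dy (by norm_num))).sub
      ((dy.mul hD rfl).mul (d1.sub de) (by norm_num))
  have dth : IsHomog deg deg (-1) (pu * D * pw) := (dpu.mul hD rfl).mul dpw (by norm_num)
  -- The connecting map has saturated image by `t3`: a multiple of c in its image bounds in the
  -- whole complex, hence so does c itself, and `m1` turns the bounding chain into a preimage.
  obtain ⟨N, dN, hN⟩ := exists_homog_generalized_inverse (pu * D * pw) dth (by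
    rintro r c hr ⟨v, hv⟩
    have hcw : Matrix.vecMul c pw = c := by
      refine cancel r _ _ hr ?_
      rw [← Matrix.smul_vecMul, ← hv, Matrix.vecMul_vecMul, Matrix.mul_assoc, w3]
    have hce : Matrix.vecMul c e = c := by
      rw [← hcw, Matrix.vecMul_vecMul, w2]
    obtain ⟨z, hz⟩ := t3 r c hr ((hvec c).2 hce)
      (by rw [← hcw, Matrix.vecMul_vecMul, w4, Matrix.vecMul_zero])
      -- By `m2` the boundary of this chain is the image of `v` under the connecting map.
      ⟨Matrix.vecMul v (pu * (1 - D * x)), by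
        rw [← hv, ← m2, Matrix.vecMul_vecMul]
        congr 1; noncomm_ring⟩
    refine ⟨z, ?_⟩
    have h0 : Matrix.vecMul c y = 0 := by
      rw [← hce, Matrix.vecMul_vecMul, hy1', Matrix.vecMul_zero]
    have h2 : pu * D * pw = D * pw - D * (y * (D * pw)) := by
      rw [← m1]; noncomm_ring
    rw [h2, Matrix.vecMul_sub, ← Matrix.vecMul_vecMul _ D, ← Matrix.vecMul_vecMul _ D,
      ← Matrix.vecMul_vecMul _ y, hz, h0, Matrix.zero_vecMul, sub_zero, hcw]) 1 (by norm_num)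
  set th := pu * D * pw with hth
  have hthw : th * pw = th := by rw [hth, Matrix.mul_assoc, w3]
  have huth : pu * th = th := by rw [hth]; simp only [← Matrix.mul_assoc, u3]
  -- The inverse is compressed between the two spaces of representatives and then replaced by M θ M,
  -- which makes the inverse relation symmetric.
  obtain ⟨ph, dph, hph, hph', hwph, hphu⟩ : ∃ ph : Matrix L L R, IsHomog deg deg 1 ph ∧
      th * ph * th = th ∧ ph * th * ph = ph ∧ pw * ph = ph ∧ ph * pu = ph := by
    have dM : IsHomog deg deg 1 (pw * N * pu) := (dpw.mul dN rfl).mul dpu (by norm_num)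
    have hM : th * (pw * N * pu) * th = th := by
      calc _ = (th * pw) * N * (pu * th) := by simp only [Matrix.mul_assoc]
      _ = th := by rw [hthw, huth, hN]
    have hM1 : pw * (pw * N * pu) = pw * N * pu := by simp only [← Matrix.mul_assoc, w3]
    have hM2 : (pw * N * pu) * pu = pw * N * pu := by simp only [Matrix.mul_assoc, u3]
    generalize pw * N * pu = M at dM hM hM1 hM2
    refine ⟨M * th * M, (dM.mul dth rfl).mul dM (by norm_num), ?_, ?_, ?_, ?_⟩
    · linear_combination (norm := noncomm_ring) hM * M * th + hM
    · linear_combination (norm := noncomm_ring) M * hM * M * th * M + M * hM * M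
    · simp only [← Matrix.mul_assoc, hM1]
    · simp only [Matrix.mul_assoc, hM2]
  have dtp : IsHomog deg deg 0 (th * ph) := dth.mul dph (by norm_num)
  have dpt : IsHomog deg deg 0 (ph * th) := dph.mul dth (by norm_num)
  -- Three idempotents cut the representatives into pieces. `pu - th * ph` belongs to the kernel of
  -- the connecting map, that is to coker ι; `th * ph` to a complement of that kernel, carried
  -- isomorphically onto ker ι; and `pw - ph * th` to im ι.
  have hEb : (th * ph) * (th * ph) = th * ph := by
    simp only [← Matrix.mul_assoc, hph]
  have hEa : (pu - th * ph) * (pu - th * ph) = pu - th * ph := by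
    linear_combination (norm := noncomm_ring) u3 - huth * ph - th * hphu + hEb
  have hEh : (pw - ph * th) * (pw - ph * th) = pw - ph * th := by
    linear_combination (norm := noncomm_ring) w3 - hwph * th - ph * hthw + ph * hph
  obtain ⟨Ta, _, _, dTa, pa, qa, dpa, dqa, pqa, qpa⟩ :=
    exists_factorization_of_idempotent deg _ (dpu.sub dtp) hEa
  obtain ⟨Tb, _, _, dTb, pb, qb, dpb, dqb, pqb, qpb⟩ :=
    exists_factorization_of_idempotent deg _ dtp hEb
  obtain ⟨Th, _, _, dTh, pη, qη, dph', dqh', pqh, qph⟩ :=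
    exists_factorization_of_idempotent deg _ (dpw.sub dpt) hEh
  set Ea := pu - th * ph with hEa'
  set Eh := pw - ph * th with hEh'
  have pa1 : Ea * pa = pa := by rw [← pqa, Matrix.mul_assoc, qpa, Matrix.mul_one]
  have qa1 : qa * Ea = qa := by rw [← pqa, ← Matrix.mul_assoc, qpa, Matrix.one_mul]
  have pb1 : (th * ph) * pb = pb := by rw [← pqb, Matrix.mul_assoc, qpb, Matrix.mul_one]
  have qb1 : qb * (th * ph) = qb := by rw [← pqb, ← Matrix.mul_assoc, qpb, Matrix.one_mul]
  have ph1 : Eh * pη = pη := by rw [← pqh, Matrix.mul_assoc, qph, Matrix.mul_one]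
  have qh1 : qη * Eh = qη := by rw [← pqh, ← Matrix.mul_assoc, qph, Matrix.one_mul]
  -- products that vanish
  have eth : e * th = 0 := by
    linear_combination (norm := noncomm_ring) e * hth + u1 * D * pw
  have Dth : D * th = 0 := by
    linear_combination (norm := noncomm_ring) D * hth + u4 * D * pw
  have thD : th * D = 0 := by
    linear_combination (norm := noncomm_ring) hth * D + pu * D * w4
  have the : th * e = th := by
    linear_combination (norm := noncomm_ring) hth * e + pu * D * w2 - hth
  have thy : th * y = 0 := by
    linear_combination (norm := noncomm_ring) th * hy1' - the * y
  have eEa : e * Ea = 0 := by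
    linear_combination (norm := noncomm_ring) e * hEa' + u1 - eth * ph
  have epa : e * pa = 0 := by rw [← pa1, ← Matrix.mul_assoc, eEa, Matrix.zero_mul]
  have epb : e * pb = 0 := by
    rw [← pb1, ← Matrix.mul_assoc, ← Matrix.mul_assoc, eth, Matrix.zero_mul, Matrix.zero_mul]
  have EaPu : Ea * pu = Ea := by
    linear_combination (norm := noncomm_ring) hEa' * pu + u3 - th * hphu - hEa'
  have qaPu : qa * pu = qa := by
    conv_lhs => rw [← qa1, Matrix.mul_assoc, EaPu, qa1]
  have qbPu : qb * pu = qb := by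
    conv_lhs => rw [← qb1, Matrix.mul_assoc, Matrix.mul_assoc, hphu, qb1]
  have pwEh : pw * Eh = Eh := by
    linear_combination (norm := noncomm_ring) pw * hEh' + w3 - hwph * th - hEh'
  have pwPh : pw * pη = pη := by
    conv_lhs => rw [← ph1, ← Matrix.mul_assoc, pwEh, ph1]
  have EhD : Eh * D = 0 := by
    linear_combination (norm := noncomm_ring) hEh' * D + w4 - ph * thD
  have Ehe : Eh * e = Eh := by
    linear_combination (norm := noncomm_ring) hEh' * e + w2 - ph * the - hEh'
  have qhe : qη * e = qη := by
    conv_lhs => rw [← qh1, Matrix.mul_assoc, Ehe, qh1]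
  have xpa : x * pa = 0 := by rw [← hx2, Matrix.mul_assoc, epa, Matrix.mul_zero]
  have xpb : x * pb = 0 := by rw [← hx2, Matrix.mul_assoc, epb, Matrix.mul_zero]
  -- Orthogonality of the corrected inclusion of the quotient homology and the corrected projection
  -- onto the homology of the subcomplex.
  have Z : pu * (1 - D * x) * (1 - y * D) * pw = 0 := by
    linear_combination (norm := noncomm_ring) pu * w1 * -1 + u2 * pw - u5 * D * pw - pu * D * w5
      + pu * D * x * hy1' * D * pw - pu * D * hx2 * y * D * pw
  have EaTh : Ea * th = 0 := by
    linear_combination (norm := noncomm_ring) hEa' * th + huth - hph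
  have thEh : th * Eh = 0 := by
    linear_combination (norm := noncomm_ring) th * hEh' + hthw - hph
  have EhPh : Eh * ph = 0 := by
    linear_combination (norm := noncomm_ring) hEh' * ph + hwph - hph'
  have key : (D - D * y * D) * ph = th * ph := by
    linear_combination (norm := noncomm_ring) D * y * D * hwph - D * hwph + m1 * ph
  have DEa : D * Ea = 0 := by
    linear_combination (norm := noncomm_ring) D * hEa' + u4 - Dth * ph
  have phEa : ph * Ea = 0 := by
    linear_combination (norm := noncomm_ring) ph * hEa' + hphu - hph'
  have Dy : D * (1 - y * D) = D - D * y * D := by noncomm_ring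
  have Dx : (1 - D * x) * D = D - D * x * D := by noncomm_ring
  have cx : ∀ {T T' : Type} [Fintype T] [Fintype T'] (q : Matrix T L R) (p : Matrix L T' R),
      x * p = 0 → q * (1 - D * x) * p = q * p := by
    intro T T' _ _ q p hp
    rw [Matrix.mul_sub, Matrix.mul_one, Matrix.sub_mul, ← Matrix.mul_assoc, Matrix.mul_assoc _ x, hp,
      Matrix.mul_zero, sub_zero]
  have cy : ∀ {T : Type} [Fintype T] (q : Matrix T L R), q * y = 0 → q * (1 - y * D) = q := by
    intro T _ q hq
    rw [Matrix.mul_sub, Matrix.mul_one, ← Matrix.mul_assoc, hq, Matrix.zero_mul, sub_zero]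
  have thye : qb * th * y = 0 := by rw [Matrix.mul_assoc, thy, Matrix.mul_zero]
  have qhy : qη * y = 0 := by rw [← qhe, Matrix.mul_assoc, hy1', Matrix.mul_zero]
  have Zq : ∀ {T : Type} [Fintype T] (q : Matrix T L R), q * pu = q →
      q * (1 - D * x) * (1 - y * D) * pw = 0 := by
    intro T _ q hq
    rw [← hq]
    simp only [Matrix.mul_assoc] at Z ⊢
    rw [Z, Matrix.mul_zero]
  -- β and γ share the basis `Tb`: the connecting map `th` carries the row of β to that of γ, and
  -- `ph` provides the matching projection. The factors `1 - y * D` and `1 - D * x` correct maps of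
  -- the graded pieces to maps of the filtered complex.
  let p : ∀ l : Letter, Matrix L (idxFamily Ta Tb Th l.idx) R :=
    letterElim (M := fun s => Matrix L (idxFamily Ta Tb Th s) R) pa pb ((1 - y * D) * ph * pb)
      ((1 - y * D) * pη)
  let q : ∀ l : Letter, Matrix (idxFamily Ta Tb Th l.idx) L R :=
    letterElim (M := fun s => Matrix (idxFamily Ta Tb Th s) L R) (qa * (1 - D * x))
      (qb * (1 - D * x)) (qb * th) qη
  have dy' : IsHomog deg deg 0 (1 - y * D) := d1.sub (dy.mul hD (by norm_num))
  have dx' : IsHomog deg deg 0 (1 - D * x) := d1.sub (hD.mul dx (by norm_num))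
  have row : ∀ {T : Type} (M : Matrix L T R), e * M = 0 → ∀ l b, a l → M l b = 0 := by
    intro T M hM l b hl
    have := congrFun (congrFun hM l) b
    rwa [he, Matrix.diagonal_mul, if_pos hl, one_mul] at this
  have col : ∀ {T : Type} (M : Matrix T L R), M * e = M → ∀ l b, ¬ a l → M b l = 0 := by
    intro T M hM l b hl
    rw [← hM, he, Matrix.mul_diagonal, if_neg hl, mul_zero]
  refine exists_pairContraction_of_letters deg a D (idxFamily Ta Tb Th)
    (fun s => match s with
      | .coker => dTa
      -- The index ker is graded by the degree of γ, one below the degree of β recorded by `dTb`.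
      | .ker => fun b => dTb b - 1
      | .im => dTh) p q (x + y - y * D * x) ?_ ?_ ?_ ?_ ?_ ?_ ?_ ?_ ?_ ?_ ?_ ?_ ?_ ?_ ?_ ?_ ?_ ?_ ?_
  · have goal : D * pa = 0 := by
      rw [← pa1, ← Matrix.mul_assoc, DEa, Matrix.zero_mul]
    exact goal
  · have goal : D * pb = 0 := by
      rw [← pb1, ← Matrix.mul_assoc, ← Matrix.mul_assoc, Dth, Matrix.zero_mul, Matrix.zero_mul]
    exact goal
  · have goal : D * ((1 - y * D) * ph * pb) = pb := by
      rw [← Matrix.mul_assoc, ← Matrix.mul_assoc, Dy, key, pb1]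
    exact goal
  · have goal : D * ((1 - y * D) * pη) = 0 := by
      rw [← Matrix.mul_assoc, Dy, ← pwPh, ← Matrix.mul_assoc, m1, ← ph1, ← Matrix.mul_assoc, thEh,
        Matrix.zero_mul]
    exact goal
  · have goal : qa * (1 - D * x) * D = 0 := by
      rw [Matrix.mul_assoc, Dx, ← qaPu, Matrix.mul_assoc, m2, ← qa1, Matrix.mul_assoc, EaTh,
        Matrix.mul_zero]
    exact goal
  · have goal : qb * (1 - D * x) * D = qb * th := by
      rw [Matrix.mul_assoc, Dx]
      conv_lhs => rw [← qbPu, Matrix.mul_assoc, m2]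
    exact goal
  · have goal : qb * th * D = 0 := by
      rw [Matrix.mul_assoc, thD, Matrix.mul_zero]
    exact goal
  · have goal : qη * D = 0 := by
      rw [← qh1, Matrix.mul_assoc, EhD, Matrix.mul_zero]
    exact goal
  · rintro (_ | _ | _ | _)
    · exact (cx qa pa xpa).trans qpa
    · exact (cx qb pb xpb).trans qpb
    · have goal : qb * th * ((1 - y * D) * ph * pb) = 1 := by
        rw [← Matrix.mul_assoc, ← Matrix.mul_assoc, cy _ thye, Matrix.mul_assoc qb, qb1, qpb]
      exact goal
    · have goal : qη * ((1 - y * D) * pη) = 1 := by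
        rw [← Matrix.mul_assoc, cy _ qhy, qph]
      exact goal
  · rintro (_ | _ | _ | _) (_ | _ | _ | _) hne
    · exact absurd rfl hne
    · refine (cx qa pb xpb).trans ?_
      rw [← qa1, ← pb1, Matrix.mul_assoc, ← Matrix.mul_assoc Ea, ← Matrix.mul_assoc Ea, EaTh,
        Matrix.zero_mul, Matrix.zero_mul, Matrix.mul_zero]
      rfl
    · have goal : qa * (1 - D * x) * ((1 - y * D) * ph * pb) = 0 := by
        rw [← hwph]; simp only [← Matrix.mul_assoc]; rw [Zq qa qaPu, Matrix.zero_mul, Matrix.zero_mul]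
      exact goal
    · have goal : qa * (1 - D * x) * ((1 - y * D) * pη) = 0 := by
        rw [← pwPh]; simp only [← Matrix.mul_assoc]; rw [Zq qa qaPu, Matrix.zero_mul]
      exact goal
    · refine (cx qb pa xpa).trans ?_
      rw [← qb1, ← pa1, Matrix.mul_assoc, ← Matrix.mul_assoc (th * ph), Matrix.mul_assoc th, phEa,
        Matrix.mul_zero, Matrix.zero_mul, Matrix.mul_zero]
      rfl
    · exact absurd rfl hne
    · have goal : qb * (1 - D * x) * ((1 - y * D) * ph * pb) = 0 := by
        rw [← hwph]; simp only [← Matrix.mul_assoc]; rw [Zq qb qbPu, Matrix.zero_mul, Matrix.zero_mul]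
      exact goal
    · have goal : qb * (1 - D * x) * ((1 - y * D) * pη) = 0 := by
        rw [← pwPh]; simp only [← Matrix.mul_assoc]; rw [Zq qb qbPu, Matrix.zero_mul]
      exact goal
    · have goal : qb * th * pa = 0 := by
        rw [← the, Matrix.mul_assoc, Matrix.mul_assoc th, epa, Matrix.mul_zero, Matrix.mul_zero]
      exact goal
    · have goal : qb * th * pb = 0 := by
        rw [← the, Matrix.mul_assoc, Matrix.mul_assoc th, epb, Matrix.mul_zero, Matrix.mul_zero]
      exact goal
    · exact absurd rfl hne
    · have goal : qb * th * ((1 - y * D) * pη) = 0 := by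
        rw [← Matrix.mul_assoc, cy _ thye, ← ph1, Matrix.mul_assoc, ← Matrix.mul_assoc th, thEh,
          Matrix.zero_mul, Matrix.mul_zero]
      exact goal
    · have goal : qη * pa = 0 := by
        rw [← qhe, Matrix.mul_assoc, epa, Matrix.mul_zero]
      exact goal
    · have goal : qη * pb = 0 := by
        rw [← qhe, Matrix.mul_assoc, epb, Matrix.mul_zero]
      exact goal
    · have goal : qη * ((1 - y * D) * ph * pb) = 0 := by
        rw [← Matrix.mul_assoc, ← Matrix.mul_assoc, cy _ qhy, ← qh1, Matrix.mul_assoc qη, EhPh,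
          Matrix.mul_zero, Matrix.zero_mul]
      exact goal
    · exact absurd rfl hne
  · have goal : 1 - (pa * (qa * (1 - D * x)) + pb * (qb * (1 - D * x)) +
          (1 - y * D) * ph * pb * (qb * th) + (1 - y * D) * pη * qη) = D * (x + y - y * D * x) + (x + y - y * D * x) * D := by
      -- The α and β terms add up to `pu * (1 - D * x)`. The γ and η terms add up to `(1 - y * D) *
      -- pw`, as φθφθ = φθ.
      rw [← m3, ← Matrix.mul_assoc pa, ← Matrix.mul_assoc pb, pqa, pqb, Matrix.mul_assoc _ pη, pqh,
        Matrix.mul_assoc _ pb, ← Matrix.mul_assoc pb, pqb]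
      have : ph * (th * ph * th) = ph * th := by rw [hph]
      rw [Matrix.mul_assoc (1 - y * D), this, hEa', hEh']
      noncomm_ring
    exact goal
  · rintro (_ | _ | _ | _) l b hne
    · have := dpa l b hne
      change dTa b + 0 = _; omega
    · have := dpb l b hne
      change dTb b - 1 + 1 = _; omega
    · have := ((dy'.mul dph rfl).mul dpb rfl) l b hne
      change dTb b - 1 + 0 = _; omega
    · have := (dy'.mul dph' rfl) l b hne
      change dTh b + 0 = _; omega
  · rintro (_ | _ | _ | _) b l hne
    · have := (dqa.mul dx' rfl) b l hne
      change _ = dTa b + 0 + 0; omega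
    · have := (dqb.mul dx' rfl) b l hne
      change _ = dTb b - 1 + 1 + 0; omega
    · have := (dqb.mul dth rfl) b l hne
      change _ = dTb b - 1 + 0 + 0; omega
    · have := dqh' b l hne
      change _ = dTh b + 0 + 0; omega
  · exact (dx.add dy).sub ((dy.mul hD rfl).mul dx (by norm_num))
  · exact row pa epa
  · exact row pb epb
  · exact col (qb * th) (by rw [Matrix.mul_assoc, the])
  · exact col qη qhe
  · intro l l' hne hl
    by_contra hl'
    -- The homotopy respects the filtration because `e * y = 0` and `x * e = x`.
    have h1 : (e * (x + y - y * D * x) * (1 - e)) = 0 := by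
      linear_combination (norm := noncomm_ring) hy1' * (1 - e) - hy1' * D * x * (1 - e) - e * hx2
    have h2 := congrFun (congrFun h1 l) l'
    have h3 : (1 - e) = Matrix.diagonal fun l => if a l then (0 : R) else 1 := by
      rw [he, ← Matrix.diagonal_one, Matrix.diagonal_sub]
      congr 1; funext l; split_ifs <;> simp
    rw [h3, Matrix.mul_diagonal, if_neg hl', he, Matrix.diagonal_mul, if_pos hl, one_mul,
      mul_one] at h2
    exact hne h2

end

/-! ### Tensor products of matrices -/

section Kron

variable {R : Type u} [CommRing R] {m : ℕ} {L L' L'' : Fin m → Type} [∀ k, Fintype (L k)]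
  [∀ k, Fintype (L' k)] [∀ k, Fintype (L'' k)] [∀ k, DecidableEq (L k)] [∀ k, DecidableEq (L' k)]

/-- The tensor product of a family of matrices. -/
def kron (M : ∀ k, Matrix (L k) (L' k) R) : Matrix (∀ k, L k) (∀ k, L' k) R :=
  Matrix.of fun w w' => ∏ k, M k (w k) (w' k)

omit [∀ k, Fintype (L k)] [∀ k, Fintype (L' k)] [∀ k, DecidableEq (L k)]
  [∀ k, DecidableEq (L' k)] in
theorem kron_apply (M : ∀ k, Matrix (L k) (L' k) R) (w : ∀ k, L k) (w' : ∀ k, L' k) :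
    kron M w w' = ∏ k, M k (w k) (w' k) := rfl

theorem kron_mul (M : ∀ k, Matrix (L k) (L' k) R) (N : ∀ k, Matrix (L' k) (L'' k) R) :
    kron M * kron N = kron fun k => M k * N k := by
  ext w w'
  rw [kron_apply, Matrix.mul_apply]
  simp only [kron_apply, Matrix.mul_apply, ← Finset.prod_mul_distrib]
  rw [Finset.prod_univ_sum, Fintype.piFinset_univ]

theorem kron_one : kron (fun k => (1 : Matrix (L k) (L k) R)) = 1 := by
  ext w w'
  rw [kron_apply]
  by_cases h : w = w'
  · subst h; simp
  · rw [Matrix.one_apply_ne h]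
    obtain ⟨k, hk⟩ := Function.ne_iff.1 h
    exact Finset.prod_eq_zero (Finset.mem_univ k) (Matrix.one_apply_ne hk)

/-- Additivity of the tensor product in slot `k`. The three families are kept separate, with
agreement elsewhere as a hypothesis, so that products of `split3` families can be inserted. -/
theorem kron_add {A B C : ∀ k, Matrix (L k) (L' k) R} (k : Fin m) (hA : ∀ j, j ≠ k → A j = C j)
    (hB : ∀ j, j ≠ k → B j = C j) (h : A k + B k = C k) : kron A + kron B = kron C := by
  ext w w'
  have e : ∀ M : ∀ k, Matrix (L k) (L' k) R, (∀ j, j ≠ k → M j = C j) →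
      kron M w w' = M k (w k) (w' k) * ∏ j ∈ Finset.univ.erase k, C j (w j) (w' j) := by
    intro M hM
    rw [kron_apply, ← Finset.mul_prod_erase _ _ (Finset.mem_univ k)]
    congr 1
    exact Finset.prod_congr rfl fun j hj => by rw [hM j (Finset.ne_of_mem_erase hj)]
  rw [Matrix.add_apply, e A hA, e B hB, e C fun _ _ => rfl, ← add_mul, ← h]
  rfl

theorem kron_eq_zero {A : ∀ k, Matrix (L k) (L' k) R} (k : Fin m) (h : A k = 0) : kron A = 0 := by
  ext w w'
  rw [kron_apply]
  exact Finset.prod_eq_zero (Finset.mem_univ k) (by rw [h]; rfl)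

theorem kron_add_eq_zero {A B : ∀ k, Matrix (L k) (L' k) R} (k : Fin m)
    (hA : ∀ j, j ≠ k → A j = B j) (h : A k = - B k) : kron A + kron B = 0 := by
  have h0 : kron (Function.update B k 0) = 0 := kron_eq_zero k (Function.update_self _ _ _)
  rw [← h0]
  refine kron_add k (fun j hj => ?_) (fun j hj => ?_) ?_
  · rw [Function.update_of_ne hj, hA j hj]
  · rw [Function.update_of_ne hj]
  · rw [Function.update_self, h, neg_add_cancel]

/-- The family that is `A` to the left of `k`, `B` at `k` and `C` to the right of `k`. -/
def split3 {X : Fin m → Type*} (A B C : ∀ j, X j) (k : Fin m) : ∀ j, X j := fun j =>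
  if j < k then A j else if j = k then B j else C j

theorem prod_split3 (a b c : Fin m → R) (k : Fin m) :
    ∏ j, split3 a b c k j = b k * (∏ j with j < k, a j) * ∏ j with k < j, c j := by
  have e1 : (Finset.univ : Finset (Fin m)) =
      ({j | j < k} : Finset (Fin m)) ∪ ({k} ∪ ({j | k < j} : Finset (Fin m))) := by
    ext j
    simp only [Finset.mem_univ, Finset.mem_union, Finset.mem_filter, Finset.mem_singleton, true_and,
      true_iff]
    exact lt_trichotomy j k
  conv_lhs => rw [e1]
  rw [Finset.prod_union, Finset.prod_union, Finset.prod_singleton]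
  · have h1 : ∏ j with j < k, split3 a b c k j = ∏ j with j < k, a j :=
      Finset.prod_congr rfl fun j hj => if_pos (Finset.mem_filter.1 hj).2
    have h2 : ∏ j with k < j, split3 a b c k j = ∏ j with k < j, c j :=
      Finset.prod_congr rfl fun j hj => by
        have := (Finset.mem_filter.1 hj).2
        rw [split3, if_neg this.asymm, if_neg this.ne']
    have h3 : split3 a b c k k = b k := by simp [split3]
    rw [h1, h2, h3]; ring
  · rw [Finset.disjoint_left]; simp
  · rw [Finset.disjoint_left]
    intro j hj
    have := (Finset.mem_filter.1 hj).2
    simp [this.ne, this.le]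

/-- A telescoping sum: the identity factors are replaced by p one place at a time, from the left.
The homotopy of the tensor product copies its shape. -/
theorem one_sub_kron (p : ∀ k, Matrix (L k) (L k) R) :
    1 - kron p = ∑ k, kron (split3 p (fun j => 1 - p j) (fun _ => 1) k) := by
  ext w w'
  have h := Finset.prod_sub_ordered Finset.univ (fun k => (1 : Matrix (L k) (L k) R) (w k) (w' k))
    (fun k => (1 - p k) (w k) (w' k))
  simp only [Matrix.sub_apply, sub_sub_cancel] at h
  rw [Matrix.sub_apply, Matrix.sum_apply, ← kron_one, kron_apply, kron_apply, h, sub_sub_cancel]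
  refine Finset.sum_congr rfl fun k _ => ?_
  refine (prod_split3 (fun j => p j (w j) (w' j)) (fun j => (1 - p j) (w j) (w' j))
    (fun j => (1 : Matrix (L j) (L j) R) (w j) (w' j)) k).symm.trans ?_
  refine Finset.prod_congr rfl fun j _ => ?_
  unfold split3
  split_ifs <;> rfl

theorem kron_split3_mul (A B C : ∀ k, Matrix (L k) (L' k) R)
    (A' B' C' : ∀ k, Matrix (L' k) (L'' k) R) (k : Fin m) :
    kron (split3 A B C k) * kron (split3 A' B' C' k) =
      kron (split3 (fun j => A j * A' j) (fun j => B j * B' j) (fun j => C j * C' j) k) := by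
  rw [kron_mul]
  congr 1
  funext j
  unfold split3
  split_ifs <;> rfl

/-- The sign `(-1)^n` in a ring. -/
def sign (R : Type u) [CommRing R] (n : ℤ) : R := ((n.negOnePow : ℤ) : R)

theorem sign_mul_self (n : ℤ) : sign R n * sign R n = 1 := by
  rw [sign, ← Int.cast_mul, ← Units.val_mul, Int.units_mul_self]; simp

theorem sign_add (a b : ℤ) : sign R (a + b) = sign R a * sign R b := by
  rw [sign, Int.negOnePow_add, Units.val_mul, Int.cast_mul]; rfl

theorem sign_one : sign R 1 = -1 := by simp [sign]

theorem sign_neg_one : sign R (-1) = -1 := by simp [sign]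

theorem sign_zero : sign R 0 = 1 := by simp [sign]

/-- The diagonal matrix of the signs of the degrees. -/
def signMat (R : Type u) [CommRing R] {I : Type} [DecidableEq I] (d : I → ℤ) : Matrix I I R :=
  Matrix.diagonal fun i => sign R (d i)

section

variable {I J : Type} [Fintype I] [Fintype J] [DecidableEq I] [DecidableEq J] {d : I → ℤ}
  {d' : J → ℤ} {M : Matrix I J R}

theorem IsHomog.signMat_mul {n : ℤ} (h : IsHomog d d' n M) :
    signMat R d * M = sign R n • (M * signMat R d') := by
  ext i j
  rw [signMat, signMat, Matrix.diagonal_mul, Matrix.smul_apply, Matrix.mul_diagonal, smul_eq_mul]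
  by_cases hz : M i j = 0
  · rw [hz]; ring
  · rw [h i j hz, sign_add]
    linear_combination (-sign R (d i) * M i j) * sign_mul_self (R := R) n

theorem signMat_mul_self (d : I → ℤ) : signMat R d * signMat R d = 1 := by
  rw [signMat, Matrix.diagonal_mul_diagonal]
  simp [sign_mul_self]

end

/-- The differential of a tensor product of complexes. -/
def wordMat (d : ∀ k, L k → ℤ) (D : ∀ k, Matrix (L k) (L k) R) :
    Matrix (∀ k, L k) (∀ k, L k) R :=
  ∑ k, kron (split3 (fun j => signMat R (d j)) D (fun _ => 1) k)

/-- The homotopy has PQ to the left of the place `k`, `h` at `k` and the identity to the right, with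
Koszul signs. In Dh + hD the terms with D and h at the same place give the telescoping sum for 1 -
PQ, and the other terms cancel in pairs. -/
theorem isRetraction_wordMat {d : ∀ k, L k → ℤ} {d' : ∀ k, L' k → ℤ}
    {D : ∀ k, Matrix (L k) (L k) R} {E : ∀ k, Matrix (L' k) (L' k) R}
    {P : ∀ k, Matrix (L k) (L' k) R} {Q : ∀ k, Matrix (L' k) (L k) R}
    {h : ∀ k, Matrix (L k) (L k) R} (H : ∀ k, IsRetraction (D k) (E k) (P k) (Q k) (h k))
    (hD : ∀ k, IsHomog (d k) (d k) (-1) (D k)) (hP : ∀ k, IsHomog (d k) (d' k) 0 (P k))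
    (hQ : ∀ k, IsHomog (d' k) (d k) 0 (Q k)) (hh : ∀ k, IsHomog (d k) (d k) 1 (h k)) :
    IsRetraction (wordMat d D) (wordMat d' E) (kron P) (kron Q)
      (∑ k, kron (split3 (fun j => signMat R (d j) * (P j * Q j)) h (fun _ => 1) k)) where
  comm := by
    rw [wordMat, wordMat, Matrix.sum_mul, Matrix.mul_sum]
    refine Finset.sum_congr rfl fun k _ => ?_
    rw [kron_mul, kron_mul]
    congr 1
    funext j
    unfold split3
    split_ifs
    · rw [(hP j).signMat_mul, sign_zero, one_smul]
    · exact (H j).comm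
    · rw [Matrix.one_mul, Matrix.mul_one]
  comm' := by
    rw [wordMat, wordMat, Matrix.sum_mul, Matrix.mul_sum]
    refine Finset.sum_congr rfl fun k _ => ?_
    rw [kron_mul, kron_mul]
    congr 1
    funext j
    unfold split3
    split_ifs
    · rw [(hQ j).signMat_mul, sign_zero, one_smul]
    · exact (H j).comm'
    · rw [Matrix.one_mul, Matrix.mul_one]
  retract := by
    rw [kron_mul, ← kron_one]
    congr 1
    funext j
    exact (H j).retract
  homotopy := by
    set s : ∀ j, Matrix (L j) (L j) R := fun j => signMat R (d j) with hs
    set p : ∀ j, Matrix (L j) (L j) R := fun j => P j * Q j with hp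
    have ss : ∀ j, s j * s j = 1 := fun j => signMat_mul_self (d j)
    have sD : ∀ j, s j * D j = - (D j * s j) := by
      intro j; rw [hs, (hD j).signMat_mul, sign_neg_one, neg_one_smul]
    have sh : ∀ j, s j * h j = - (h j * s j) := by
      intro j; rw [hs, (hh j).signMat_mul, sign_one, neg_one_smul]
    have sp : ∀ j, s j * p j = p j * s j := by
      intro j; rw [hs, hp, ((hP j).mul (hQ j) rfl).signMat_mul, add_zero, sign_zero, one_smul]
    have pD : ∀ j, p j * D j = D j * p j := by
      intro j
      rw [hp, Matrix.mul_assoc, ← (H j).comm', ← Matrix.mul_assoc, ← (H j).comm, Matrix.mul_assoc]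
    rw [kron_mul, one_sub_kron, wordMat, Finset.sum_mul_sum, Finset.sum_mul_sum, Finset.sum_comm,
      ← Finset.sum_add_distrib]
    refine Finset.sum_congr rfl fun k _ => ?_
    rw [← Finset.sum_add_distrib, Fintype.sum_eq_single k]
    · rw [kron_split3_mul, kron_split3_mul]
      symm
      refine kron_add k (fun j hj => ?_) (fun j hj => ?_) ?_
      · simp only [split3, if_neg hj]
        split_ifs
        · change s j * (s j * p j) = p j
          rw [← Matrix.mul_assoc, ss, Matrix.one_mul]
        · exact Matrix.one_mul _
      · simp only [split3, if_neg hj]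
        split_ifs
        · change s j * p j * s j = p j
          rw [sp, Matrix.mul_assoc, ss, Matrix.mul_one]
        · exact Matrix.one_mul _
      · simp only [split3, lt_irrefl, if_false, if_true]
        exact (H k).homotopy.symm
    · intro i hik
      rw [kron_mul, kron_mul]
      have com : ∀ j, s j * (s j * p j) = s j * p j * s j := fun j => by
        rw [Matrix.mul_assoc, ← sp]
      rcases lt_or_gt_of_ne hik with hlt | hlt
      -- The differential acts to the left of the homotopy. It commutes with PQ and anticommutes
      -- with the sign matrix there, so the two orders cancel at place `i`.
      · refine kron_add_eq_zero i (fun j hj => ?_) ?_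
        · rcases lt_or_gt_of_ne hj with h1 | h1
          · simpa [split3, h1, h1.trans hlt] using com j
          · simp [split3, h1.asymm, h1.ne']
        · have : D i * (s i * p i) = -(s i * p i * D i) := by
            rw [Matrix.mul_assoc (s i), pD, ← Matrix.mul_assoc (D i), ← Matrix.mul_assoc (s i), sD,
              Matrix.neg_mul, neg_neg]
          simpa [split3, hlt] using this
      -- The differential acts to the right of the homotopy, so its sign matrix meets `h` at place
      -- `k`, where the two anticommute.
      · refine kron_add_eq_zero k (fun j hj => ?_) ?_
        · rcases lt_or_gt_of_ne hj with h1 | h1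
          · simpa [split3, h1, h1.trans hlt] using com j
          · simp [split3, h1.asymm, h1.ne']
        · simpa [split3, hlt] using sh k

omit [∀ k, Fintype (L k)] [∀ k, Fintype (L' k)] [∀ k, DecidableEq (L k)]
  [∀ k, DecidableEq (L' k)] in
theorem isHomog_kron {d : ∀ k, L k → ℤ} {d' : ∀ k, L' k → ℤ} {M : ∀ k, Matrix (L k) (L' k) R}
    (h : ∀ k, IsHomog (d k) (d' k) 0 (M k)) :
    IsHomog (fun w => ∑ k, d k (w k)) (fun w => ∑ k, d' k (w k)) 0 (kron M) := by
  intro w w' hne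
  rw [add_zero]
  refine Finset.sum_congr rfl fun k _ => ?_
  have := h k _ _ (fun h0 => hne (Finset.prod_eq_zero (Finset.mem_univ k) h0))
  omega

end Kron

/-! ### Restriction to subsets of the bases -/

section Restrict

variable {R : Type u} [CommRing R]

/-- No path from the range of `f` leaves the range of `g`, so restricting the sum over the middle
index loses no term. -/
theorem submatrix_mul_of_closed {I J K I₀ J₀ K₀ : Type} [Fintype J] [Fintype J₀]
    (M : Matrix I J R) (N : Matrix J K R) (f : I₀ → I) (g : J₀ → J) (k : K₀ → K)
    (hg : Function.Injective g) (h : ∀ i j, M (f i) j ≠ 0 → j ∈ Set.range g) :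
    (M * N).submatrix f k = M.submatrix f g * N.submatrix g k := by
  ext i l
  rw [Matrix.submatrix_apply, Matrix.mul_apply, Matrix.mul_apply]
  symm
  refine Fintype.sum_of_injective g hg _ _ (fun j hj => ?_) fun j => rfl
  have : M (f i) j = 0 := by
    by_contra hne; exact hj (h i j hne)
  rw [this, zero_mul]

theorem IsRetraction.submatrix {I J I₀ J₀ : Type} [Fintype I] [Fintype J] [Fintype I₀]
    [Fintype J₀] [DecidableEq I] [DecidableEq J] [DecidableEq I₀] [DecidableEq J₀]
    {D : Matrix I I R} {E : Matrix J J R} {P : Matrix I J R} {Q : Matrix J I R} {h : Matrix I I R}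
    (H : IsRetraction D E P Q h) (f : I₀ → I) (g : J₀ → J) (hf : Function.Injective f)
    (hg : Function.Injective g) (cD : ∀ i i', D (f i) i' ≠ 0 → i' ∈ Set.range f)
    (cE : ∀ j j', E (g j) j' ≠ 0 → j' ∈ Set.range g)
    (cP : ∀ i j, P (f i) j ≠ 0 → j ∈ Set.range g)
    (cQ : ∀ j i, Q (g j) i ≠ 0 → i ∈ Set.range f)
    (ch : ∀ i i', h (f i) i' ≠ 0 → i' ∈ Set.range f) :
    IsRetraction (D.submatrix f f) (E.submatrix g g) (P.submatrix f g) (Q.submatrix g f)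
      (h.submatrix f f) where
  comm := by
    rw [← submatrix_mul_of_closed _ _ _ _ _ hf cD, ← submatrix_mul_of_closed _ _ _ _ _ hg cP,
      H.comm]
  comm' := by
    rw [← submatrix_mul_of_closed _ _ _ _ _ hg cE, ← submatrix_mul_of_closed _ _ _ _ _ hf cQ,
      H.comm']
  retract := by
    rw [← submatrix_mul_of_closed _ _ _ _ _ hf cQ, H.retract, Matrix.submatrix_one _ hg]
  homotopy := by
    rw [← submatrix_mul_of_closed _ _ _ _ _ hg cP, ← submatrix_mul_of_closed _ _ _ _ _ hf cD,
      ← submatrix_mul_of_closed _ _ _ _ _ hf ch, ← Matrix.submatrix_one f hf]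
    exact congrArg (fun M => M.submatrix f f) H.homotopy

variable {m : ℕ} {L L' : Fin m → Type}

/-- The words whose set of letters outside `a` is contained in a simplex of `K`. -/
def wordSet (K : SComplex (Fin m)) (a : ∀ k, L k → Prop) : Set (∀ k, L k) :=
  {w | ∃ τ ∈ K, ∀ k, ¬ a k (w k) → k ∈ τ}

/-- The set of places with letters outside the subcomplex can only shrink, so the same simplex of
`K` serves as a witness. -/
theorem wordSet_of_imp {K : SComplex (Fin m)} {a : ∀ k, L k → Prop} {a' : ∀ k, L' k → Prop}
    {w : ∀ k, L k} {w' : ∀ k, L' k} (h : ∀ k, a k (w k) → a' k (w' k)) (hw : w ∈ wordSet K a) :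
    w' ∈ wordSet K a' := by
  obtain ⟨τ, hτ, hw⟩ := hw
  exact ⟨τ, hτ, fun k hk => hw k fun h' => hk (h k h')⟩

theorem imp_of_kron_ne_zero {a : ∀ k, L k → Prop} {a' : ∀ k, L' k → Prop}
    {M : ∀ k, Matrix (L k) (L' k) R} (h : ∀ k l l', M k l l' ≠ 0 → a k l → a' k l')
    {w : ∀ k, L k} {w' : ∀ k, L' k} (hne : kron M w w' ≠ 0) (k : Fin m) (hw : a k (w k)) :
    a' k (w' k) :=
  h k _ _ (fun h0 => hne (Finset.prod_eq_zero (Finset.mem_univ k) h0)) hw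

variable [∀ k, DecidableEq (L k)]

theorem imp_of_sum_kron_split3_ne_zero {a : ∀ k, L k → Prop} {A B : ∀ k, Matrix (L k) (L k) R}
    (hA : ∀ k l l', A k l l' ≠ 0 → a k l → a k l') (hB : ∀ k l l', B k l l' ≠ 0 → a k l → a k l')
    {w w' : ∀ k, L k} (hne : (∑ i, kron (split3 A B (fun _ => 1) i)) w w' ≠ 0) (k : Fin m)
    (hw : a k (w k)) : a k (w' k) := by
  rw [Matrix.sum_apply] at hne
  obtain ⟨i, -, hi⟩ := Finset.exists_ne_zero_of_sum_ne_zero hne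
  refine imp_of_kron_ne_zero (a := a) (a' := a) (fun j l l' h => ?_) hi k hw
  unfold split3 at h
  split_ifs at h
  · exact hA j l l' h
  · exact hB j l l' h
  · intro hl
    have : l = l' := by
      by_contra hne'; exact h (Matrix.one_apply_ne hne')
    exact this ▸ hl

theorem imp_of_signMat_ne_zero {I : Type} [DecidableEq I] {d : I → ℤ} {a : I → Prop} (l l' : I)
    (h : signMat R d l l' ≠ 0) (hl : a l) : a l' := by
  have : l = l' := by
    by_contra hne'; exact h (Matrix.diagonal_apply_ne _ hne')
  exact this ▸ hl

theorem exists_mul_ne_zero {I J K : Type} [Fintype J] {M : Matrix I J R} {N : Matrix J K R} {i : I}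
    {k : K} (h : (M * N) i k ≠ 0) : ∃ j, M i j ≠ 0 ∧ N j k ≠ 0 := by
  obtain ⟨j, -, hj⟩ := Finset.exists_ne_zero_of_sum_ne_zero h
  exact ⟨j, left_ne_zero_of_mul hj, right_ne_zero_of_mul hj⟩

/-- The tensor product of the complexes of the pairs, restricted by `K`, can be computed from
the minimal models of the pairs. -/
theorem PairContraction.nonempty_matH_equiv [∀ k, Fintype (L k)] {d : ∀ k, L k → ℤ}
    {a : ∀ k, L k → Prop} {D : ∀ k, Matrix (L k) (L k) R} (C : ∀ k, PairContraction (d k) (a k) (D k))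
    (hD : ∀ k, IsHomog (d k) (d k) (-1) (D k)) (ha : ∀ k l l', D k l l' ≠ 0 → a k l → a k l')
    (K : SComplex (Fin m)) {I J : Type} [Fintype I] [Fintype J]
    (f : I → ∀ k, L k) (g : J → ∀ k, Good (C k).B) (hf : Function.Injective f)
    (hg : Function.Injective g) (rf : Set.range f = wordSet K a)
    (rg : Set.range g = wordSet K fun k => Good.inSub (B := (C k).B)) (N : ℤ) :
    Nonempty (MatH ((wordMat d D).submatrix f f) (fun i => ∑ k, d k (f i k) = N) ≃ₗ[R]
      MatH ((wordMat (fun k => Good.deg (C k).dB) (fun k => Good.mat R (C k).B)).submatrix g g)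
        (fun j => ∑ k, Good.deg (C k).dB (g j k) = N)) ∧
    Nonempty (MatH ((wordMat d D).submatrix f f).transpose (fun i => ∑ k, d k (f i k) = N) ≃ₗ[R]
      MatH ((wordMat (fun k => Good.deg (C k).dB)
        (fun k => Good.mat R (C k).B)).submatrix g g).transpose
        (fun j => ∑ k, Good.deg (C k).dB (g j k) = N)) := by
  classical
  have H := isRetraction_wordMat (fun k => (C k).isRetraction) hD (fun k => (C k).homP)
    (fun k => (C k).homQ) (fun k => (C k).homh)
  have memf : ∀ i, f i ∈ wordSet K a := fun i => rf ▸ Set.mem_range_self i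
  have memg : ∀ j, g j ∈ wordSet K fun k => Good.inSub (B := (C k).B) :=
    fun j => rg ▸ Set.mem_range_self j
  -- All five matrices send letters of the subcomplex to letters of the subcomplex, place by place.
  -- So the words allowed by `K` are closed under each of them.
  have H' := H.submatrix f g hf hg
    (fun i i' hne => by
      rw [rf]
      exact wordSet_of_imp (imp_of_sum_kron_split3_ne_zero (fun k => imp_of_signMat_ne_zero) ha hne)
        (memf i))
    (fun j j' hne => by
      rw [rg]
      exact wordSet_of_imp (imp_of_sum_kron_split3_ne_zero (fun k => imp_of_signMat_ne_zero)
        (fun k g g' h _ => Good.inSub_of_mat_ne_zero g g' h) hne) (memg j))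
    (fun i j hne => by
      rw [rg]
      exact wordSet_of_imp (imp_of_kron_ne_zero (fun k => (C k).filtP) hne) (memf i))
    (fun j i hne => by
      rw [rf]
      exact wordSet_of_imp (imp_of_kron_ne_zero (fun k => (C k).filtQ) hne) (memg j))
    (fun i i' hne => by
      rw [rf]
      refine wordSet_of_imp (imp_of_sum_kron_split3_ne_zero (fun k l l' h => ?_)
        (fun k => (C k).filth) hne) (memf i)
      obtain ⟨l₁, h1, h2⟩ := exists_mul_ne_zero h
      obtain ⟨l₂, h3, h4⟩ := exists_mul_ne_zero h2
      exact fun hl => (C k).filtQ _ _ h4 ((C k).filtP _ _ h3 (imp_of_signMat_ne_zero _ _ h1 hl)))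
  have dP := isHomog_kron (fun k => (C k).homP)
  have dQ := isHomog_kron (fun k => (C k).homQ)
  have hP : ∀ i j, (kron fun k => (C k).P) (f i) (g j) ≠ 0 →
      (∑ k, d k (f i k) = N ↔ ∑ k, Good.deg (C k).dB (g j k) = N) := by
    intro i j hne
    have := dP _ _ hne
    simp only [add_zero] at this
    rw [this]
  have hQ : ∀ j i, (kron fun k => (C k).Q) (g j) (f i) ≠ 0 →
      (∑ k, d k (f i k) = N ↔ ∑ k, Good.deg (C k).dB (g j k) = N) := by
    intro i j hne
    have := dQ _ _ hne
    simp only [add_zero] at this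
    rw [this]
  exact ⟨⟨LinearEquiv.ofBijective _ (H'.map_bijective (fun i j h => (hP i j h).1)
      (fun j i h => (hQ j i h).2))⟩,
    ⟨LinearEquiv.ofBijective _ (H'.transpose.map_bijective (fun i j h => (hQ j i h).1)
      (fun j i h => (hP i j h).2))⟩⟩

end Restrict


/-! ### Subcomplexes spanned by basis elements -/

section Component

variable {R : Type u} [CommRing R] {I L : Type}

/-- The component of degree `j` of a row vector. -/
def degComp (d : L → ℤ) (j : ℤ) (c : L → R) : L → R := fun l => if d l = j then c l else 0

theorem degComp_of_ne {d : L → ℤ} {j : ℤ} (c : L → R) {l : L} (h : ¬ d l = j) :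
    degComp d j c l = 0 := if_neg h

theorem degComp_of_eq {d : L → ℤ} {j : ℤ} (c : L → R) {l : L} (h : d l = j) :
    degComp d j c l = c l := if_pos h

theorem degComp_sub (d : L → ℤ) (j : ℤ) (c c' : L → R) :
    degComp d j (c - c') = degComp d j c - degComp d j c' := by
  funext l
  by_cases h : d l = j <;> simp [degComp, h]

theorem degComp_smul (d : L → ℤ) (j : ℤ) (r : R) (c : L → R) :
    degComp d j (r • c) = r • degComp d j c := by
  funext l
  by_cases h : d l = j <;> simp [degComp, h]

theorem degComp_zero (d : L → ℤ) (j : ℤ) : degComp d j (0 : L → R) = 0 := by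
  funext l
  by_cases h : d l = j <;> simp [degComp, h]

theorem degComp_mem (d : L → ℤ) (j : ℤ) {a : L → Prop} {c : L → R} (hc : c ∈ suppOn R a) :
    degComp d j c ∈ suppOn R a := by
  intro l hl
  by_cases h : d l = j
  · rw [degComp_of_eq c h, hc l hl]
  · exact degComp_of_ne c h

theorem sum_degComp [Fintype L] (d : L → ℤ) (c : L → R) :
    ∑ j ∈ Finset.univ.image d, degComp d j c = c := by
  funext l
  rw [Finset.sum_apply]
  unfold degComp
  rw [Finset.sum_ite_eq, if_pos (Finset.mem_image_of_mem d (Finset.mem_univ l))]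

/-- Torsion-freeness of homology is known degree by degree, while a pair contraction is built from
ungraded vectors. Splitting into components bridges the two. -/
theorem degComp_vecMul [Fintype I] {d : I → ℤ} {d' : L → ℤ} {n : ℤ} {M : Matrix I L R}
    (hM : IsHomog d d' n M) {j k : ℤ} (hk : j + n = k) (c : I → R) :
    degComp d' k (Matrix.vecMul c M) = Matrix.vecMul (degComp d j c) M := by
  funext l
  by_cases hl : d' l = k
  · rw [degComp_of_eq _ hl]
    refine Finset.sum_congr rfl fun i _ => ?_
    by_cases hi : d i = j
    · rw [degComp_of_eq c hi]
    · have : M i l = 0 := by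
        by_contra h
        have := hM i l h
        omega
      change c i * M i l = degComp d j c i * M i l
      rw [this, mul_zero, mul_zero]
  · rw [degComp_of_ne _ hl]
    symm
    refine Finset.sum_eq_zero fun i _ => ?_
    by_cases hi : d i = j
    · have : M i l = 0 := by
        by_contra h
        have := hM i l h
        omega
      change degComp d j c i * M i l = 0
      rw [this, mul_zero]
    · rw [degComp_of_ne c hi, zero_mul]

end Component

/-! ### Torsion conditions for the inclusion of a subcomplex -/

section Inclusion

variable {R : Type u} [CommRing R] {I L : Type} [Fintype I] [Fintype L]

open Classical in
/-- The matrix of the inclusion of a subset of the basis. -/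
noncomputable def inclMat (R : Type u) [CommRing R] (f : I → L) : Matrix I L R :=
  Matrix.of fun i l => if f i = l then 1 else 0

theorem eq_of_inclMat_ne_zero {f : I → L} {i : I} {l : L} (h : inclMat R f i l ≠ 0) : f i = l := by
  by_contra hne
  exact h (if_neg hne)

theorem inclMat_mul {J : Type} (f : I → L) (M : Matrix L J R) (i : I) (j : J) :
    (inclMat R f * M) i j = M (f i) j := by
  classical
  simp [Matrix.mul_apply, inclMat]

theorem vecMul_inclMat_apply {f : I → L} (hf : Function.Injective f) (c : I → R) (i : I) :
    Matrix.vecMul c (inclMat R f) (f i) = c i := by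
  classical
  simp [Matrix.vecMul, dotProduct, inclMat, hf.eq_iff]

theorem vecMul_inclMat_mem (f : I → L) (c : I → R) :
    Matrix.vecMul c (inclMat R f) ∈ suppOn R (fun l => l ∈ Set.range f) := by
  intro l hl
  refine Finset.sum_eq_zero fun i _ => ?_
  have : inclMat R f i l = 0 := if_neg fun h => hl ⟨i, h⟩
  change c i * inclMat R f i l = 0
  rw [this, mul_zero]

theorem vecMul_comp_inclMat {f : I → L} (hf : Function.Injective f) {c : L → R}
    (hc : c ∈ suppOn R (fun l => l ∈ Set.range f)) : Matrix.vecMul (c ∘ f) (inclMat R f) = c := by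
  funext l
  by_cases hl : l ∈ Set.range f
  · obtain ⟨i, rfl⟩ := hl
    exact vecMul_inclMat_apply hf _ i
  · rw [vecMul_inclMat_mem f _ l hl, hc l hl]

theorem vecMul_transpose_inclMat (f : I → L) (c : L → R) :
    Matrix.vecMul c (inclMat R f).transpose = c ∘ f := by
  classical
  funext i
  simp [Matrix.vecMul, dotProduct, inclMat]

theorem submatrix_mul_inclMat {f : I → L} (hf : Function.Injective f) {D : Matrix L L R}
    (cD : ∀ i l, D (f i) l ≠ 0 → l ∈ Set.range f) :
    D.submatrix f f * inclMat R f = inclMat R f * D := by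
  ext i l
  rw [inclMat_mul]
  exact congrFun (vecMul_comp_inclMat (c := D (f i)) hf
    fun l hl => by by_contra h; exact hl (cD i l h)) l

theorem vecMul_comp_submatrix {f : I → L} (hf : Function.Injective f) (D : Matrix L L R)
    {c : L → R} (hc : c ∈ suppOn R (fun l => l ∈ Set.range f)) :
    Matrix.vecMul (c ∘ f) (D.submatrix f f) = Matrix.vecMul c D ∘ f := by
  funext i
  refine Fintype.sum_of_injective f hf _ _ (fun l hl => ?_) fun j => rfl
  rw [hc l hl, zero_mul]

/-- The kernel, the image and the cokernel of a linear map are torsion-free. -/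
structure TorsionFreeMap {M N : Type*} [AddCommGroup M] [AddCommGroup N] [Module R M] [Module R N]
    (f : M →ₗ[R] N) : Prop where
  ker : ∀ (r : R) x, r ≠ 0 → f x = 0 → r • x = 0 → x = 0
  range : ∀ (r : R) x, r ≠ 0 → r • f x = 0 → f x = 0
  coker : ∀ (r : R) z, r ≠ 0 → r • z ∈ LinearMap.range f → z ∈ LinearMap.range f

omit [Fintype I] [Fintype L] in
theorem TorsionFreeMap.of_equiv {M N M' N' : Type*} [AddCommGroup M] [AddCommGroup N] [Module R M]
    [Module R N] [AddCommGroup M'] [AddCommGroup N'] [Module R M'] [Module R N'] {f : M →ₗ[R] N}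
    {f' : M' →ₗ[R] N'} (h : TorsionFreeMap f) (e : M ≃ₗ[R] M') (e' : N ≃ₗ[R] N')
    (he : ∀ x, e' (f x) = f' (e x)) : TorsionFreeMap f' := by
  refine ⟨fun r x hr h1 h2 => ?_, fun r x hr h1 => ?_, fun r z hr h1 => ?_⟩
  · obtain ⟨x, rfl⟩ := e.surjective x
    rw [← he, e'.map_eq_zero_iff] at h1
    rw [← map_smul, e.map_eq_zero_iff] at h2
    rw [h.ker r x hr h1 h2, map_zero]
  · obtain ⟨x, rfl⟩ := e.surjective x
    rw [← he, ← map_smul, e'.map_eq_zero_iff] at h1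
    rw [← he, h.range r x hr h1, map_zero]
  · obtain ⟨z, rfl⟩ := e'.surjective z
    obtain ⟨y, hy⟩ := h1
    obtain ⟨x, rfl⟩ := e.surjective y
    rw [← he, ← map_smul] at hy
    obtain ⟨y, rfl⟩ := h.coker r z hr ⟨x, e'.injective hy⟩
    exact ⟨e y, (he y).symm⟩

omit [Fintype I] [Fintype L] in
theorem TorsionFreeMap.of_free [IsDomain R] {M N : Type*} [AddCommGroup M]
    [AddCommGroup N] [Module R M] [Module R N] {f : M →ₗ[R] N}
    (h1 : Module.Free R (LinearMap.ker f))
    (h2 : Module.Free R (N ⧸ LinearMap.range f))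
    (h3 : Module.Free R (LinearMap.range f)) : TorsionFreeMap f := by
  refine ⟨fun r x hr hx h => ?_, fun r x hr h => ?_, fun r z hr h => ?_⟩
  · have : r • (⟨x, hx⟩ : LinearMap.ker f) = 0 := Subtype.ext h
    exact congrArg Subtype.val ((smul_eq_zero_iff_right hr).1 this)
  · have : r • (⟨f x, x, rfl⟩ : LinearMap.range f) = 0 := Subtype.ext h
    exact congrArg Subtype.val ((smul_eq_zero_iff_right hr).1 this)
  · rw [← Submodule.Quotient.mk_eq_zero, Submodule.Quotient.mk_smul, smul_eq_zero_iff_right hr,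
      Submodule.Quotient.mk_eq_zero] at h
    exact h

variable [IsDomain R] {d : L → ℤ} {f : I → L} (hf : Function.Injective f) {D : Matrix L L R}
  (cD : ∀ i l, D (f i) l ≠ 0 → l ∈ Set.range f)
  (H : ∀ q : ℤ, TorsionFreeMap (MatH.map (D := D.submatrix f f) (E := D)
    (p := fun i => d (f i) = q) (q := fun l => d l = q) (inclMat R f)
    (fun _ _ h hi => eq_of_inclMat_ne_zero h ▸ hi) (submatrix_mul_inclMat hf cD)))
include H

-- The class of c in the ambient homology lies in the range of the induced map and is killed by r,
-- hence is zero.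
omit [IsDomain R] in
theorem exists_vecMul_of_smul {r : R} (hr : r ≠ 0) {q : ℤ} {c : L → R}
    (hc : c ∈ suppOn R (fun l => l ∈ Set.range f)) (hq : ∀ l, ¬ d l = q → c l = 0)
    (h0 : Matrix.vecMul c D = 0) (h : ∃ y, Matrix.vecMul y D = r • c) :
    ∃ y, Matrix.vecMul y D = c := by
  have hm : c ∘ f ∈ cyc (D.submatrix f f) (fun i => d (f i) = q) :=
    ⟨fun i hi => hq _ hi, (vecMul_comp_submatrix hf D hc).trans (by rw [h0]; rfl)⟩
  have := (H q).range r (Submodule.Quotient.mk ⟨_, hm⟩) hr (by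
    rw [MatH.map_mk, ← Submodule.Quotient.mk_smul, Submodule.Quotient.mk_eq_zero, mem_bdry]
    obtain ⟨y, hy⟩ := h
    refine ⟨y, hy.trans ?_⟩
    change r • c = r • Matrix.vecMul (c ∘ f) (inclMat R f)
    rw [vecMul_comp_inclMat hf hc])
  rw [MatH.map_mk, Submodule.Quotient.mk_eq_zero, mem_bdry] at this
  obtain ⟨y, hy⟩ := this
  exact ⟨y, hy.trans (vecMul_comp_inclMat hf hc)⟩

-- The homology of the subcomplex is torsion-free: a torsion class dies in the ambient homology, as
-- the range is torsion-free, so it lies in the kernel, which is torsion-free too.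
omit [IsDomain R] in
theorem exists_mem_vecMul_of_smul {r : R} (hr : r ≠ 0) {q : ℤ} {c : L → R}
    (hc : c ∈ suppOn R (fun l => l ∈ Set.range f)) (hq : ∀ l, ¬ d l = q → c l = 0)
    (h0 : Matrix.vecMul c D = 0)
    (h : ∃ y ∈ suppOn R (fun l => l ∈ Set.range f), Matrix.vecMul y D = r • c) :
    ∃ y ∈ suppOn R (fun l => l ∈ Set.range f), Matrix.vecMul y D = c := by
  have hm : c ∘ f ∈ cyc (D.submatrix f f) (fun i => d (f i) = q) :=
    ⟨fun i hi => hq _ hi, (vecMul_comp_submatrix hf D hc).trans (by rw [h0]; rfl)⟩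
  have h1 : ∃ y, Matrix.vecMul y D = c :=
    exists_vecMul_of_smul hf cD H hr hc hq h0 (h.imp fun y hy => hy.2)
  have := (H q).ker r (Submodule.Quotient.mk ⟨_, hm⟩) hr (by
    rw [MatH.map_mk, Submodule.Quotient.mk_eq_zero, mem_bdry]
    obtain ⟨y, hy⟩ := h1
    exact ⟨y, hy.trans (vecMul_comp_inclMat hf hc).symm⟩) (by
    rw [← Submodule.Quotient.mk_smul, Submodule.Quotient.mk_eq_zero, mem_bdry]
    obtain ⟨y, hy1, hy⟩ := h
    refine ⟨y ∘ f, (vecMul_comp_submatrix hf D hy1).trans ?_⟩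
    rw [hy]; rfl)
  rw [Submodule.Quotient.mk_eq_zero, mem_bdry] at this
  obtain ⟨y, hy⟩ := this
  refine ⟨Matrix.vecMul y (inclMat R f), vecMul_inclMat_mem f y, ?_⟩
  rw [Matrix.vecMul_vecMul, ← submatrix_mul_inclMat hf cD, ← Matrix.vecMul_vecMul, hy]
  exact vecMul_comp_inclMat hf hc

-- Modulo the range of the induced map, r times the class of u vanishes. As the cokernel is
-- torsion-free, u is homologous to a cycle of the subcomplex.
omit [IsDomain R] in
theorem exists_sub_mem_of_smul {r : R} (hr : r ≠ 0) {q : ℤ} {u v : L → R}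
    (hu : ∀ l, ¬ d l = q → u l = 0) (hu0 : Matrix.vecMul u D = 0)
    (hv : v ∈ suppOn R (fun l => l ∈ Set.range f)) (hq : ∀ l, ¬ d l = q → v l = 0)
    (h0 : Matrix.vecMul v D = 0) (h : ∃ y, Matrix.vecMul y D = r • u - v) :
    ∃ y, u - Matrix.vecMul y D ∈ suppOn R (fun l => l ∈ Set.range f) := by
  have hm : v ∘ f ∈ cyc (D.submatrix f f) (fun i => d (f i) = q) :=
    ⟨fun i hi => hq _ hi, (vecMul_comp_submatrix hf D hv).trans (by rw [h0]; rfl)⟩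
  have := (H q).coker r (Submodule.Quotient.mk ⟨u, hu, hu0⟩) hr ⟨Submodule.Quotient.mk ⟨_, hm⟩, by
    rw [MatH.map_mk, ← Submodule.Quotient.mk_smul, eq_comm, ← sub_eq_zero,
      ← Submodule.Quotient.mk_sub, Submodule.Quotient.mk_eq_zero, mem_bdry]
    obtain ⟨y, hy⟩ := h
    refine ⟨y, hy.trans ?_⟩
    change r • u - v = r • u - Matrix.vecMul (v ∘ f) (inclMat R f)
    rw [vecMul_comp_inclMat hf hv]⟩
  obtain ⟨x, hx⟩ := this
  obtain ⟨c, rfl⟩ := Submodule.Quotient.mk_surjective _ x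
  rw [MatH.map_mk, eq_comm, ← sub_eq_zero, ← Submodule.Quotient.mk_sub,
    Submodule.Quotient.mk_eq_zero, mem_bdry] at hx
  obtain ⟨y, hy⟩ := hx
  refine ⟨y, ?_⟩
  have : u - Matrix.vecMul y D = Matrix.vecMul c.1 (inclMat R f) := by
    rw [hy]
    exact sub_sub_cancel _ _
  rw [this]
  exact vecMul_inclMat_mem f _

/-- Cancelling r shows that w is a cycle of the subcomplex. Torsion-freeness of its homology is then
applied to each component. -/
theorem exists_mem_vecMul_of_smul_vecMul (hD : IsHomog d d (-1) D) (hDD : D * D = 0) (r : R)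
    (w : L → R) (hr : r ≠ 0)
    (h : ∃ y ∈ suppOn R (fun l => l ∈ Set.range f), Matrix.vecMul y D = r • w) :
    ∃ y ∈ suppOn R (fun l => l ∈ Set.range f), Matrix.vecMul y D = w := by
  classical
  obtain ⟨y, hy, e⟩ := h
  have hrw : r • w ∈ suppOn R (fun l => l ∈ Set.range f) := by
    rw [← e]
    intro l hl
    refine Finset.sum_eq_zero fun l' _ => ?_
    by_cases h1 : l' ∈ Set.range f
    · obtain ⟨i, rfl⟩ := h1
      have : D (f i) l = 0 := by
        by_contra h2; exact hl (cD i l h2)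
      change y (f i) * D (f i) l = 0
      rw [this, mul_zero]
    · rw [hy l' h1, zero_mul]
  have hw : w ∈ suppOn R (fun l => l ∈ Set.range f) := fun l hl =>
    (mul_eq_zero.1 (hrw l hl)).resolve_left hr
  have hw0 : Matrix.vecMul w D = 0 := by
    have : r • Matrix.vecMul w D = 0 := by
      rw [← Matrix.smul_vecMul, ← e, Matrix.vecMul_vecMul, hDD, Matrix.vecMul_zero]
    exact (smul_eq_zero.1 this).resolve_left hr
  have key : ∀ j, ∃ y ∈ suppOn R (fun l => l ∈ Set.range f), Matrix.vecMul y D = degComp d j w := by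
    intro j
    refine exists_mem_vecMul_of_smul hf cD H hr (degComp_mem d j hw)
      (fun l hl => degComp_of_ne w hl) ?_ ⟨degComp d (j + 1) y, degComp_mem d _ hy, ?_⟩
    · rw [← degComp_vecMul hD rfl, hw0, degComp_zero]
    · rw [← degComp_vecMul hD (add_neg_cancel_right j 1), e, degComp_smul]
  choose z hz1 hz2 using key
  refine ⟨∑ j ∈ Finset.univ.image d, z j, Submodule.sum_mem _ fun j _ => hz1 j, ?_⟩
  rw [Matrix.sum_vecMul, ← sum_degComp d w]
  exact Finset.sum_congr rfl fun j _ => hz2 j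

/-- This is torsion-freeness of the relative homology. The boundary of w becomes, after
multiplication by r, a boundary within the subcomplex, so it equals that of some y' there. Then w -
y' is a cycle whose r-fold multiple is homologous to a cycle of the subcomplex, and the cokernel
condition applies. -/
theorem exists_sub_vecMul_mem_of_smul (hD : IsHomog d d (-1) D) (hDD : D * D = 0) (r : R)
    (w : L → R) (hr : r ≠ 0)
    (h : ∃ y, r • w - Matrix.vecMul y D ∈ suppOn R (fun l => l ∈ Set.range f)) :
    ∃ y, w - Matrix.vecMul y D ∈ suppOn R (fun l => l ∈ Set.range f) := by
  classical
  obtain ⟨y, hz⟩ := h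
  obtain ⟨y', hy', e'⟩ := exists_mem_vecMul_of_smul_vecMul hf cD H hD hDD r (Matrix.vecMul w D) hr
    ⟨_, hz, by rw [Matrix.sub_vecMul, Matrix.vecMul_vecMul y, hDD, Matrix.vecMul_zero, sub_zero,
      Matrix.smul_vecMul]⟩
  have hu0 : Matrix.vecMul (w - y') D = 0 := by rw [Matrix.sub_vecMul, e', sub_self]
  have hv : r • w - Matrix.vecMul y D - r • y' ∈ suppOn R (fun l => l ∈ Set.range f) :=
    Submodule.sub_mem _ hz (Submodule.smul_mem _ _ hy')
  have hv0 : Matrix.vecMul (r • w - Matrix.vecMul y D - r • y') D = 0 := by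
    rw [Matrix.sub_vecMul, Matrix.sub_vecMul, Matrix.vecMul_vecMul y, hDD, Matrix.vecMul_zero,
      sub_zero, Matrix.smul_vecMul, Matrix.smul_vecMul, e', sub_self]
  have key : ∀ j, ∃ y, degComp d j (w - y') - Matrix.vecMul y D ∈
      suppOn R (fun l => l ∈ Set.range f) := by
    intro j
    refine exists_sub_mem_of_smul hf cD H hr (fun l hl => degComp_of_ne _ hl) ?_
      (degComp_mem d j hv) (fun l hl => degComp_of_ne _ hl) ?_ ⟨degComp d (j + 1) y, ?_⟩
    · rw [← degComp_vecMul hD rfl, hu0, degComp_zero]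
    · rw [← degComp_vecMul hD rfl, hv0, degComp_zero]
    · rw [← degComp_vecMul hD (add_neg_cancel_right j 1), ← degComp_smul, ← degComp_sub]
      congr 1
      rw [smul_sub]
      abel
  choose z hz2 using key
  refine ⟨∑ j ∈ Finset.univ.image d, z j, ?_⟩
  have : w - Matrix.vecMul (∑ j ∈ Finset.univ.image d, z j) D =
      y' + ∑ j ∈ Finset.univ.image d, (degComp d j (w - y') - Matrix.vecMul (z j) D) := by
    rw [Finset.sum_sub_distrib, sum_degComp, Matrix.sum_vecMul]
    abel
  rw [this]
  exact Submodule.add_mem _ hy' (Submodule.sum_mem _ fun j _ => hz2 j)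

omit [IsDomain R] in
theorem exists_vecMul_of_smul_of_mem (hD : IsHomog d d (-1) D) (r : R)
    (w : L → R) (hr : r ≠ 0) (hw : w ∈ suppOn R (fun l => l ∈ Set.range f))
    (hw0 : Matrix.vecMul w D = 0) (h : ∃ y, Matrix.vecMul y D = r • w) :
    ∃ y, Matrix.vecMul y D = w := by
  classical
  obtain ⟨y, e⟩ := h
  have key : ∀ j, ∃ y, Matrix.vecMul y D = degComp d j w := by
    intro j
    refine exists_vecMul_of_smul hf cD H hr (degComp_mem d j hw)
      (fun l hl => degComp_of_ne w hl) ?_ ⟨degComp d (j + 1) y, ?_⟩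
    · rw [← degComp_vecMul hD rfl, hw0, degComp_zero]
    · rw [← degComp_vecMul hD (add_neg_cancel_right j 1), e, degComp_smul]
  choose z hz2 using key
  refine ⟨∑ j ∈ Finset.univ.image d, z j, ?_⟩
  rw [Matrix.sum_vecMul, ← sum_degComp d w]
  exact Finset.sum_congr rfl fun j _ => hz2 j

end Inclusion


/-! ### The homology of a pair in terms of its minimal model -/

section Split

variable {R : Type u} [CommRing R]

/-- The map `f` is, for suitable bases of its source and target, the direct sum of an isomorphism of
modules with the basis `I` and of zero maps, the kernel having the basis `K` and the cokernel having
the basis `C`. -/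
def SplitsAs {M N : Type*} [AddCommGroup M] [AddCommGroup N] [Module R M] [Module R N]
    (f : M →ₗ[R] N) (K C I : Type) : Prop :=
  ∃ (e : M ≃ₗ[R] (K ⊕ I → R)) (e' : N ≃ₗ[R] (C ⊕ I → R)), ∀ x,
    (∀ y, e' (f x) (Sum.inl y) = 0) ∧ ∀ y, e' (f x) (Sum.inr y) = e x (Sum.inr y)

namespace SplitsAs

variable {M N : Type*} [AddCommGroup M] [AddCommGroup N] [Module R M] [Module R N]
  {f : M →ₗ[R] N} {K C I : Type}

theorem of_equiv {M' N' : Type*} [AddCommGroup M'] [AddCommGroup N'] [Module R M'] [Module R N']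
    {f' : M' →ₗ[R] N'} (h : SplitsAs f' K C I) (e : M ≃ₗ[R] M') (e' : N ≃ₗ[R] N')
    (he : ∀ x, e' (f x) = f' (e x)) : SplitsAs f K C I := by
  obtain ⟨g, g', hg⟩ := h
  refine ⟨e.trans g, e'.trans g', fun x => ?_⟩
  rw [LinearEquiv.trans_apply, LinearEquiv.trans_apply, he]
  exact hg (e x)

theorem nonempty_source (h : SplitsAs f K C I) : Nonempty (M ≃ₗ[R] (K → R) × (I → R)) := by
  obtain ⟨e, -, -⟩ := h
  exact ⟨e.trans (LinearEquiv.sumArrowLequivProdArrow K I R R)⟩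

theorem nonempty_range (h : SplitsAs f K C I) : Nonempty (LinearMap.range f ≃ₗ[R] (I → R)) := by
  obtain ⟨e, e', h⟩ := h
  let g : M →ₗ[R] (I → R) := LinearMap.funLeft R R Sum.inr ∘ₗ e.toLinearMap
  have hg : Function.Surjective g := fun y => by
    refine ⟨e.symm (Sum.elim 0 y), ?_⟩
    funext i
    change e (e.symm _) (Sum.inr i) = y i
    rw [LinearEquiv.apply_symm_apply]; rfl
  have hker : LinearMap.ker f = LinearMap.ker g := by
    ext x
    rw [LinearMap.mem_ker, LinearMap.mem_ker]
    constructor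
    · intro hx
      funext i
      change e x (Sum.inr i) = 0
      rw [← (h x).2, hx, map_zero]; rfl
    · intro hx
      rw [← e'.map_eq_zero_iff]
      funext i
      obtain i | i := i
      · exact (h x).1 i
      · rw [(h x).2]; exact congrFun hx i
  exact ⟨f.quotKerEquivRange.symm.trans ((Submodule.quotEquivOfEq _ _ hker).trans
    (g.quotKerEquivOfSurjective hg))⟩

theorem nonempty_coker (h : SplitsAs f K C I) :
    Nonempty ((N ⧸ LinearMap.range f) ≃ₗ[R] (C → R)) := by
  obtain ⟨e, e', h⟩ := h
  let g : N →ₗ[R] (C → R) := LinearMap.funLeft R R Sum.inl ∘ₗ e'.toLinearMap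
  have hg : Function.Surjective g := fun y => by
    refine ⟨e'.symm (Sum.elim y 0), ?_⟩
    funext i
    change e' (e'.symm _) (Sum.inl i) = y i
    rw [LinearEquiv.apply_symm_apply]; rfl
  have hker : LinearMap.range f = LinearMap.ker g := by
    ext z
    rw [LinearMap.mem_ker, LinearMap.mem_range]
    constructor
    · rintro ⟨x, rfl⟩
      funext i
      exact (h x).1 i
    · intro hz
      refine ⟨e.symm (Sum.elim 0 fun i => e' z (Sum.inr i)), e'.injective ?_⟩
      funext i
      obtain i | i := i
      · rw [(h _).1]; exact (congrFun hz i).symm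
      · rw [(h _).2, LinearEquiv.apply_symm_apply]; rfl
  exact ⟨(Submodule.quotEquivOfEq _ _ hker).trans (g.quotKerEquivOfSurjective hg)⟩

theorem nonempty_ker (h : SplitsAs f K C I) : Nonempty (LinearMap.ker f ≃ₗ[R] (K → R)) := by
  obtain ⟨e, e', h⟩ := h
  let g : M →ₗ[R] (K → R) := LinearMap.funLeft R R Sum.inl ∘ₗ e.toLinearMap
  refine ⟨LinearEquiv.ofBijective (g ∘ₗ (LinearMap.ker f).subtype) ⟨?_, ?_⟩⟩
  · rw [← LinearMap.ker_eq_bot, LinearMap.ker_eq_bot']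
    rintro ⟨x, hx⟩ h0
    apply Subtype.ext
    change x = 0
    rw [← e.map_eq_zero_iff]
    funext i
    obtain i | i := i
    · exact congrFun h0 i
    · rw [← (h x).2, LinearMap.mem_ker.1 hx, map_zero]; rfl
  · intro y
    refine ⟨⟨e.symm (Sum.elim y 0), ?_⟩, ?_⟩
    · rw [LinearMap.mem_ker, ← e'.map_eq_zero_iff]
      funext i
      obtain i | i := i
      · exact (h _).1 i
      · rw [(h _).2, LinearEquiv.apply_symm_apply]; rfl
    · funext i
      change e (e.symm _) (Sum.inl i) = y i
      rw [LinearEquiv.apply_symm_apply]; rfl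

end SplitsAs

end Split

/-! ### Bases of homology detected on a retract -/

section Retract

variable {R : Type u} [CommRing R] {I J Y : Type} [Fintype I] [Fintype J]

theorem IsRetraction.exists_matH_equiv_fun [DecidableEq I] [DecidableEq J] {D : Matrix I I R}
    {E : Matrix J J R} {P : Matrix I J R} {Q : Matrix J I R} {h : Matrix I I R}
    (H : IsRetraction D E P Q h) {p : I → Prop} {q : J → Prop} (hP : ∀ i j, P i j ≠ 0 → p i → q j)
    (hQ : ∀ j i, Q j i ≠ 0 → q j → p i) (T : J → Prop)
    (h1 : ∀ y l, T l → Matrix.vecMul y E l = 0)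
    (h2 : ∀ c, Matrix.vecMul c E = 0 → (∀ l, T l → c l = 0) → ∃ y, Matrix.vecMul y E = c)
    (h3 : ∀ l l', T l → E l l' = 0) (φ : Y → J) (hφ : Function.Injective φ)
    (hφ' : ∀ j, j ∈ Set.range φ ↔ T j ∧ q j) :
    ∃ e : MatH D p ≃ₗ[R] (Y → R), ∀ (c : cyc D p) y,
      e (Submodule.Quotient.mk c) y = Matrix.vecMul c.1 P (φ y) := by
  obtain ⟨e, he⟩ := PolyJoin.exists_matH_equiv_fun (D := E) T q h1 h2 h3
  let ψ : Y ≃ {l // T l ∧ q l} :=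
    (Equiv.ofInjective φ hφ).trans (Equiv.subtypeEquivRight hφ')
  refine ⟨((LinearEquiv.ofBijective _ (H.map_bijective hP hQ)).trans e).trans
    (LinearEquiv.funCongrLeft R R ψ), fun c y => ?_⟩
  exact he ⟨Matrix.vecMul c.1 P, vecMul_mem_cyc P hP H.comm c.1 c.2⟩ (ψ y)

end Retract

section Good

variable {R : Type u} [CommRing R] {B : Idx → Type}

theorem Good.deg_of_ne (dB : ∀ s, B s → ℤ) {g : Good B} (h : g.1 ≠ .β) :
    Good.deg dB g = dB _ g.2 := by
  unfold Good.deg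
  rw [if_neg h, add_zero]

/-- The basis elements that represent the homology of the ambient complex. -/
def Good.isTop (g : Good B) : Prop := g.1 = .α ∨ g.1 = .η

variable [∀ s, Fintype (B s)] [∀ s, DecidableEq (B s)]

/-- A cycle has zero β entries. If its α and η entries vanish too, it is supported on γ, and moving
its γ entries to β yields a preimage. -/
theorem Good.exists_vecMul_mat (c : Good B → R) (h : Matrix.vecMul c (Good.mat R B) = 0)
    (hc : ∀ g, Good.isTop g → c g = 0) : ∃ y, Matrix.vecMul y (Good.mat R B) = c := by
  refine ⟨fun g => letterElim (M := fun s => B s → R) (fun _ => 0) (fun b => c ⟨.γ, b⟩)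
    (fun _ => 0) (fun _ => 0) g.1 g.2, ?_⟩
  funext ⟨x, b⟩
  cases x with
  | α => exact (Good.vecMul_mat_of_ne _ _ (fun h => by cases h)).trans (hc _ (Or.inl rfl)).symm
  | β =>
    exact (Good.vecMul_mat_of_ne _ _ (fun h => by cases h)).trans
      ((congrFun h ⟨.γ, b⟩).symm.trans (Good.vecMul_mat_gamma c b))
  | γ => exact Good.vecMul_mat_gamma _ b
  | η => exact (Good.vecMul_mat_of_ne _ _ (fun h => by cases h)).trans (hc _ (Or.inr rfl)).symm

theorem Good.exists_mat_mulVec (c : Good B → R) (h : Matrix.mulVec (Good.mat R B) c = 0)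
    (hc : ∀ g, Good.isTop g → c g = 0) : ∃ y, Matrix.mulVec (Good.mat R B) y = c := by
  refine ⟨fun g => letterElim (M := fun s => B s → R) (fun _ => 0) (fun _ => 0)
    (fun b => c ⟨.β, b⟩) (fun _ => 0) g.1 g.2, ?_⟩
  funext ⟨x, b⟩
  cases x with
  | α => exact (Good.mat_mulVec_of_ne _ _ (fun h => by cases h)).trans (hc _ (Or.inl rfl)).symm
  | β => exact Good.mat_mulVec_beta _ b
  | γ =>
    exact (Good.mat_mulVec_of_ne _ _ (fun h => by cases h)).trans
      ((congrFun h ⟨.β, b⟩).symm.trans (Good.mat_mulVec_beta c b))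
  | η => exact (Good.mat_mulVec_of_ne _ _ (fun h => by cases h)).trans (hc _ (Or.inr rfl)).symm

end Good

namespace PairContraction

variable {R : Type u} [CommRing R] {I L : Type} [Fintype I] [DecidableEq I] [Fintype L]
  [DecidableEq L] {d : L → ℤ} {D : Matrix L L R}

/-- The basis elements of index `s` and degree `b`. -/
abbrev Part {a : L → Prop} (C : PairContraction d a D) (s : Idx) (b : ℤ) : Type :=
  {x : C.B s // C.dB s x = b}

/-- The basis elements that represent the homology of the ambient complex in degree `b`. -/
def topEmb {a : L → Prop} (C : PairContraction d a D) (b : ℤ) :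
    C.Part .coker b ⊕ C.Part .im b → Good C.B
  | .inl x => ⟨.α, x.1⟩
  | .inr x => ⟨.η, x.1⟩

/-- The basis elements that represent the homology of the subcomplex in degree `b`. -/
def subEmb {a : L → Prop} (C : PairContraction d a D) (b : ℤ) :
    C.Part .ker b ⊕ C.Part .im b → {g : Good C.B // g.inSub}
  | .inl x => ⟨⟨.γ, x.1⟩, Or.inl rfl⟩
  | .inr x => ⟨⟨.η, x.1⟩, Or.inr rfl⟩

theorem topEmb_injective {a : L → Prop} (C : PairContraction d a D) (b : ℤ) :
    Function.Injective (C.topEmb b) := by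
  rintro (x | x) (y | y) h
  · exact congrArg _ (Subtype.ext (eq_of_heq (Sigma.mk.inj h).2))
  · exact absurd (congrArg Sigma.fst h) (fun h => by cases h)
  · exact absurd (congrArg Sigma.fst h) (fun h => by cases h)
  · exact congrArg _ (Subtype.ext (eq_of_heq (Sigma.mk.inj h).2))

theorem subEmb_injective {a : L → Prop} (C : PairContraction d a D) (b : ℤ) :
    Function.Injective (C.subEmb b) := by
  rintro (x | x) (y | y) h
  · exact congrArg _ (Subtype.ext (eq_of_heq (Sigma.mk.inj (congrArg Subtype.val h)).2))
  · exact absurd (congrArg (fun g => g.1.1) h) (fun h => by cases h)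
  · exact absurd (congrArg (fun g => g.1.1) h) (fun h => by cases h)
  · exact congrArg _ (Subtype.ext (eq_of_heq (Sigma.mk.inj (congrArg Subtype.val h)).2))

theorem mem_range_topEmb {a : L → Prop} (C : PairContraction d a D) (b : ℤ) (g : Good C.B) :
    g ∈ Set.range (C.topEmb b) ↔ g.isTop ∧ Good.deg C.dB g = b := by
  constructor
  · rintro ⟨x | x, rfl⟩
    · exact ⟨Or.inl rfl, (Good.deg_of_ne _ (fun h => by cases h)).trans x.2⟩
    · exact ⟨Or.inr rfl, (Good.deg_of_ne _ (fun h => by cases h)).trans x.2⟩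
  · obtain ⟨l, x⟩ := g
    rintro ⟨h | h, hb⟩
    · cases h
      exact ⟨.inl ⟨x, (Good.deg_of_ne _ (fun h => by cases h)).symm.trans hb⟩, rfl⟩
    · cases h
      exact ⟨.inr ⟨x, (Good.deg_of_ne _ (fun h => by cases h)).symm.trans hb⟩, rfl⟩

theorem mem_range_subEmb {a : L → Prop} (C : PairContraction d a D) (b : ℤ)
    (g : {g : Good C.B // g.inSub}) :
    g ∈ Set.range (C.subEmb b) ↔ True ∧ Good.deg C.dB g.1 = b := by
  constructor
  · rintro ⟨x | x, rfl⟩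
    · exact ⟨trivial, (Good.deg_of_ne _ (fun h => by cases h)).trans x.2⟩
    · exact ⟨trivial, (Good.deg_of_ne _ (fun h => by cases h)).trans x.2⟩
  · obtain ⟨⟨l, x⟩, h | h⟩ := g
    · cases h
      rintro ⟨-, hb⟩
      exact ⟨.inl ⟨x, (Good.deg_of_ne _ (fun h => by cases h)).symm.trans hb⟩, rfl⟩
    · cases h
      rintro ⟨-, hb⟩
      exact ⟨.inr ⟨x, (Good.deg_of_ne _ (fun h => by cases h)).symm.trans hb⟩, rfl⟩

variable {f : I → L} (C : PairContraction d (fun l => l ∈ Set.range f) D)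

-- Neither γ nor η has a boundary, so the subcomplex contracts onto a complex with zero
-- differential.
open Classical in
theorem isRetraction_sub (hf : Function.Injective f)
    (cD : ∀ i l, D (f i) l ≠ 0 → l ∈ Set.range f) :
    IsRetraction (D.submatrix f f) (0 : Matrix {g : Good C.B // g.inSub} {g : Good C.B // g.inSub} R)
      (C.P.submatrix f Subtype.val) (C.Q.submatrix Subtype.val f) (C.h.submatrix f f) := by
  have := C.isRetraction.submatrix f (Subtype.val : {g : Good C.B // g.inSub} → Good C.B) hf
    Subtype.val_injective cD
    (fun j j' h => ⟨⟨j', Good.inSub_of_mat_ne_zero _ _ h⟩, rfl⟩)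
    (fun i j h => ⟨⟨j, C.filtP _ _ h ⟨i, rfl⟩⟩, rfl⟩)
    (fun j i h => C.filtQ _ _ h j.2)
    (fun i i' h => C.filth _ _ h ⟨i, rfl⟩)
  convert this using 1
  ext ⟨g, hg⟩ ⟨g', hg'⟩
  refine (Good.mat_of_ne g g' ?_).symm
  rintro h
  rcases hg with hg | hg <;> exact absurd (h.symm.trans hg) (fun h => by cases h)

theorem degP {b : ℤ} (l : L) (g : Good C.B) (h : C.P l g ≠ 0) : d l = b ↔ Good.deg C.dB g = b := by
  rw [C.homP l g h, add_zero]

theorem degQ {b : ℤ} (g : Good C.B) (l : L) (h : C.Q g l ≠ 0) : Good.deg C.dB g = b ↔ d l = b := by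
  rw [C.homQ g l h, add_zero]

/-- The homology of the subcomplex has the basis γ, η and that of the whole complex the basis α, η.
Chains of the subcomplex have no α coordinate by `filtP`, and the η coordinate is computed by the
same columns of `P` on both sides. -/
theorem splitsAs_map (hf : Function.Injective f)
    (cD : ∀ i l, D (f i) l ≠ 0 → l ∈ Set.range f) (b : ℤ)
    (hP : ∀ i l, inclMat R f i l ≠ 0 → d (f i) = b → d l = b)
    (hc : D.submatrix f f * inclMat R f = inclMat R f * D) :
    SplitsAs (MatH.map (D := D.submatrix f f) (E := D) (p := fun i => d (f i) = b)
      (q := fun l => d l = b) (inclMat R f) hP hc)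
      (C.Part .ker b) (C.Part .coker b) (C.Part .im b) := by
  classical
  obtain ⟨e, he⟩ := (C.isRetraction_sub hf cD).exists_matH_equiv_fun (p := fun i => d (f i) = b)
    (q := fun g => Good.deg C.dB g.1 = b) (fun i g h => (C.degP _ _ h).1)
    (fun g i h => (C.degQ _ _ h).1) (fun _ => True) (fun y l _ => by simp)
    (fun c _ h => ⟨0, by funext l; rw [h l trivial]; simp⟩) (fun _ _ _ => rfl)
    (C.subEmb b) (C.subEmb_injective b) (C.mem_range_subEmb b)
  obtain ⟨e', he'⟩ := C.isRetraction.exists_matH_equiv_fun (p := fun l => d l = b)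
    (q := fun g => Good.deg C.dB g = b) (fun i g h => (C.degP _ _ h).1)
    (fun g i h => (C.degQ _ _ h).1) Good.isTop
    (fun y g h => Good.vecMul_mat_of_ne y g fun h' => by
      rcases h with h | h <;> exact absurd (h.symm.trans h') (fun h => by cases h))
    Good.exists_vecMul_mat
    (fun g g' h => Good.mat_of_ne g g' fun h' => by
      rcases h with h | h <;> exact absurd (h.symm.trans h') (fun h => by cases h))
    (C.topEmb b) (C.topEmb_injective b) (C.mem_range_topEmb b)
  refine ⟨e, e', fun x => ?_⟩
  obtain ⟨c, rfl⟩ := Submodule.Quotient.mk_surjective _ x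
  have key : ∀ g, Matrix.vecMul (Matrix.vecMul c.1 (inclMat R f)) C.P g =
      ∑ i, c.1 i * C.P (f i) g := by
    intro g
    rw [Matrix.vecMul_vecMul]
    exact Finset.sum_congr rfl fun i _ => congrArg _ (inclMat_mul f C.P i g)
  refine ⟨fun y => ?_, fun y => ?_⟩
  · rw [MatH.map_mk, he']
    refine (key _).trans (Finset.sum_eq_zero fun i _ => ?_)
    have : C.P (f i) (C.topEmb b (Sum.inl y)) = 0 := by
      by_contra h
      rcases C.filtP _ _ h ⟨i, rfl⟩ with h | h <;> cases h
    rw [this, mul_zero]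
  · rw [MatH.map_mk, he', he]
    exact key _

/-- Restriction to the subcomplex kills the classes dual to α and identifies those dual to η. The
classes dual to γ are not reached, so kernel and cokernel swap roles. -/
theorem splitsAs_transpose_map (hf : Function.Injective f)
    (cD : ∀ i l, D (f i) l ≠ 0 → l ∈ Set.range f) (b : ℤ)
    (hP : ∀ l i, (inclMat R f).transpose l i ≠ 0 → d l = b → d (f i) = b)
    (hc : D.transpose * (inclMat R f).transpose =
      (inclMat R f).transpose * (D.submatrix f f).transpose) :
    SplitsAs (MatH.map (D := D.transpose) (E := (D.submatrix f f).transpose)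
      (p := fun l => d l = b) (q := fun i => d (f i) = b) (inclMat R f).transpose hP hc)
      (C.Part .coker b) (C.Part .ker b) (C.Part .im b) := by
  classical
  obtain ⟨e, he⟩ := (C.isRetraction_sub hf cD).transpose.exists_matH_equiv_fun
    (p := fun i => d (f i) = b)
    (q := fun g => Good.deg C.dB g.1 = b) (fun i g h => (C.degQ _ _ h).2)
    (fun g i h => (C.degP _ _ h).2) (fun _ => True) (fun y l _ => by simp)
    (fun c _ h => ⟨0, by funext l; rw [h l trivial]; simp⟩) (fun _ _ _ => rfl)
    (C.subEmb b) (C.subEmb_injective b) (C.mem_range_subEmb b)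
  obtain ⟨e', he'⟩ := C.isRetraction.transpose.exists_matH_equiv_fun (p := fun l => d l = b)
    (q := fun g => Good.deg C.dB g = b) (fun i g h => (C.degQ _ _ h).2)
    (fun g i h => (C.degP _ _ h).2) Good.isTop
    (fun y g h => by
      rw [Matrix.vecMul_transpose]
      exact Good.mat_mulVec_of_ne y g fun h' => by
        rcases h with h | h <;> exact absurd (h.symm.trans h') (fun h => by cases h))
    (fun c h hc => by
      simp only [Matrix.vecMul_transpose] at h ⊢
      exact Good.exists_mat_mulVec c h hc)
    (fun g g' h => Good.mat_of_ne' g' g fun h' => by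
      rcases h with h | h <;> exact absurd (h.symm.trans h') (fun h => by cases h))
    (C.topEmb b) (C.topEmb_injective b) (C.mem_range_topEmb b)
  refine ⟨e', e, fun x => ?_⟩
  obtain ⟨c, rfl⟩ := Submodule.Quotient.mk_surjective _ x
  have key : ∀ g, Good.inSub g → ∑ i, c.1 (f i) * C.Q g (f i) =
      Matrix.vecMul c.1 C.Q.transpose g := by
    intro g hg
    refine Fintype.sum_of_injective f hf _ _ (fun l hl => ?_) fun j => rfl
    have : C.Q g l = 0 := by
      by_contra h
      exact hl (C.filtQ _ _ h hg)
    exact (congrArg _ this).trans (mul_zero _)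
  have key2 : ∀ g : {g : Good C.B // g.inSub},
      Matrix.vecMul (Matrix.vecMul c.1 (inclMat R f).transpose)
        (C.Q.submatrix Subtype.val f).transpose g = Matrix.vecMul c.1 C.Q.transpose g.1 := by
    intro g
    rw [vecMul_transpose_inclMat]
    exact key _ g.2
  refine ⟨fun y => ?_, fun y => ?_⟩
  · rw [MatH.map_mk, he]
    refine (key2 _).trans ?_
    change Matrix.vecMul c.1 C.Q.transpose ⟨.γ, y.1⟩ = 0
    -- Evaluated at β, the cocycle condition says that the coordinate at γ is zero.
    have h0 : Matrix.mulVec (Good.mat R C.B) (Matrix.vecMul c.1 C.Q.transpose) = 0 := by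
      rw [← Matrix.vecMul_transpose, Matrix.vecMul_vecMul, ← C.isRetraction.transpose.comm,
        ← Matrix.vecMul_vecMul, (mem_cyc.1 c.2).2, Matrix.zero_vecMul]
    exact (Good.mat_mulVec_beta _ y.1).symm.trans (congrFun h0 _)
  · rw [MatH.map_mk, he', he]
    exact key2 _

end PairContraction


/-! ### The contraction of a pair of simplicial complexes -/

namespace FaceSystem

section Mat

variable {V : Type} [LinearOrder V] (R : Type u) [CommRing R] {F G : FaceSystem V}

theorem isHomog_mat : IsHomog (fun g => ((F.verts g).card : ℤ)) (fun g => ((F.verts g).card : ℤ)) (-1)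
    (F.mat R) := fun _ _ h => F.card_of_mat_ne_zero R h

/-- Each row is the double boundary of one generator, taken in the degree of that generator, where
`d_comp_d` applies. -/
theorem mat_mul_mat [Fintype F.Gen] : F.mat R * F.mat R = 0 := by
  classical
  ext g g'
  have h0 : ∀ p q r : ℤ, q + 1 = p → r + 1 = q → ∀ x : F.GenDeg 0 p →₀ R,
      Matrix.vecMul (F.finsuppEquiv R 0 p x).1 (F.mat R * F.mat R) = 0 := by
    intro p q r h1 h2 x
    rw [← Matrix.vecMul_vecMul, ← F.finsuppEquiv_d R 0 p q h1, ← F.finsuppEquiv_d R 0 q r h2]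
    have := LinearMap.congr_fun (F.d_comp_d R 0 p q r) x
    rw [LinearMap.comp_apply] at this
    rw [this, LinearMap.zero_apply, map_zero]
    rfl
  have := h0 ((F.verts g).card + 0) ((F.verts g).card - 1) ((F.verts g).card - 2) (by ring)
    (by ring) (Finsupp.single ⟨g, by simp⟩ 1)
  rw [finsuppEquiv_single, Matrix.single_one_vecMul] at this
  exact congrFun this g'

variable (f : F.Gen → G.Gen) (hv : ∀ g, G.verts (f g) = F.verts g)
  (hf : ∀ g v, f (F.face g v) = G.face (f g) v)
include hv hf

theorem mat_apply_of_injective (hi : Function.Injective f) (g g' : F.Gen) :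
    G.mat R (f g) (f g') = F.mat R g g' := by
  unfold mat
  rw [hv]
  refine Finset.sum_congr rfl fun v _ => ?_
  rw [← hf]
  by_cases h : F.face g v = g'
  · rw [if_pos h, if_pos (congrArg f h)]
  · rw [if_neg h, if_neg fun h' => h (hi h')]

theorem mem_range_of_mat_ne_zero (g : F.Gen) (g' : G.Gen) (h : G.mat R (f g) g' ≠ 0) :
    g' ∈ Set.range f := by
  obtain ⟨v, -, hne⟩ := Finset.exists_ne_zero_of_sum_ne_zero h
  refine ⟨F.face g v, ?_⟩
  rw [hf]
  by_contra h'
  exact hne (if_neg h')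

variable [Fintype F.Gen] [Fintype G.Gen] (c : ℤ)

theorem homologyEquiv_map (q : ℤ)
    (hP : ∀ g g', inclMat R f g g' ≠ 0 → ((F.verts g).card : ℤ) = q + c →
      ((G.verts g').card : ℤ) = q + c)
    (hc : F.mat R * inclMat R f = inclMat R f * G.mat R) (x) :
    (G.matrixModel R c).homologyEquiv q ((HomologicalComplex.homologyMap (map R c f hv hf) q).hom x) =
      MatH.map (inclMat R f) hP hc ((F.matrixModel R c).homologyEquiv q x) := by
  classical
  refine (F.matrixModel R c).homologyEquiv_homologyMap (G.matrixModel R c) _ _ q hP hc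
    (fun y => ?_) x
  have : (suppOn R _).subtype ∘ₗ (G.finsuppEquiv R c q).toLinearMap ∘ₗ
      ((map R c f hv hf).f q).hom =
      (inclMat R f).vecMulLinear ∘ₗ (suppOn R _).subtype ∘ₗ (F.finsuppEquiv R c q).toLinearMap := by
    refine Finsupp.lhom_ext' fun g => LinearMap.ext_ring ?_
    change (G.finsuppEquiv R c q (Finsupp.mapDomain _ (Finsupp.single g 1))).1 =
      Matrix.vecMul (F.finsuppEquiv R c q (Finsupp.single g 1)).1 (inclMat R f)
    rw [finsuppEquiv_single, Matrix.single_one_vecMul, Finsupp.mapDomain_single,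
      finsuppEquiv_single]
    funext g'
    by_cases h : f g.1 = g'
    · subst h
      exact (Pi.single_eq_same _ _).trans (if_pos rfl).symm
    · exact (Pi.single_eq_of_ne (Ne.symm h) _).trans (if_neg h).symm
  exact LinearMap.congr_fun this y

theorem homologyEquiv_dualHom_map (q : ℤ)
    (hP : ∀ g g', (inclMat R f).transpose g g' ≠ 0 → ((G.verts g).card : ℤ) = q + c →
      ((F.verts g').card : ℤ) = q + c)
    (hc : (G.mat R).transpose * (inclMat R f).transpose =
      (inclMat R f).transpose * (F.mat R).transpose) (x) :
    (F.dualMatrixModel R c).homologyEquiv q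
      ((HomologicalComplex.homologyMap (dualHom (map R c f hv hf)) q).hom x) =
      MatH.map (inclMat R f).transpose hP hc ((G.dualMatrixModel R c).homologyEquiv q x) := by
  classical
  refine (G.dualMatrixModel R c).homologyEquiv_homologyMap (F.dualMatrixModel R c) _ _ q hP hc
    (fun (φ : Module.Dual R (G.GenDeg c q →₀ R)) => ?_) x
  rw [vecMul_transpose_inclMat]
  funext g
  change (F.dualEquiv R c q (LinearMap.comp φ ((map R c f hv hf).f q).hom)).1 g =
    (G.dualEquiv R c q φ).1 (f g)
  by_cases h : ((F.verts g).card : ℤ) = q + c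
  · have h' : ((G.verts (f g)).card : ℤ) = q + c := by rw [hv]; exact h
    rw [F.dualEquiv_apply R c q _ ⟨g, h⟩, G.dualEquiv_apply R c q φ ⟨f g, h'⟩]
    change φ (Finsupp.mapDomain _ (Finsupp.single _ 1)) = _
    rw [Finsupp.mapDomain_single]
  · have h' : ¬ ((G.verts (f g)).card : ℤ) = q + c := by rw [hv]; exact h
    rw [(F.dualEquiv R c q _).2 g h, (G.dualEquiv R c q φ).2 _ h']

end Mat

end FaceSystem

/-! ### Minimal models of simplicial pairs -/

section Pair

variable {V : Type} [LinearOrder V] [Finite V]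

noncomputable instance (K : SComplex V) : Fintype (simplexSystem K).Gen :=
  @Fintype.ofFinite {s : Finset V // s ∈ K} _

variable (R : Type u) [CommRing R] {A X : SComplex V}

/-- The degree of a simplex in the suspended augmented chain complex. -/
def simplexDeg (X : SComplex V) (s : (simplexSystem X).Gen) : ℤ :=
  (((simplexSystem X).verts s).card : ℤ)

/-- The inclusion of simplices. -/
def simplexIncl (h : A ≤ X) (s : (simplexSystem A).Gen) : (simplexSystem X).Gen := ⟨s.1, h s.2⟩

omit [Finite V] in
theorem simplexIncl_injective (h : A ≤ X) : Function.Injective (simplexIncl h) :=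
  fun s s' e => Subtype.ext (congrArg (fun t : (simplexSystem X).Gen => t.1) e)

omit [Finite V] in
theorem mat_submatrix_simplexIncl (h : A ≤ X) :
    (simplexSystem A).mat R = ((simplexSystem X).mat R).submatrix (simplexIncl h) (simplexIncl h) := by
  ext s s'
  exact (FaceSystem.mat_apply_of_injective R (simplexIncl h) (fun _ => rfl) (fun _ _ => rfl)
    (simplexIncl_injective h) s s').symm

omit [Finite V] in
theorem mem_range_simplexIncl_of_mat_ne_zero (h : A ≤ X) (s : (simplexSystem A).Gen)
    (s' : (simplexSystem X).Gen) (hs : (simplexSystem X).mat R (simplexIncl h s) s' ≠ 0) :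
    s' ∈ Set.range (simplexIncl h) :=
  FaceSystem.mem_range_of_mat_ne_zero R (simplexIncl h) (fun _ => rfl) (fun _ _ => rfl) s s' hs

theorem mat_mul_inclMat (h : A ≤ X) : (simplexSystem A).mat R * inclMat R (simplexIncl h) =
    inclMat R (simplexIncl h) * (simplexSystem X).mat R := by
  rw [mat_submatrix_simplexIncl R h]
  exact submatrix_mul_inclMat (simplexIncl_injective h) (mem_range_simplexIncl_of_mat_ne_zero R h)

/-- The minimal model of a pair of simplicial complexes. -/
abbrev PairModel (R : Type u) [CommRing R] (h : A ≤ X) [DecidableEq (simplexSystem X).Gen] : Type _ :=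
  PairContraction (simplexDeg X) (fun s => s ∈ Set.range (simplexIncl h)) ((simplexSystem X).mat R)

theorem nonempty_pairModel [IsDomain R] [IsPrincipalIdealRing R] (h : A ≤ X) (hs : IsSplit R h)
    [DecidableEq (simplexSystem X).Gen] : Nonempty (PairModel R h) := by
  have H : ∀ b : ℤ, TorsionFreeMap (MatH.map
      (D := ((simplexSystem X).mat R).submatrix (simplexIncl h) (simplexIncl h))
      (E := (simplexSystem X).mat R) (p := fun s => simplexDeg X (simplexIncl h s) = b)
      (q := fun s => simplexDeg X s = b) (inclMat R (simplexIncl h))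
      (fun _ _ h hi => eq_of_inclMat_ne_zero h ▸ hi)
      (submatrix_mul_inclMat (simplexIncl_injective h)
        (mem_range_simplexIncl_of_mat_ne_zero R h))) := by
    intro b
    -- Simplices are graded by cardinality, one more than the degree in the reduced chain complex.
    obtain ⟨q, rfl⟩ : ∃ q, b = q + 1 := ⟨b - 1, by ring⟩
    obtain ⟨h1, h2, h3⟩ := hs q
    have t : TorsionFreeMap (iota R h q) :=
      TorsionFreeMap.of_free h1 h2 h3
    -- The matrix of `A` equals the submatrix only propositionally. Generalizing over it allows the
    -- substitution inside the dependent type of the map.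
    have aux : ∀ (D : Matrix (simplexSystem A).Gen (simplexSystem A).Gen R)
        (_ : (simplexSystem A).mat R = D) (hc : D * inclMat R (simplexIncl h) =
          inclMat R (simplexIncl h) * (simplexSystem X).mat R),
        TorsionFreeMap (MatH.map (D := D)
          (E := (simplexSystem X).mat R) (p := fun s => simplexDeg X (simplexIncl h s) = q + 1)
          (q := fun s => simplexDeg X s = q + 1) (inclMat R (simplexIncl h))
          (fun _ _ h hi => eq_of_inclMat_ne_zero h ▸ hi) hc) := by
      rintro _ rfl hc
      exact t.of_equiv (((simplexSystem A).matrixModel R 1).homologyEquiv q)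
        (((simplexSystem X).matrixModel R 1).homologyEquiv q)
        (FaceSystem.homologyEquiv_map R (simplexIncl h) (fun _ => rfl) (fun _ _ => rfl) 1 q
          (fun _ _ h hi => eq_of_inclMat_ne_zero h ▸ hi) hc)
    exact aux _ (mat_submatrix_simplexIncl R h) _
  exact nonempty_pairContraction _ _ _ (FaceSystem.isHomog_mat R) (FaceSystem.mat_mul_mat R)
    (fun s s' hne hs => by
      obtain ⟨s, rfl⟩ := hs
      exact mem_range_simplexIncl_of_mat_ne_zero R h s s' hne)
    (exists_mem_vecMul_of_smul_vecMul (simplexIncl_injective h)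
      (mem_range_simplexIncl_of_mat_ne_zero R h) H (FaceSystem.isHomog_mat R)
      (FaceSystem.mat_mul_mat R))
    (exists_sub_vecMul_mem_of_smul (simplexIncl_injective h)
      (mem_range_simplexIncl_of_mat_ne_zero R h) H (FaceSystem.isHomog_mat R)
      (FaceSystem.mat_mul_mat R))
    (exists_vecMul_of_smul_of_mem (simplexIncl_injective h)
      (mem_range_simplexIncl_of_mat_ne_zero R h) H (FaceSystem.isHomog_mat R))

variable {R} [DecidableEq (simplexSystem X).Gen] {h : A ≤ X} (C : PairModel R h)

namespace PairModel

theorem splitsAs_iota_add_one (q : ℤ) :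
    SplitsAs (iota R h q) (C.Part .ker (q + 1)) (C.Part .coker (q + 1)) (C.Part .im (q + 1)) := by
  have hP : ∀ s s', inclMat R (simplexIncl h) s s' ≠ 0 → simplexDeg X (simplexIncl h s) = q + 1 →
      simplexDeg X s' = q + 1 := fun _ _ h hi => eq_of_inclMat_ne_zero h ▸ hi
  have aux : ∀ (D : Matrix (simplexSystem A).Gen (simplexSystem A).Gen R)
      (_ : ((simplexSystem X).mat R).submatrix (simplexIncl h) (simplexIncl h) = D)
      (hc : D * inclMat R (simplexIncl h) = inclMat R (simplexIncl h) * (simplexSystem X).mat R),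
      SplitsAs (MatH.map (D := D) (E := (simplexSystem X).mat R)
        (p := fun s => simplexDeg X (simplexIncl h s) = q + 1)
        (q := fun s => simplexDeg X s = q + 1) (inclMat R (simplexIncl h)) hP hc)
        (C.Part .ker (q + 1)) (C.Part .coker (q + 1)) (C.Part .im (q + 1)) := by
    rintro _ rfl hc
    classical
    exact C.splitsAs_map (simplexIncl_injective h) (mem_range_simplexIncl_of_mat_ne_zero R h) _ hP hc
  exact (aux _ (mat_submatrix_simplexIncl R h).symm (mat_mul_inclMat R h)).of_equiv
    (((simplexSystem A).matrixModel R 1).homologyEquiv q)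
    (((simplexSystem X).matrixModel R 1).homologyEquiv q)
    (FaceSystem.homologyEquiv_map R (simplexIncl h) (fun _ => rfl) (fun _ _ => rfl) 1 q hP
      (mat_mul_inclMat R h))

theorem splitsAs_iota (b : ℤ) :
    SplitsAs (iota R h (b - 1)) (C.Part .ker b) (C.Part .coker b) (C.Part .im b) := by
  have := splitsAs_iota_add_one C (b - 1)
  rwa [sub_add_cancel] at this

theorem splitsAs_coIota_add_one (q : ℤ) :
    SplitsAs (coIota R h q) (C.Part .coker (q + 1)) (C.Part .ker (q + 1)) (C.Part .im (q + 1)) := by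
  have hP : ∀ s s', (inclMat R (simplexIncl h)).transpose s s' ≠ 0 → simplexDeg X s = q + 1 →
      simplexDeg X (simplexIncl h s') = q + 1 :=
    fun s s' hne hi => (eq_of_inclMat_ne_zero (i := s') (l := s) hne).symm ▸ hi
  have hc : ((simplexSystem X).mat R).transpose * (inclMat R (simplexIncl h)).transpose =
      (inclMat R (simplexIncl h)).transpose * ((simplexSystem A).mat R).transpose := by
    rw [← Matrix.transpose_mul, ← Matrix.transpose_mul, mat_mul_inclMat]
  have aux : ∀ (D : Matrix (simplexSystem A).Gen (simplexSystem A).Gen R)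
      (_ : ((simplexSystem X).mat R).submatrix (simplexIncl h) (simplexIncl h) = D)
      (hc : ((simplexSystem X).mat R).transpose * (inclMat R (simplexIncl h)).transpose =
        (inclMat R (simplexIncl h)).transpose * D.transpose),
      SplitsAs (MatH.map (D := ((simplexSystem X).mat R).transpose) (E := D.transpose)
        (p := fun s => simplexDeg X s = q + 1)
        (q := fun s => simplexDeg X (simplexIncl h s) = q + 1)
        (inclMat R (simplexIncl h)).transpose hP hc)
        (C.Part .coker (q + 1)) (C.Part .ker (q + 1)) (C.Part .im (q + 1)) := by
    rintro _ rfl hc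
    classical
    exact C.splitsAs_transpose_map (simplexIncl_injective h)
      (mem_range_simplexIncl_of_mat_ne_zero R h) _ hP hc
  exact (aux _ (mat_submatrix_simplexIncl R h).symm hc).of_equiv
    (((simplexSystem X).dualMatrixModel R 1).homologyEquiv q)
    (((simplexSystem A).dualMatrixModel R 1).homologyEquiv q)
    (FaceSystem.homologyEquiv_dualHom_map R (simplexIncl h) (fun _ => rfl) (fun _ _ => rfl) 1 q hP hc)

theorem splitsAs_coIota (b : ℤ) :
    SplitsAs (coIota R h (b - 1)) (C.Part .coker b) (C.Part .ker b) (C.Part .im b) := by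
  have := splitsAs_coIota_add_one C (b - 1)
  rwa [sub_add_cancel] at this

theorem nonempty_charH (s : Idx) (b : ℤ) : Nonempty (charH R h s b ≃ₗ[R] (C.Part s b → R)) := by
  cases s with
  | coker => exact (splitsAs_iota C b).nonempty_coker
  | ker => exact (splitsAs_iota C b).nonempty_ker
  | im => exact (splitsAs_iota C b).nonempty_range

/-- Passing to the dual exchanges kernel and cokernel, and `charCoH` is labelled accordingly. So the
same basis elements serve for homology and cohomology, without a universal coefficient theorem. -/
theorem nonempty_charCoH (s : Idx) (b : ℤ) :
    Nonempty (charCoH R h s b ≃ₗ[R] (C.Part s b → R)) := by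
  cases s with
  | coker => exact (splitsAs_coIota C b).nonempty_ker
  | ker => exact (splitsAs_coIota C b).nonempty_coker
  | im => exact (splitsAs_coIota C b).nonempty_range

/-- A basis element of index coker gives a coordinate that vanishes on the range of ι, so the vector
with all coordinates 1 would not be reached. -/
theorem isEmpty_coker [Nontrivial R] (hs : ∀ q, Function.Surjective (iota R h q)) :
    IsEmpty (C.B .coker) := by
  refine ⟨fun x => ?_⟩
  obtain ⟨e, e', he⟩ := splitsAs_iota C (C.dB .coker x)
  obtain ⟨z, hz⟩ := hs _ (e'.symm fun _ => 1)
  have := (he z).1 ⟨x, rfl⟩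
  rw [hz, LinearEquiv.apply_symm_apply] at this
  exact one_ne_zero this

end PairModel

end Pair

/-! ### Polyhedral joins as complexes of words -/

section WordMat

variable {R : Type u} [CommRing R]

theorem sign_natCast (n : ℕ) : sign R n = (-1) ^ n := by
  rw [sign, Int.negOnePow_def]
  simp

variable {m : ℕ} {L : Fin m → Type} [∀ k, Fintype (L k)] [∀ k, DecidableEq (L k)]

-- The k-th summand is nonzero only on words that agree away from `k`, where the sign and identity
-- matrices are diagonal.
open Classical in
theorem wordMat_apply (d : ∀ k, L k → ℤ) (D : ∀ k, Matrix (L k) (L k) R) (w w' : ∀ k, L k) :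
    wordMat d D w w' = ∑ k, if ∀ j, j ≠ k → w j = w' j then
      D k (w k) (w' k) * ∏ j with j < k, sign R (d j (w j)) else 0 := by
  rw [wordMat, Matrix.sum_apply]
  refine Finset.sum_congr rfl fun k _ => ?_
  rw [kron_apply]
  split_ifs with h
  · have e : ∀ j, split3 (fun j => signMat R (d j)) D (fun _ => 1) k j (w j) (w' j) =
        split3 (fun j => sign R (d j (w j))) (fun j => D j (w j) (w' j)) (fun _ => 1) k j := by
      intro j
      unfold split3
      split_ifs with h1 h2
      · rw [← h j h1.ne]; exact Matrix.diagonal_apply_eq _ _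
      · rfl
      · rw [← h j h2]; exact Matrix.one_apply_eq _
    rw [Finset.prod_congr rfl fun j _ => e j, prod_split3, Finset.prod_const_one, mul_one]
  · push Not at h
    obtain ⟨j, hj, hne⟩ := h
    refine Finset.prod_eq_zero (Finset.mem_univ j) ?_
    unfold split3
    rw [if_neg hj]
    split_ifs
    · exact Matrix.diagonal_apply_ne _ hne
    · exact Matrix.one_apply_ne hne

end WordMat

section Parts

variable {m : ℕ} {n : Fin m → ℕ}

/-- The vertex `v` of the `k`-th block. -/
def vert (k : Fin m) (v : Fin (n k)) : Vert n := toLex ⟨k, v⟩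

theorem mem_part {σ : Finset (Vert n)} {k : Fin m} {v : Fin (n k)} :
    v ∈ part σ k ↔ vert k v ∈ σ := by
  simp [part, vert]

theorem exists_eq_vert (v : Vert n) : ∃ k u, v = vert k u := ⟨(ofLex v).1, (ofLex v).2, rfl⟩

theorem vert_inj {k k' : Fin m} {u : Fin (n k)} {u' : Fin (n k')} (h : vert k u = vert k' u') :
    (⟨k, u⟩ : Σ k, Fin (n k)) = ⟨k', u'⟩ := toLex.injective h

theorem vert_inj' {k : Fin m} {u u' : Fin (n k)} (h : vert k u = vert k u') : u = u' :=
  eq_of_heq (Sigma.mk.inj (vert_inj h)).2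

theorem ext_part {σ σ' : Finset (Vert n)} (h : ∀ k, part σ k = part σ' k) : σ = σ' := by
  ext v
  obtain ⟨k, u, rfl⟩ := exists_eq_vert v
  rw [← mem_part, ← mem_part, h]

theorem vert_lt_vert_of_lt {k k' : Fin m} (u : Fin (n k)) (u' : Fin (n k')) (h : k < k') :
    vert k u < vert k' u' := Sigma.Lex.lt_def.2 (Or.inl h)

theorem vert_lt_vert {k : Fin m} {u u' : Fin (n k)} : vert k u < vert k u' ↔ u < u' := by
  refine Sigma.Lex.lt_def.trans ⟨?_, fun h => Or.inr ⟨rfl, h⟩⟩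
  rintro (h | h)
  · exact absurd h (lt_irrefl _)
  · obtain ⟨_, h⟩ := h
    exact h

theorem sum_eq_sum_part {M : Type*} [AddCommMonoid M] (σ : Finset (Vert n)) (g : Vert n → M) :
    ∑ v ∈ σ, g v = ∑ k, ∑ u ∈ part σ k, g (vert k u) := by
  rw [Finset.sum_sigma']
  symm
  refine Finset.sum_bij (fun x _ => vert x.1 x.2) ?_ ?_ ?_ fun _ _ => rfl
  · rintro ⟨k, u⟩ h
    exact mem_part.1 (Finset.mem_sigma.1 h).2
  · rintro ⟨k, u⟩ - ⟨k', u'⟩ - h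
    exact vert_inj h
  · intro v hv
    obtain ⟨k, u, rfl⟩ := exists_eq_vert v
    exact ⟨⟨k, u⟩, Finset.mem_sigma.2 ⟨Finset.mem_univ _, mem_part.2 hv⟩, rfl⟩

theorem card_eq_sum_card_part (σ : Finset (Vert n)) : σ.card = ∑ k, (part σ k).card := by
  rw [Finset.card_eq_sum_ones, sum_eq_sum_part]
  simp

/-- The blocks follow one another, so the vertices before this one are all those of the earlier
blocks and the earlier ones of its own block. -/
theorem sgn_vert (σ : Finset (Vert n)) (k : Fin m) (u : Fin (n k)) :
    FaceSystem.sgn σ (vert k u) =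
      FaceSystem.sgn (part σ k) u * ∏ j with j < k, (-1) ^ (part σ j).card := by
  unfold FaceSystem.sgn
  rw [card_eq_sum_card_part, ← Finset.prod_pow_eq_pow_sum]
  have e : ∀ j, (-1 : ℤ) ^ (part (σ.filter fun v => v < vert k u) j).card =
      split3 (fun j => (-1) ^ (part σ j).card)
        (fun j => if j = k then (-1) ^ ((part σ k).filter fun v => v < u).card else 1)
        (fun _ => 1) k j := by
    intro j
    unfold split3
    split_ifs with h1 h2
    · congr 2
      ext v
      rw [mem_part, mem_part, Finset.mem_filter]
      exact and_iff_left (vert_lt_vert_of_lt v u h1)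
    · subst h2
      beta_reduce
      rw [if_pos rfl]
      refine congrArg (fun s : Finset (Fin (n j)) => (-1 : ℤ) ^ s.card) ?_
      ext v
      rw [mem_part, Finset.mem_filter, Finset.mem_filter, mem_part, vert_lt_vert]
    · have : part (σ.filter fun v => v < vert k u) j = ∅ := by
        ext v
        rw [mem_part, Finset.mem_filter]
        have h3 := vert_lt_vert_of_lt u v (lt_of_le_of_ne (not_lt.1 h1) (Ne.symm h2))
        simp [h3.le]
      rw [this]; rfl
  rw [Finset.prod_congr rfl fun j _ => e j, prod_split3]
  simp

theorem part_erase_vert_self (σ : Finset (Vert n)) (k : Fin m) (u : Fin (n k)) :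
    part (σ.erase (vert k u)) k = (part σ k).erase u := by
  ext v
  rw [mem_part, Finset.mem_erase, Finset.mem_erase, mem_part]
  exact and_congr_left fun _ => not_congr ⟨vert_inj', fun h => h ▸ rfl⟩

theorem part_erase_vert_of_ne (σ : Finset (Vert n)) {k j : Fin m} (h : j ≠ k) (u : Fin (n k)) :
    part (σ.erase (vert k u)) j = part σ j := by
  ext v
  rw [mem_part, Finset.mem_erase, mem_part]
  exact and_iff_right fun h' => h (congrArg Sigma.fst (vert_inj h'))

/-- The simplex with given parts. -/
def ofParts (s : ∀ k : Fin m, Finset (Fin (n k))) : Finset (Vert n) :=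
  Finset.univ.filter fun v => (ofLex v).2 ∈ s (ofLex v).1

theorem part_ofParts (s : ∀ k : Fin m, Finset (Fin (n k))) (k : Fin m) : part (ofParts s) k = s k := by
  ext v
  rw [mem_part, ofParts, Finset.mem_filter]
  exact and_iff_right (Finset.mem_univ _)

variable {K : SComplex (Fin m)} {X A : ∀ k : Fin m, SComplex (Fin (n k))}

theorem mem_polyJoin {σ : Finset (Vert n)} :
    σ ∈ polyJoin K X A ↔ ∃ τ ∈ K, ∀ k, part σ k ∈ if k ∈ τ then X k else A k := by
  unfold polyJoin
  simp only [LowerSet.mem_iSup_iff, exists_prop]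
  rfl

theorem mem_range_simplexIncl_iff {V : Type} [LinearOrder V] {A X : SComplex V} (h : A ≤ X)
    (s : (simplexSystem X).Gen) : s ∈ Set.range (simplexIncl h) ↔ s.1 ∈ A := by
  constructor
  · rintro ⟨t, rfl⟩
    exact t.2
  · exact fun hs => ⟨⟨s.1, hs⟩, rfl⟩

variable (h : ∀ k, A k ≤ X k)
include h

theorem part_mem_of_mem_polyJoin {σ : Finset (Vert n)} (hσ : σ ∈ polyJoin K X A) (k : Fin m) :
    part σ k ∈ X k := by
  obtain ⟨τ, -, hτ⟩ := mem_polyJoin.1 hσ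
  have := hτ k
  split_ifs at this
  · exact this
  · exact h k this

/-- A simplex of the polyhedral join as a word of simplices. -/
def toWord (σ : (simplexSystem (polyJoin K X A)).Gen) (k : Fin m) : (simplexSystem (X k)).Gen :=
  ⟨part σ.1 k, part_mem_of_mem_polyJoin h σ.2 k⟩

theorem toWord_injective : Function.Injective (toWord (K := K) h) := by
  intro σ σ' e
  apply Subtype.ext
  exact ext_part fun k => congrArg (fun t : ∀ k, (simplexSystem (X k)).Gen => (t k).1) e

theorem range_toWord : Set.range (toWord (K := K) h) =
    wordSet K fun k s => s ∈ Set.range (simplexIncl (h k)) := by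
  ext w
  constructor
  · rintro ⟨σ, rfl⟩
    obtain ⟨τ, hτ, hσ⟩ := mem_polyJoin.1 σ.2
    refine ⟨τ, hτ, fun k hk => ?_⟩
    by_contra hk'
    have := hσ k
    rw [if_neg hk'] at this
    exact hk ((mem_range_simplexIncl_iff (h k) _).2 this)
  · rintro ⟨τ, hτ, hw⟩
    refine ⟨⟨ofParts fun k => (w k).1, mem_polyJoin.2 ⟨τ, hτ, fun k => ?_⟩⟩, ?_⟩
    · rw [part_ofParts]
      split_ifs with hk
      · exact (w k).2
      · by_contra h'
        exact hk (hw k fun hm => h' ((mem_range_simplexIncl_iff (h k) _).1 hm))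
    · funext k
      exact Subtype.ext (part_ofParts (fun k => (w k).1) k)

theorem sum_simplexDeg_toWord (σ : (simplexSystem (polyJoin K X A)).Gen) :
    ∑ k, simplexDeg (X k) (toWord h σ k) = (((simplexSystem (polyJoin K X A)).verts σ).card : ℤ) := by
  have := card_eq_sum_card_part σ.1
  have e : (((simplexSystem (polyJoin K X A)).verts σ).card : ℤ) = ((σ.1.card : ℕ) : ℤ) := rfl
  rw [e, this, Nat.cast_sum]
  rfl

variable (R : Type u) [CommRing R]

/-- Removing a vertex changes exactly one part. By `sgn_vert`, the simplicial sign is the sign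
within that part times the Koszul sign for the degrees `simplexDeg`; grading by cardinality is what
makes these agree. -/
theorem mat_polyJoin [∀ k, DecidableEq (simplexSystem (X k)).Gen] :
    (simplexSystem (polyJoin K X A)).mat R =
      (wordMat (fun k => simplexDeg (X k)) (fun k => (simplexSystem (X k)).mat R)).submatrix
        (toWord h) (toWord h) := by
  classical
  ext σ σ'
  rw [Matrix.submatrix_apply, wordMat_apply]
  refine (sum_eq_sum_part σ.1 _).trans (Finset.sum_congr rfl fun k _ => ?_)
  have face : ∀ u, (simplexSystem (polyJoin K X A)).face σ (vert k u) = σ' ↔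
      (∀ j, j ≠ k → toWord h σ j = toWord h σ' j) ∧
        (simplexSystem (X k)).face (toWord h σ k) u = toWord h σ' k := by
    intro u
    constructor
    · rintro rfl
      exact ⟨fun j hj => Subtype.ext (part_erase_vert_of_ne σ.1 hj u).symm,
        Subtype.ext (part_erase_vert_self σ.1 k u).symm⟩
    · rintro ⟨h1, h2⟩
      refine toWord_injective h (funext fun j => ?_)
      by_cases hj : j = k
      · subst hj
        rw [← h2]
        exact Subtype.ext (part_erase_vert_self σ.1 j u)
      · rw [← h1 j hj]
        exact Subtype.ext (part_erase_vert_of_ne σ.1 hj u)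
  by_cases hw : ∀ j, j ≠ k → toWord h σ j = toWord h σ' j
  · rw [if_pos hw, FaceSystem.mat, Finset.sum_mul]
    refine Finset.sum_congr rfl fun u _ => ?_
    by_cases hu : (simplexSystem (X k)).face (toWord h σ k) u = toWord h σ' k
    · rw [if_pos hu, if_pos ((face u).2 ⟨hw, hu⟩)]
      have e : ∀ j, sign R (simplexDeg (X j) (toWord h σ j)) = (-1) ^ (part σ.1 j).card :=
        fun j => sign_natCast _
      simp only [e]
      refine (congrArg (fun z : ℤ => (z : R)) (sgn_vert σ.1 k u)).trans ?_
      push_cast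
      rfl
    · rw [if_neg hu, if_neg fun h' => hu ((face u).1 h').2, zero_mul]
  · rw [if_neg hw]
    exact Finset.sum_eq_zero fun u _ => if_neg fun h' => hw ((face u).1 h').1

end Parts


/-! ### The minimal model of a polyhedral join -/

section Block

variable {R : Type u} [CommRing R] {Y : Type} [Fintype Y] [DecidableEq Y] {F : Y → Type}
  [∀ y, Fintype (F y)]

theorem vecMul_blockDiagonal (E : ∀ y, Matrix (F y) (F y) R) (c : (Σ y, F y) → R) (y : Y) (a : F y) :
    Matrix.vecMul c (Matrix.blockDiagonal' E) ⟨y, a⟩ =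
      Matrix.vecMul (fun b => c ⟨y, b⟩) (E y) a := by
  refine (Fintype.sum_sigma _).trans ?_
  rw [Finset.sum_eq_single y]
  · exact Finset.sum_congr rfl fun b _ => congrArg _ (Matrix.blockDiagonal'_apply_eq E y b a)
  · intro y' _ hne
    exact Finset.sum_eq_zero fun b _ =>
      (congrArg _ (Matrix.blockDiagonal'_apply_ne E b a hne)).trans (mul_zero _)
  · exact fun h => absurd (Finset.mem_univ y) h

/-- Both being a cycle and being a boundary can be tested block by block. -/
theorem nonempty_matH_blockDiagonal (E : ∀ y, Matrix (F y) (F y) R) (p : (Σ y, F y) → Prop) :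
    Nonempty (MatH (Matrix.blockDiagonal' E) p ≃ₗ[R]
      ∀ y, MatH (E y) (fun a => p ⟨y, a⟩)) := by
  let e : cyc (Matrix.blockDiagonal' E) p ≃ₗ[R] ∀ y, cyc (E y) (fun a => p ⟨y, a⟩) :=
    { toFun := fun c y => ⟨fun a => c.1 ⟨y, a⟩, fun a ha => c.2.1 _ ha, funext fun a =>
        (vecMul_blockDiagonal E c.1 y a).symm.trans (congrFun (mem_cyc.1 c.2).2 ⟨y, a⟩)⟩
      invFun := fun c => ⟨fun x => (c x.1).1 x.2, fun x hx => (c x.1).2.1 _ hx, funext fun x =>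
        (vecMul_blockDiagonal E _ x.1 x.2).trans (congrFun (mem_cyc.1 (c x.1).2).2 x.2)⟩
      map_add' := fun _ _ => rfl
      map_smul' := fun _ _ => rfl
      left_inv := fun _ => rfl
      right_inv := fun _ => rfl }
  refine ⟨(Submodule.Quotient.equiv _ (Submodule.pi Set.univ fun y => bdry (E y) _) e ?_).trans
    (Submodule.quotientPi _)⟩
  ext c
  rw [Submodule.mem_map, Submodule.mem_pi]
  constructor
  · rintro ⟨c, ⟨y, hy⟩, rfl⟩ z -
    refine ⟨fun a => y ⟨z, a⟩, ?_⟩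
    funext a
    exact (vecMul_blockDiagonal E y z a).symm.trans (congrFun hy ⟨z, a⟩)
  · intro hc
    choose z hz using fun y => hc y (Set.mem_univ y)
    refine ⟨e.symm c, ⟨fun x => z x.1 x.2, ?_⟩, e.apply_symm_apply c⟩
    funext x
    exact (vecMul_blockDiagonal E _ x.1 x.2).trans (congrFun (hz x.1) x.2)

end Block

/-! ### Words in the minimal models as basis words with letters -/

section GoodWords

variable {m : ℕ}

noncomputable instance (K : SComplex (Fin m)) (x : Fin m → Idx) :
    Fintype (totalSystem K x).Gen :=
  @Fintype.ofFinite {w : Fin m → Letter // (∀ k, (w k).idx = x k) ∧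
    Finset.univ.filter (fun k => w k = Letter.α ∨ w k = Letter.β) ∈ K} _

/-- The element of index `s` underlying a basis element of `T_*^𝒳 ⊗̂ M`. -/
def Good.base {B : Idx → Type} (g : Good B) : Σ s, B s := ⟨g.1.idx, g.2⟩

theorem Good.ext_base {B : Idx → Type} {g g' : Good B} (h1 : g.1 = g'.1) (h2 : g.base = g'.base) :
    g = g' := by
  obtain ⟨l, b⟩ := g
  obtain ⟨l', b'⟩ := g'
  cases h1
  exact congrArg _ (eq_of_heq (Sigma.mk.inj h2).2)

/-- The basis element of `T_*^𝒳 ⊗̂ M` with given letter and underlying element. -/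
def Good.mk' {B : Idx → Type} (l : Letter) (y : Σ s, B s) (h : l.idx = y.1) : Good B := ⟨l, h ▸ y.2⟩

theorem Good.base_mk' {B : Idx → Type} (l : Letter) (y : Σ s, B s) (h : l.idx = y.1) :
    (Good.mk' l y h).base = y := by
  obtain ⟨s, b⟩ := y
  cases h
  rfl

theorem Good.fst_toGamma {B : Idx → Type} (g : Good B) :
    g.toGamma.1 = if g.1 = .β then .γ else g.1 := by
  obtain ⟨l, b⟩ := g
  cases l <;> rfl

theorem Good.base_toGamma {B : Idx → Type} (g : Good B) : g.toGamma.base = g.base := by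
  obtain ⟨l, b⟩ := g
  cases l <;> rfl

theorem Good.deg_eq {B : Idx → Type} (dB : ∀ s, B s → ℤ) (g : Good B) :
    Good.deg dB g = dB g.base.1 g.base.2 + if g.1 = .β then 1 else 0 := rfl

variable (K : SComplex (Fin m)) (B : Fin m → Idx → Type)

/-- The index of a word in the bases `B k`. -/
def wordIdx {B : Fin m → Idx → Type} (y : ∀ k, Σ s, B k s) (k : Fin m) : Idx := (y k).1

instance : Fintype Idx := ⟨{.coker, .ker, .im}, fun x => by cases x <;> decide⟩

/-- Pairs of a word in the bases `B k` and a word of letters of the same index. -/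
abbrev PairedWord : Type := Σ y : (∀ k, Σ s, B k s), (totalSystem K (wordIdx y)).Gen

variable {K B}

/-- The letters of a paired word. -/
def PairedWord.letter (z : PairedWord K B) (k : Fin m) : Letter := z.2.1 k

/-- A paired word as a word in the bases of the minimal models. -/
def PairedWord.toGood (z : PairedWord K B) (k : Fin m) : Good (B k) :=
  Good.mk' (z.letter k) (z.1 k) (z.2.2.1 k)

theorem PairedWord.base_toGood (z : PairedWord K B) (k : Fin m) : (z.toGood k).base = z.1 k :=
  Good.base_mk' _ _ _

theorem PairedWord.fst_toGood (z : PairedWord K B) (k : Fin m) : (z.toGood k).1 = z.letter k := rfl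

theorem PairedWord.ext_letter {z z' : PairedWord K B} (h1 : z.1 = z'.1)
    (h2 : ∀ k, z.letter k = z'.letter k) : z = z' := by
  obtain ⟨y, w⟩ := z
  obtain ⟨y', w'⟩ := z'
  cases h1
  exact congrArg _ (Subtype.ext (funext h2))

theorem PairedWord.toGood_eq_iff (z z' : PairedWord K B) (k : Fin m) :
    z.toGood k = z'.toGood k ↔ z.letter k = z'.letter k ∧ z.1 k = z'.1 k := by
  constructor
  · intro h
    refine ⟨congrArg Sigma.fst h, ?_⟩
    rw [← z.base_toGood, ← z'.base_toGood, h]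
  · rintro ⟨h1, h2⟩
    exact Good.ext_base h1 (by rw [z.base_toGood, z'.base_toGood, h2])

theorem PairedWord.toGood_injective : Function.Injective (PairedWord.toGood (K := K) (B := B)) := by
  intro z z' h
  have := fun k => (z.toGood_eq_iff z' k).1 (congrFun h k)
  exact PairedWord.ext_letter (funext fun k => (this k).2) fun k => (this k).1

theorem Good.not_inSub_iff {B : Idx → Type} (g : Good B) : ¬ g.inSub ↔ g.1 = .α ∨ g.1 = .β := by
  obtain ⟨l, b⟩ := g
  unfold Good.inSub
  cases l <;> simp

/-- The letters outside the subcomplex are α and β, exactly those whose places must form a simplex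
of `K` in the total complex. -/
theorem PairedWord.range_toGood : Set.range (PairedWord.toGood (K := K) (B := B)) =
    wordSet K fun k => Good.inSub (B := B k) := by
  ext w
  constructor
  · rintro ⟨z, rfl⟩
    refine ⟨_, z.2.2.2, fun k hk => ?_⟩
    rw [Finset.mem_filter]
    exact ⟨Finset.mem_univ k, (Good.not_inSub_iff _).1 hk⟩
  · rintro ⟨τ, hτ, hw⟩
    refine ⟨⟨fun k => (w k).base, ⟨fun k => (w k).1, fun k => rfl, K.lower (fun k hk => ?_) hτ⟩⟩,
      ?_⟩
    · exact hw k ((Good.not_inSub_iff _).2 (Finset.mem_filter.1 hk).2)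
    · funext k
      exact Good.ext_base rfl (PairedWord.base_toGood _ k)

theorem PairedWord.sum_deg (dB : ∀ k s, B k s → ℤ) (z : PairedWord K B) :
    ∑ k, Good.deg (dB k) (z.toGood k) = (∑ k, dB k (z.1 k).1 (z.1 k).2) +
      (((totalSystem K (wordIdx z.1)).verts z.2).card : ℤ) := by
  simp only [Good.deg_eq, Finset.sum_add_distrib]
  refine congrArg₂ _ (Finset.sum_congr rfl fun k _ => by rw [z.base_toGood]) ?_
  rw [Finset.sum_ite, Finset.sum_const_zero, add_zero, Finset.sum_const, nsmul_one]
  rfl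

/-- The sign relating a paired word to the corresponding word in the minimal models. -/
def PairedWord.sgn (dB : ∀ k s, B k s → ℤ) (z : PairedWord K B) : ℤˣ :=
  ∏ k, if z.letter k = .β then ∏ j with j < k, (dB j (z.1 j).1 (z.1 j).2).negOnePow else 1

variable {R : Type u} [CommRing R]

/-- All factors away from `k` occur twice and cancel, and at `k` only the letter β contributes. -/
theorem PairedWord.sgn_mul_sgn (dB : ∀ k s, B k s → ℤ) (z z' : PairedWord K B) (k : Fin m)
    (hy : z.1 = z'.1) (hne : ∀ j, j ≠ k → z.letter j = z'.letter j) (hk : z.letter k = .β)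
    (hk' : z'.letter k = .γ) :
    z.sgn dB * z'.sgn dB = ∏ j with j < k, (dB j (z.1 j).1 (z.1 j).2).negOnePow := by
  unfold PairedWord.sgn
  rw [← Finset.prod_mul_distrib, Finset.prod_eq_single k]
  · rw [if_pos hk, hk', if_neg (fun h => by cases h), mul_one]
  · intro j _ hj
    rw [hne j hj, hy, Int.units_mul_self]
  · exact fun h => absurd (Finset.mem_univ k) h

variable [∀ k s, Fintype (B k s)] [∀ k s, DecidableEq (B k s)]

theorem PairedWord.good_mat_eq (z z' : PairedWord K B) (k : Fin m) :
    Good.mat R (B k) (z.toGood k) (z'.toGood k) =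
      if z.letter k = .β ∧ z'.letter k = .γ ∧ z.1 k = z'.1 k then 1 else 0 := by
  unfold Good.mat
  rw [Matrix.of_apply]
  refine if_congr ?_ rfl rfl
  refine and_congr_right fun h => ?_
  have hβ : (z.toGood k).1 = .β := h
  constructor
  · intro e
    refine ⟨?_, ?_⟩
    · rw [← z'.fst_toGood, e, Good.fst_toGamma, if_pos hβ]
    · rw [← z.base_toGood, ← z'.base_toGood, e, Good.base_toGamma]
  · rintro ⟨h1, h2⟩
    refine Good.ext_base ?_ ?_
    · rw [z'.fst_toGood, h1, Good.fst_toGamma, if_pos hβ]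
    · rw [Good.base_toGamma, z.base_toGood, z'.base_toGood, h2]

theorem face_eq_iff {x : Fin m → Idx} (w w' : (totalSystem K x).Gen) (k : Fin m) (hk : w.1 k = .β) :
    (totalSystem K x).face w k = w' ↔ (∀ j, j ≠ k → w.1 j = w'.1 j) ∧ w'.1 k = .γ := by
  constructor
  · rintro rfl
    refine ⟨fun j hj => ?_, ?_⟩
    · exact (if_neg fun h => hj h.1).symm
    · exact if_pos ⟨rfl, hk⟩
  · rintro ⟨h1, h2⟩
    refine Subtype.ext (funext fun j => ?_)
    change (if j = k ∧ w.1 j = .β then Letter.γ else w.1 j) = w'.1 j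
    by_cases hj : j = k
    · subst hj
      rw [if_pos ⟨rfl, hk⟩, h2]
    · rw [if_neg fun h => hj h.1, h1 j hj]

theorem sgn_filter (w : Fin m → Letter) (k : Fin m) :
    FaceSystem.sgn (Finset.univ.filter fun j => w j = .β) k =
      ∏ j with j < k, if w j = .β then -1 else 1 := by
  unfold FaceSystem.sgn
  rw [Finset.prod_ite, Finset.prod_const_one, mul_one, Finset.prod_const, Finset.filter_filter,
    Finset.filter_filter]
  congr 3
  ext j
  exact and_comm

-- The differential replaces one β by γ and keeps the underlying basis elements, hence is block
-- diagonal. The Koszul sign of a letter splits into its basis degree and the count of β. The second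
-- part is the sign in the total complex of `K`, and the first is absorbed by rescaling the words by
-- `PairedWord.sgn`.
open Classical in
theorem wordMat_toGood (dB : ∀ k s, B k s → ℤ) (z z' : PairedWord K B) :
    wordMat (fun k => Good.deg (dB k)) (fun k => Good.mat R (B k)) z.toGood z'.toGood =
      ((z.sgn dB : ℤ) : R) * ((z'.sgn dB : ℤ) : R) *
        Matrix.blockDiagonal' (fun y => (totalSystem K (wordIdx y)).mat R) z z' := by
  rw [wordMat_apply]
  by_cases hy : z.1 = z'.1
  swap
  · rw [Finset.sum_eq_zero, Matrix.blockDiagonal'_apply_ne _ _ _ hy, mul_zero]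
    intro k _
    split_ifs with h
    · rw [PairedWord.good_mat_eq, if_neg, zero_mul]
      rintro ⟨-, -, hk⟩
      refine hy (funext fun j => ?_)
      by_cases hj : j = k
      · rw [hj, hk]
      · exact ((z.toGood_eq_iff z' j).1 (h j hj)).2
    · rfl
  obtain ⟨y, w⟩ := z
  obtain ⟨y', w'⟩ := z'
  obtain rfl : y = y' := hy
  rw [Matrix.blockDiagonal'_apply_eq, FaceSystem.mat, Finset.mul_sum]
  have hverts : (totalSystem K (wordIdx y)).verts w = Finset.univ.filter fun k => w.1 k = .β := rfl
  rw [hverts, Finset.sum_filter]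
  refine Finset.sum_congr rfl fun k _ => ?_
  set z : PairedWord K B := ⟨y, w⟩ with hz
  set z' : PairedWord K B := ⟨y, w'⟩ with hz'
  by_cases hk : w.1 k = .β
  swap
  · have h0 : Good.mat R (B k) (z.toGood k) (z'.toGood k) = 0 :=
      (PairedWord.good_mat_eq z z' k).trans (if_neg fun h => hk h.1)
    rw [if_neg hk, h0, zero_mul, ite_self]
  rw [if_pos hk]
  by_cases hf : (totalSystem K (wordIdx y)).face w k = w'
  · obtain ⟨h1, h2⟩ := (face_eq_iff w w' k hk).1 hf
    rw [if_pos hf, if_pos fun j hj => (z.toGood_eq_iff z' j).2 ⟨h1 j hj, rfl⟩,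
      PairedWord.good_mat_eq, if_pos ⟨hk, h2, rfl⟩, one_mul, ← Int.cast_mul, ← Units.val_mul,
      PairedWord.sgn_mul_sgn dB z z' k rfl h1 hk h2, sgn_filter, Units.coe_prod, ← Int.cast_mul,
      ← Finset.prod_mul_distrib, Int.cast_prod]
    refine Finset.prod_congr rfl fun j _ => ?_
    rw [Good.deg_eq, sign_add, z.base_toGood, Int.cast_mul]
    congr 1
    change sign R (if w.1 j = .β then 1 else 0) = _
    split_ifs
    · rw [sign_one]; simp
    · rw [sign_zero]; simp
  · rw [if_neg hf, mul_zero]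
    split_ifs with h
    · rw [PairedWord.good_mat_eq, if_neg, zero_mul]
      rintro ⟨-, h2, -⟩
      exact hf ((face_eq_iff w w' k hk).2
        ⟨fun j hj => ((z.toGood_eq_iff z' j).1 (h j hj)).1, h2⟩)
    · rfl

end GoodWords


/-! ### The homology of a polyhedral join as a product -/

section Product

variable {R : Type u} [CommRing R]

theorem nonempty_matH_congr {L : Type} [Fintype L] {D D' : Matrix L L R} {p p' : L → Prop}
    (hD : D = D') (hp : ∀ l, p l ↔ p' l) : Nonempty (MatH D p ≃ₗ[R] MatH D' p') := by
  subst hD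
  obtain rfl : p = p' := funext fun l => propext (hp l)
  exact ⟨LinearEquiv.refl R _⟩

variable {m : ℕ} (K : SComplex (Fin m))

/-- Each word of basis elements contributes one copy of the total complex of its index, shifted by
the sum of its degrees. Hence that sum is subtracted from N. -/
theorem nonempty_matH_good {B : Fin m → Idx → Type} [∀ k s, Fintype (B k s)]
    [∀ k s, DecidableEq (B k s)] (dB : ∀ k s, B k s → ℤ) (N : ℤ) :
    Nonempty (MatH ((wordMat (fun k => Good.deg (dB k)) (fun k => Good.mat R (B k))).submatrix
        (PairedWord.toGood (K := K)) PairedWord.toGood)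
        (fun z => ∑ k, Good.deg (dB k) (z.toGood k) = N) ≃ₗ[R]
      ∀ y : (∀ k, Σ s, B k s), totH R K (wordIdx y) (N - ∑ k, dB k (y k).1 (y k).2)) ∧
    Nonempty (MatH ((wordMat (fun k => Good.deg (dB k)) (fun k => Good.mat R (B k))).submatrix
        (PairedWord.toGood (K := K)) PairedWord.toGood).transpose
        (fun z => ∑ k, Good.deg (dB k) (z.toGood k) = N) ≃ₗ[R]
      ∀ y : (∀ k, Σ s, B k s), totCoH R K (wordIdx y) (N - ∑ k, dB k (y k).1 (y k).2)) := by
  classical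
  have hs : ∀ z z' : PairedWord K B, ((wordMat (fun k => Good.deg (dB k))
      (fun k => Good.mat R (B k))).submatrix PairedWord.toGood PairedWord.toGood) z z' =
      ((z.sgn dB : ℤ) : R) * ((z'.sgn dB : ℤ) : R) *
        Matrix.blockDiagonal' (fun y => (totalSystem K (wordIdx y)).mat R) z z' :=
    wordMat_toGood dB
  have hp : ∀ (y : ∀ k, Σ s, B k s) (w : (totalSystem K (wordIdx y)).Gen),
      ∑ k, Good.deg (dB k) (PairedWord.toGood ⟨y, w⟩ k) = N ↔
      (((totalSystem K (wordIdx y)).verts w).card : ℤ) =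
        N - (∑ k, dB k (y k).1 (y k).2) + 0 := by
    intro y w
    rw [PairedWord.sum_deg]
    constructor <;> intro h <;> linarith
  constructor
  · obtain ⟨e⟩ := matH_equiv_of_equiv (Equiv.refl (PairedWord K B)) (fun z : PairedWord K B => z.sgn dB) hs
      (p := fun z : PairedWord K B => ∑ k, Good.deg (dB k) (z.toGood k) = N)
      (q := fun z : PairedWord K B => ∑ k, Good.deg (dB k) (z.toGood k) = N) (fun _ => Iff.rfl)
    obtain ⟨e'⟩ := nonempty_matH_blockDiagonal (fun y : (∀ k, Σ s, B k s) =>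
      (totalSystem K (wordIdx y)).mat R) (fun z : PairedWord K B => ∑ k, Good.deg (dB k) (z.toGood k) = N)
    have e'' := fun y : (∀ k, Σ s, B k s) =>
      nonempty_matH_congr (rfl : (totalSystem K (wordIdx y)).mat R = _) (hp y)
    exact ⟨e.symm.trans (e'.trans (LinearEquiv.piCongrRight fun y =>
      (e'' y).some.trans (((totalSystem K (wordIdx y)).matrixModel R 0).homologyEquiv _).symm))⟩
  · obtain ⟨e⟩ := matH_equiv_of_equiv (Equiv.refl (PairedWord K B)) (fun z : PairedWord K B => z.sgn dB)
      (D := (Matrix.blockDiagonal' (fun y => (totalSystem K (wordIdx y)).mat R)).transpose)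
      (E := ((wordMat (fun k => Good.deg (dB k)) (fun k => Good.mat R (B k))).submatrix
        (PairedWord.toGood (K := K)) PairedWord.toGood).transpose)
      (fun z z' : PairedWord K B => (hs z' z).trans (by rw [mul_comm ((z'.sgn dB : ℤ) : R)]; rfl))
      (p := fun z : PairedWord K B => ∑ k, Good.deg (dB k) (z.toGood k) = N)
      (q := fun z : PairedWord K B => ∑ k, Good.deg (dB k) (z.toGood k) = N) (fun _ => Iff.rfl)
    obtain ⟨e0⟩ := nonempty_matH_congr (Matrix.blockDiagonal'_transpose
      (fun y : (∀ k, Σ s, B k s) => (totalSystem K (wordIdx y)).mat R))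
      (p := fun z : PairedWord K B => ∑ k, Good.deg (dB k) (z.toGood k) = N) (fun _ => Iff.rfl)
    obtain ⟨e'⟩ := nonempty_matH_blockDiagonal (fun y : (∀ k, Σ s, B k s) =>
      ((totalSystem K (wordIdx y)).mat R).transpose)
      (fun z : PairedWord K B => ∑ k, Good.deg (dB k) (z.toGood k) = N)
    have e'' := fun y : (∀ k, Σ s, B k s) =>
      nonempty_matH_congr (rfl : ((totalSystem K (wordIdx y)).mat R).transpose = _) (hp y)
    exact ⟨e.symm.trans (e0.trans (e'.trans (LinearEquiv.piCongrRight fun y =>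
      (e'' y).some.trans (((totalSystem K (wordIdx y)).dualMatrixModel R 0).homologyEquiv _).symm)))⟩

variable {n : Fin m → ℕ} {X A : ∀ k : Fin m, SComplex (Fin (n k))} {h : ∀ k, A k ≤ X k}
  [∀ k, DecidableEq (simplexSystem (X k)).Gen] (C : ∀ k, PairModel R (h k)) (N : ℤ)

theorem nonempty_redH_polyJoin : Nonempty (redH R (polyJoin K X A) (N - 1) ≃ₗ[R]
    ∀ y : (∀ k, Σ s, (C k).B s), totH R K (wordIdx y) (N - ∑ k, (C k).dB (y k).1 (y k).2)) := by
  obtain ⟨e⟩ := nonempty_matH_congr (mat_polyJoin (K := K) h R)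
    (p := fun σ => (((simplexSystem (polyJoin K X A)).verts σ).card : ℤ) = N - 1 + 1)
    (p' := fun σ => ∑ k, simplexDeg (X k) (toWord h σ k) = N)
    (fun σ => by rw [sum_simplexDeg_toWord, sub_add_cancel])
  obtain ⟨⟨e'⟩, -⟩ := PairContraction.nonempty_matH_equiv C
    (fun k => FaceSystem.isHomog_mat R) (fun k s s' hne hs => by
      obtain ⟨s, rfl⟩ := hs
      exact mem_range_simplexIncl_of_mat_ne_zero R (h k) s s' hne) K (toWord h)
    (PairedWord.toGood (K := K)) (toWord_injective h) PairedWord.toGood_injective (range_toWord h)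
    PairedWord.range_toGood N
  obtain ⟨e''⟩ := (nonempty_matH_good (R := R) K (fun k => (C k).dB) N).1
  exact ⟨(((simplexSystem (polyJoin K X A)).matrixModel R 1).homologyEquiv (N - 1)).trans
    (e.trans (e'.trans e''))⟩

theorem nonempty_redCoH_polyJoin : Nonempty (redCoH R (polyJoin K X A) (N - 1) ≃ₗ[R]
    ∀ y : (∀ k, Σ s, (C k).B s), totCoH R K (wordIdx y) (N - ∑ k, (C k).dB (y k).1 (y k).2)) := by
  obtain ⟨e⟩ := nonempty_matH_congr (congrArg Matrix.transpose (mat_polyJoin (K := K) h R))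
    (p := fun σ => (((simplexSystem (polyJoin K X A)).verts σ).card : ℤ) = N - 1 + 1)
    (p' := fun σ => ∑ k, simplexDeg (X k) (toWord h σ k) = N)
    (fun σ => by rw [sum_simplexDeg_toWord, sub_add_cancel])
  obtain ⟨-, ⟨e'⟩⟩ := PairContraction.nonempty_matH_equiv C
    (fun k => FaceSystem.isHomog_mat R) (fun k s s' hne hs => by
      obtain ⟨s, rfl⟩ := hs
      exact mem_range_simplexIncl_of_mat_ne_zero R (h k) s s' hne) K (toWord h)
    (PairedWord.toGood (K := K)) (toWord_injective h) PairedWord.toGood_injective (range_toWord h)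
    PairedWord.range_toGood N
  obtain ⟨e''⟩ := (nonempty_matH_good (R := R) K (fun k => (C k).dB) N).2
  exact ⟨(((simplexSystem (polyJoin K X A)).dualMatrixModel R 1).homologyEquiv (N - 1)).trans
    (e.trans (e'.trans e''))⟩

end Product


/-! ### The diagonal tensor product -/

section Diag

variable {R : Type u} [CommRing R] {m : ℕ} {B : Fin m → Idx → Type} (dB : ∀ k s, B k s → ℤ)
  {S : Set Idx} (N : ℤ)

/-- The words in bases, sorted by index and degrees. -/
def sortedWordEquiv (hS : ∀ k s, s ∉ S → IsEmpty (B k s)) :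
    (Σ x : Fin m → S, Σ p : {p : ℤ × (Fin m → ℤ) // p.1 + ∑ k, p.2 k = N},
      ∀ k, {b : B k (x k) // dB k (x k) b = p.1.2 k}) ≃ (∀ k, Σ s, B k s) where
  toFun z k := ⟨z.1 k, (z.2.2 k).1⟩
  invFun y := ⟨fun k => ⟨(y k).1, by
      by_contra h
      exact (hS k _ h).false (y k).2⟩,
    ⟨(N - ∑ k, dB k (y k).1 (y k).2, fun k => dB k (y k).1 (y k).2), by simp⟩,
    fun k => ⟨(y k).2, rfl⟩⟩
  left_inv := by
    rintro ⟨x, ⟨⟨a, b⟩, hp⟩, q⟩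
    -- The degrees b and a are determined by the basis elements. Gathering the degree equations into
    -- one family lets both be eliminated by substitution.
    obtain ⟨⟨r, hr⟩, rfl⟩ : ∃ q' : {r : ∀ k, B k (x k) // ∀ k, dB k (x k) (r k) = b k},
        q = fun k => ⟨q'.1 k, q'.2 k⟩ := ⟨⟨fun k => (q k).1, fun k => (q k).2⟩, rfl⟩
    obtain rfl : (fun k => dB k (x k) (r k)) = b := funext hr
    obtain rfl : N - ∑ k, dB k (x k) (r k) = a := by
      dsimp only at hp
      linarith
    rfl
  right_inv y := rfl

variable [∀ k s, Finite (B k s)]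

/-- Tensoring with a free module takes one copy of T for each basis element. The basis tuples over
all indices and degrees are exactly the words, since indices outside `S` carry no basis elements. -/
theorem nonempty_diagTensor_equiv (hS : ∀ k s, s ∉ S → IsEmpty (B k s))
    (T : (Fin m → Idx) → ℤ → ModuleCat.{u} R) (H : Fin m → Idx → ℤ → ModuleCat.{u} R)
    (eH : ∀ k s b, Nonempty (H k s b ≃ₗ[R] ({x : B k s // dB k s x = b} → R))) :
    Nonempty (DiagTensor R S T H N ≃ₗ[R]
      ∀ y : (∀ k, Σ s, B k s), T (wordIdx y) (N - ∑ k, dB k (y k).1 (y k).2)) := by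
  classical
  have e1 : ∀ (x : Fin m → S) (p : {p : ℤ × (Fin m → ℤ) // p.1 + ∑ k, p.2 k = N}),
      Nonempty (((T (fun k => (x k : Idx)) p.1.1) ⊗[R] (⨂[R] k, H k (x k) (p.1.2 k))) ≃ₗ[R]
        ⨁ _ : (∀ k, {b : B k (x k) // dB k (x k) b = p.1.2 k}), T (fun k => (x k : Idx)) p.1.1) := by
    intro x p
    let b := Basis.piTensorProduct fun k => Module.Basis.ofEquivFun (eH k (x k) (p.1.2 k)).some
    exact ⟨(TensorProduct.congr (LinearEquiv.refl R _) b.repr).trans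
      ((TensorProduct.finsuppScalarRight R R _ _).trans (finsuppLequivDFinsupp R))⟩
  let P := {p : ℤ × (Fin m → ℤ) // p.1 + ∑ k, p.2 k = N}
  let Q := fun (x : Fin m → S) (p : P) => ∀ k, {b : B k (x k) // dB k (x k) b = p.1.2 k}
  let M := fun (x : Fin m → S) (p : P) => T (fun k => (x k : Idx)) p.1.1
  have e2 : ∀ x : Fin m → S, Nonempty ((⨁ p : P,
      (T (fun k => (x k : Idx)) p.1.1) ⊗[R] (⨂[R] k, H k (x k) (p.1.2 k))) ≃ₗ[R]
      ⨁ z : (Σ p : P, Q x p), M x z.1) := fun x =>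
    ⟨LinearEquiv.trans (DFinsupp.mapRange.linearEquiv fun p => (e1 x p).some)
      (DirectSum.sigmaLcurryEquiv R (δ := fun p (_ : Q x p) => M x p)).symm⟩
  have e3 : Nonempty (DiagTensor R S T H N ≃ₗ[R]
      ⨁ z : (Σ x : Fin m → S, Σ p : P, Q x p), M z.1 z.2.1) :=
    ⟨LinearEquiv.trans (DFinsupp.mapRange.linearEquiv fun x => (e2 x).some)
      (DirectSum.sigmaLcurryEquiv R (δ := fun x (z : Σ p : P, Q x p) => M x z.1)).symm⟩
  -- There are finitely many words, so the direct sum is a product.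
  have : Fintype (∀ k, Σ s, B k s) := Fintype.ofFinite _
  exact ⟨(e3.some.trans (DirectSum.lequivCongrLeft R (sortedWordEquiv dB N hS))).trans
    (DirectSum.linearEquivFunOnFintype R _
      (fun y : (∀ k, Σ s, B k s) => T (wordIdx y) (N - ∑ k, dB k (y k).1 (y k).2)))⟩

end Diag

/-! ### The homology of polyhedral joins -/

section Main

variable {R : Type u} [CommRing R]

theorem SplitsAs.nonempty_target {M N : Type*} [AddCommGroup M] [AddCommGroup N] [Module R M]
    [Module R N] {f : M →ₗ[R] N} {K C I : Type} (h : SplitsAs f K C I) :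
    Nonempty (N ≃ₗ[R] (C → R) × (I → R)) := by
  obtain ⟨-, e, -⟩ := h
  exact ⟨e.trans (LinearEquiv.sumArrowLequivProdArrow C I R R)⟩

/-- A dependent function on `ℛ` as a pair. -/
def piRREquiv (M : Idx → Type u) [∀ s, AddCommGroup (M s)] [∀ s, Module R (M s)] :
    (∀ s : RR, M s) ≃ₗ[R] M .ker × M .im where
  toFun f := (f ⟨.ker, Or.inr rfl⟩, f ⟨.im, Or.inl rfl⟩)
  invFun p
    | ⟨.coker, h⟩ => absurd h (by simp [RR])
    | ⟨.ker, _⟩ => p.1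
    | ⟨.im, _⟩ => p.2
  map_add' _ _ := rfl
  map_smul' _ _ := rfl
  left_inv f := by
    funext ⟨s, h⟩
    cases s with
    | coker => exact absurd h (by simp [RR])
    | ker => rfl
    | im => rfl
  right_inv _ := rfl

theorem nonempty_directSum_RR_equiv {B : Idx → Type} {H : Idx → ModuleCat.{u} R}
    (e : ∀ s, Nonempty (H s ≃ₗ[R] (B s → R))) :
    Nonempty ((⨁ s : RR, H s) ≃ₗ[R] (B .ker → R) × (B .im → R)) := by
  classical
  have : Fintype RR := Fintype.ofFinite _
  exact ⟨(DirectSum.linearEquivFunOnFintype R RR fun s => H s).trans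
    ((LinearEquiv.piCongrRight fun s : RR => (e s).some).trans (piRREquiv fun s => B s → R))⟩

theorem isEmpty_of_notMem_XX {B : Idx → Type} (s : Idx) (h : s ∉ XX) : IsEmpty (B s) :=
  absurd (Set.mem_univ s) h

theorem isEmpty_of_notMem_RR {B : Idx → Type} (hB : IsEmpty (B .coker)) (s : Idx) (h : s ∉ RR) :
    IsEmpty (B s) := by
  cases s with
  | coker => exact hB
  | ker => exact absurd (Or.inr rfl) h
  | im => exact absurd (Or.inl rfl) h

variable {m : ℕ} {n : Fin m → ℕ} (K : SComplex (Fin m)) {X A : ∀ k : Fin m, SComplex (Fin (n k))}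
  (h : ∀ k, A k ≤ X k)

theorem homologyFormula_of_pairModel [∀ k, DecidableEq (simplexSystem (X k)).Gen]
    (C : ∀ k, PairModel R (h k)) {S : Set Idx} (hS : ∀ k s, s ∉ S → IsEmpty ((C k).B s)) :
    HomologyFormula R K h S := fun N =>
  ⟨(nonempty_redH_polyJoin K C N).some.trans (nonempty_diagTensor_equiv (fun k => (C k).dB) N hS _ _
    fun k s b => PairModel.nonempty_charH (C k) s b).some.symm⟩

theorem cohomologyFormula_of_pairModel [∀ k, DecidableEq (simplexSystem (X k)).Gen]
    (C : ∀ k, PairModel R (h k)) {S : Set Idx} (hS : ∀ k s, s ∉ S → IsEmpty ((C k).B s)) :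
    CohomologyFormula R K h S := fun N =>
  ⟨(nonempty_redCoH_polyJoin K C N).some.trans (nonempty_diagTensor_equiv (fun k => (C k).dB) N hS _ _
    fun k s b => PairModel.nonempty_charCoH (C k) s b).some.symm⟩

theorem joinFormulas_of_isSplit [IsDomain R] [IsPrincipalIdealRing R]
    (hs : ∀ k, IsSplit R (h k)) : JoinFormulas R K h := by
  classical
  let C : ∀ k, PairModel R (h k) := fun k => (nonempty_pairModel R (h k) (hs k)).some
  refine ⟨homologyFormula_of_pairModel K h C fun k => isEmpty_of_notMem_XX,
    cohomologyFormula_of_pairModel K h C fun k => isEmpty_of_notMem_XX, fun hsurj => ?_⟩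
  -- When every ι is onto, the minimal models contain no α, so the same models give the formulas
  -- over ℛ.
  have hS : ∀ k s, s ∉ RR → IsEmpty ((C k).B s) := fun k =>
    isEmpty_of_notMem_RR (PairModel.isEmpty_coker (C k) (hsurj k))
  refine ⟨homologyFormula_of_pairModel K h C hS, cohomologyFormula_of_pairModel K h C hS,
    fun k b => ?_, fun k b => ?_⟩
  · exact ⟨(nonempty_directSum_RR_equiv fun s => PairModel.nonempty_charH (C k) s b).some.trans
      (PairModel.splitsAs_iota (C k) b).nonempty_source.some.symm⟩
  · exact ⟨(nonempty_directSum_RR_equiv fun s => PairModel.nonempty_charCoH (C k) s b).some.trans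
      (PairModel.splitsAs_coIota (C k) b).nonempty_target.some.symm⟩

theorem isSplit_of_field {F : Type u} [Field F] {V : Type} [LinearOrder V] {A X : SComplex V}
    (h : A ≤ X) : IsSplit F h := fun _ =>
  ⟨Module.Free.of_divisionRing _ _, Module.Free.of_divisionRing _ _,
    Module.Free.of_divisionRing _ _⟩

end Main

end PolyJoin

theorem theorem3p9 {m : ℕ} (n : Fin m → ℕ) (K : PolyJoin.SComplex (Fin m))
    (X A : ∀ k : Fin m, PolyJoin.SComplex (Fin (n k))) (hAX : ∀ k, A k ≤ X k) :
    ((∀ k, PolyJoin.IsSplit ℤ (hAX k)) → PolyJoin.JoinFormulas ℤ K hAX) ∧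
    (∀ (F : Type u) [Field F], PolyJoin.JoinFormulas F K hAX) :=
  ⟨fun hs => PolyJoin.joinFormulas_of_isSplit K hAX hs, fun _ _ =>
    PolyJoin.joinFormulas_of_isSplit K hAX fun k => PolyJoin.isSplit_of_field (hAX k)⟩
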